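/- Let $n\ge 2$, let $b\in GL(n,\mathbb{C})$, and let $q\in\mathbb{C}^*$ be not a root of unity, with $\operatorname{tr}(b^t b^{-1})=-(q+q^{-1})$. Let $\mathcal{U}_q(n)^*$ be the quantum group of the nondegenerate bilinear form $b$: the Hopf algebra generated by the entries of an $n\times n$ matrix $L=(L_{ij})$ with relations $L\,b\,L^t=b$ and $L^t b^{-1}L=b^{-1}$, coproduct $\Delta(L_{ij})=\sum_k L_{ik}\otimes L_{kj}$ and counit $\varepsilon(L_{ij})=\delta_{ij}$. Let $\mathcal{U}_q(n)$ be the dual algebra (linear functionals on $\mathcal{U}_q(n)^*$ with the convolution product). A finite-dimensional representation of $\mathcal{U}_q(n)$ means one that comes from a coaction of $\mathcal{U}_q(n)^*$, i.e. a finite-dimensional $\mathcal{U}_q(n)^*$-comodule; tensor products are formed by means of the product of $\mathcal{U}_q(n)^*$. The representation ring is the ring generated by the classes $[V]$ of finite-dimensional representations up to equivalence, with $[V\oplus W]=[V]+[W]$, $[V\otimes W]=[V][W]$, and $[\mathbb{C}]=1$ for the scalar representation. Then there are representations $V_k(n)$, $k=0,1,2,\dots$, of $\mathcal{U}_q(n)$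 such that: 1. $V_0(n)=\mathbb{C}$ is the scalar representation, $V_1(n)=\mathbb{C}^n$ is the fundamental one ($e_j\mapsto\sum_i e_i\otimes L_{ij}$); the $V_k(n)$ are irreducible and pairwise inequivalent, and every irreducible finite-dimensional representation of $\mathcal{U}_q(n)$ is equivalent to one of them; every finite-dimensional representation is completely reducible. 2. $V_1(n)\otimes V_k(n)\cong V_{k+1}(n)\oplus V_{k-1}(n)$ for all $k\ge 0$, where $V_{-1}(n)=0$. 3. There is a ring isomorphism from the representation ring of $\mathcal{U}_q(n)$ to the representation ring of the complex Lie algebra $\mathfrak{sl}_2$ (finite-dimensional representations) that takes $[V_k(n)]$ to the class of the irreducible $(k+1)$-dimensional representation of $\mathfrak{sl}_2$, for every $k\ge 0$. 4. The dimensions $p_k(n)=\dim V_k(n)$ satisfy $n\,p_k(n)=p_{k+1}(n)+p_{k-1}(n)$ for $k\ge 0$, with $p_{-1}(n)=0$, $p_0(n)=1$ (so $p_1(n)=n$). 5. $p_k(n)=U_k(n/2)$, where $U_k$ is the $k$-th Chebyshev polynomial of the second kind. There is $\theta\in\mathbb{C}$ with $n=2\cos\theta$, and for every such $\theta$ with $\sin\theta\neq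 0$ and all $k\ge 0$, $$p_k(n)=\frac{\sin((k+1)\theta)}{\sin\theta}.$$ -/

import Mathlib

open scoped TensorProduct

noncomputable section

/-! ### The quantum group of a nondegenerate bilinear form and its dual algebra -/

namespace BilinearQuantumGroup

variable {n : ℕ}

/-- The free algebra on the entries `L i j` of an `n × n` matrix. -/
abbrev Free (n : ℕ) : Type := FreeAlgebra ℂ (Fin n × Fin n)

/-- The matrix of free generators. -/
def freeL (n : ℕ) (i j : Fin n) : Free n := FreeAlgebra.ι ℂ (i, j)

/-- The entrywise relations `L b Lᵗ = b` and `Lᵗ b⁻¹ L = b⁻¹`.  Together they say that `L` is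
invertible with inverse `b Lᵗ b⁻¹`. -/
inductive Rel (b : GL (Fin n) ℂ) : Free n → Free n → Prop
  | left (i j : Fin n) : Rel b
      (∑ k, ∑ l, algebraMap ℂ (Free n) ((b : Matrix (Fin n) (Fin n) ℂ) k l) *
        (freeL n i k * freeL n j l))
      (algebraMap ℂ (Free n) ((b : Matrix (Fin n) (Fin n) ℂ) i j))
  | right (i j : Fin n) : Rel b
      (∑ k, ∑ l, algebraMap ℂ (Free n) (((b⁻¹ : GL (Fin n) ℂ) : Matrix (Fin n) (Fin n) ℂ) k l) *
        (freeL n k i * freeL n l j))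
      (algebraMap ℂ (Free n) (((b⁻¹ : GL (Fin n) ℂ) : Matrix (Fin n) (Fin n) ℂ) i j))

end BilinearQuantumGroup

/-- The algebra of functions on the quantum group of the nondegenerate bilinear form `b`:
generated by `L i j` subject to `L b Lᵗ = b` and `Lᵗ b⁻¹ L = b⁻¹`. -/
def QuantumGroup {n : ℕ} (b : GL (Fin n) ℂ) : Type := RingQuot (BilinearQuantumGroup.Rel b)

namespace QuantumGroup

variable {n : ℕ} (b : GL (Fin n) ℂ)

instance : Ring (QuantumGroup b) :=
  inferInstanceAs (Ring (RingQuot (BilinearQuantumGroup.Rel b)))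

instance : Algebra ℂ (QuantumGroup b) :=
  inferInstanceAs (Algebra ℂ (RingQuot (BilinearQuantumGroup.Rel b)))

/-- The quotient map from the free algebra. -/
def mk : BilinearQuantumGroup.Free n →ₐ[ℂ] QuantumGroup b :=
  RingQuot.mkAlgHom ℂ (BilinearQuantumGroup.Rel b)

/-- The generators. -/
def L (i j : Fin n) : QuantumGroup b := mk b (BilinearQuantumGroup.freeL n i j)

theorem rel_left (i j : Fin n) :
    ∑ k, ∑ l, (b : Matrix (Fin n) (Fin n) ℂ) k l • (L b i k * L b j l) =
      algebraMap ℂ (QuantumGroup b) ((b : Matrix (Fin n) (Fin n) ℂ) i j) := by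
  have h := RingQuot.mkAlgHom_rel ℂ (BilinearQuantumGroup.Rel.left (b := b) i j)
  change mk b _ = mk b _ at h
  simp only [← Algebra.smul_def, map_sum, map_smul, map_mul, AlgHom.commutes] at h
  exact h

theorem rel_right (i j : Fin n) :
    ∑ k, ∑ l, ((b⁻¹ : GL (Fin n) ℂ) : Matrix (Fin n) (Fin n) ℂ) k l • (L b k i * L b l j) =
      algebraMap ℂ (QuantumGroup b)
        (((b⁻¹ : GL (Fin n) ℂ) : Matrix (Fin n) (Fin n) ℂ) i j) := by
  have h := RingQuot.mkAlgHom_rel ℂ (BilinearQuantumGroup.Rel.right (b := b) i j)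
  change mk b _ = mk b _ at h
  simp only [← Algebra.smul_def, map_sum, map_smul, map_mul, AlgHom.commutes] at h
  exact h

section lift

variable {b} {A : Type*} [Ring A] [Algebra ℂ A]

/-- The universal property of the quantum group. -/
def lift (f : Fin n → Fin n → A)
    (hl : ∀ i j, ∑ k, ∑ l, (b : Matrix (Fin n) (Fin n) ℂ) k l • (f i k * f j l) =
      algebraMap ℂ A ((b : Matrix (Fin n) (Fin n) ℂ) i j))
    (hr : ∀ i j, ∑ k, ∑ l,
        ((b⁻¹ : GL (Fin n) ℂ) : Matrix (Fin n) (Fin n) ℂ) k l • (f k i * f l j) =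
      algebraMap ℂ A (((b⁻¹ : GL (Fin n) ℂ) : Matrix (Fin n) (Fin n) ℂ) i j)) :
    QuantumGroup b →ₐ[ℂ] A :=
  RingQuot.liftAlgHom ℂ ⟨FreeAlgebra.lift ℂ (fun p => f p.1 p.2), by
    intro x y h
    cases h with
    | left i j =>
      simpa [BilinearQuantumGroup.freeL, ← Algebra.smul_def] using hl i j
    | right i j =>
      simpa [BilinearQuantumGroup.freeL, ← Algebra.smul_def] using hr i j⟩

@[simp]
theorem lift_L (f : Fin n → Fin n → A) (hl hr) (i j : Fin n) :
    lift (b := b) f hl hr (L b i j) = f i j := by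
  change RingQuot.liftAlgHom ℂ _ (RingQuot.mkAlgHom ℂ _ _) = _
  rw [RingQuot.liftAlgHom_mkAlgHom_apply]
  simp [BilinearQuantumGroup.freeL]

theorem hom_ext {f g : QuantumGroup b →ₐ[ℂ] A} (h : ∀ i j, f (L b i j) = g (L b i j)) :
    f = g := by
  apply RingQuot.ringQuot_ext'
  apply FreeAlgebra.hom_ext
  funext p
  exact h p.1 p.2

end lift

theorem sum_comm_four {M : Type*} [AddCommMonoid M] (F : Fin n → Fin n → Fin n → Fin n → M) :
    ∑ k, ∑ l, ∑ m, ∑ p, F k l m p = ∑ m, ∑ p, ∑ k, ∑ l, F k l m p := by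
  calc _ = ∑ x : Fin n × Fin n, ∑ y : Fin n × Fin n, F x.1 x.2 y.1 y.2 := by
        simp only [Fintype.sum_prod_type]
    _ = ∑ y : Fin n × Fin n, ∑ x : Fin n × Fin n, F x.1 x.2 y.1 y.2 := Finset.sum_comm
    _ = _ := by simp only [Fintype.sum_prod_type]

/-- `Δ (L i j) = ∑ k, L i k ⊗ L k j`. -/
def comulHom : QuantumGroup b →ₐ[ℂ] QuantumGroup b ⊗[ℂ] QuantumGroup b :=
  lift (fun i j => ∑ k, L b i k ⊗ₜ[ℂ] L b k j)
    (by
      intro i j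
      have h : ∀ k l : Fin n, (b : Matrix (Fin n) (Fin n) ℂ) k l •
          ((∑ m, L b i m ⊗ₜ[ℂ] L b m k) * (∑ p, L b j p ⊗ₜ[ℂ] L b p l)) =
          ∑ m, ∑ p, (L b i m * L b j p) ⊗ₜ[ℂ]
            ((b : Matrix (Fin n) (Fin n) ℂ) k l • (L b m k * L b p l)) := by
        intro k l
        simp only [Finset.sum_mul_sum, Algebra.TensorProduct.tmul_mul_tmul, Finset.smul_sum,
          TensorProduct.tmul_smul]
      calc _ = ∑ m, ∑ p, (L b i m * L b j p) ⊗ₜ[ℂ]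
            (∑ k, ∑ l, (b : Matrix (Fin n) (Fin n) ℂ) k l • (L b m k * L b p l)) := by
            simp only [h, TensorProduct.tmul_sum]
            exact sum_comm_four _
        _ = (∑ m, ∑ p, (b : Matrix (Fin n) (Fin n) ℂ) m p • (L b i m * L b j p)) ⊗ₜ[ℂ] 1 := by
            simp only [rel_left b, Algebra.algebraMap_eq_smul_one (A := QuantumGroup b),
              TensorProduct.tmul_smul, TensorProduct.smul_tmul', ← TensorProduct.sum_tmul]
        _ = _ := by
            rw [rel_left, Algebra.TensorProduct.algebraMap_apply])
    (by
      intro i j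
      have h : ∀ k l : Fin n, ((b⁻¹ : GL (Fin n) ℂ) : Matrix (Fin n) (Fin n) ℂ) k l •
          ((∑ m, L b k m ⊗ₜ[ℂ] L b m i) * (∑ p, L b l p ⊗ₜ[ℂ] L b p j)) =
          ∑ m, ∑ p, (((b⁻¹ : GL (Fin n) ℂ) : Matrix (Fin n) (Fin n) ℂ) k l •
            (L b k m * L b l p)) ⊗ₜ[ℂ] (L b m i * L b p j) := by
        intro k l
        simp only [Finset.sum_mul_sum, Algebra.TensorProduct.tmul_mul_tmul, Finset.smul_sum,
          TensorProduct.smul_tmul']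
      calc _ = ∑ m, ∑ p, (∑ k, ∑ l, ((b⁻¹ : GL (Fin n) ℂ) : Matrix (Fin n) (Fin n) ℂ) k l •
            (L b k m * L b l p)) ⊗ₜ[ℂ] (L b m i * L b p j) := by
            simp only [h, TensorProduct.sum_tmul]
            exact sum_comm_four _
        _ = 1 ⊗ₜ[ℂ] (∑ m, ∑ p, ((b⁻¹ : GL (Fin n) ℂ) : Matrix (Fin n) (Fin n) ℂ) m p •
            (L b m i * L b p j)) := by
            simp only [rel_right b, Algebra.algebraMap_eq_smul_one (A := QuantumGroup b),
              TensorProduct.smul_tmul, ← TensorProduct.tmul_sum]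
        _ = _ := by
            rw [rel_right, Algebra.TensorProduct.algebraMap_apply, Algebra.algebraMap_eq_smul_one,
              TensorProduct.tmul_smul, TensorProduct.smul_tmul'])

/-- `ε (L i j) = δ i j`. -/
def counitHom : QuantumGroup b →ₐ[ℂ] ℂ :=
  lift (fun i j => if i = j then 1 else 0)
    (by intro i j; simp)
    (by intro i j; simp)

@[simp]
theorem comulHom_L (i j : Fin n) :
    comulHom b (L b i j) = ∑ k, L b i k ⊗ₜ[ℂ] L b k j := lift_L _ _ _ _ _

@[simp]
theorem counitHom_L (i j : Fin n) : counitHom b (L b i j) = if i = j then 1 else 0 :=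
  lift_L _ _ _ _ _

instance : Bialgebra ℂ (QuantumGroup b) :=
  Bialgebra.ofAlgHom (comulHom b) (counitHom b)
    (by
      apply hom_ext
      intro i j
      simp [TensorProduct.sum_tmul, TensorProduct.tmul_sum]
      exact Finset.sum_comm)
    (by
      apply hom_ext
      intro i j
      simp [TensorProduct.ite_tmul])
    (by
      apply hom_ext
      intro i j
      simp [TensorProduct.tmul_ite])

theorem comul_L (i j : Fin n) :
    Coalgebra.comul (R := ℂ) (L b i j) = ∑ k, L b i k ⊗ₜ[ℂ] L b k j := comulHom_L b i j

theorem counit_L (i j : Fin n) :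
    Coalgebra.counit (R := ℂ) (L b i j) = if i = j then 1 else 0 := counitHom_L b i j

end QuantumGroup

/-- The quantum algebra: the algebra dual to the coalgebra `QuantumGroup b`, that is the linear
functionals on it with the convolution product `(u * v) a = ∑ u a₍₁₎ * v a₍₂₎`. -/
abbrev QuantumAlgebra {n : ℕ} (b : GL (Fin n) ℂ) : Type := WithConv (QuantumGroup b →ₗ[ℂ] ℂ)

/-! ### Finite-dimensional representations of the quantum algebra -/

/-- A finite-dimensional representation of the quantum algebra, given by a coaction of its dual
bialgebra `QuantumGroup b` (which is a Hopf algebra: `L` is invertible, `S L = b Lᵗ b⁻¹`).  The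
quantum algebra acts by `URep.action`; the coaction says that the matrix coefficients of this action
are elements of `QuantumGroup b`. -/
structure URep {n : ℕ} (b : GL (Fin n) ℂ) where
  carrier : Type
  [addCommGroup : AddCommGroup carrier]
  [module : Module ℂ carrier]
  [finite : Module.Finite ℂ carrier]
  coact : carrier →ₗ[ℂ] carrier ⊗[ℂ] QuantumGroup b
  coassoc : (TensorProduct.assoc ℂ carrier (QuantumGroup b) (QuantumGroup b)).toLinearMap ∘ₗ
    coact.rTensor (QuantumGroup b) ∘ₗ coact =
      (Coalgebra.comul (R := ℂ) (A := QuantumGroup b)).lTensor carrier ∘ₗ coact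
  counit : (TensorProduct.rid ℂ carrier).toLinearMap ∘ₗ
    (Coalgebra.counit (R := ℂ) (A := QuantumGroup b)).lTensor carrier ∘ₗ coact = LinearMap.id

namespace URep

variable {n : ℕ} {b : GL (Fin n) ℂ}

attribute [instance] addCommGroup module finite

/-- The action `u • v = ∑ v₍₀₎ u(v₍₁₎)` of the quantum algebra, as a linear map. -/
def actionLin (V : URep b) (u : QuantumGroup b →ₗ[ℂ] ℂ) : V.carrier →ₗ[ℂ] V.carrier :=
  (TensorProduct.rid ℂ V.carrier).toLinearMap ∘ₗ u.lTensor V.carrier ∘ₗ V.coact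

/-- `v ⊗ (a ⊗ c) ↦ (f a * g c) • v`. -/
def pairing (V : URep b) (f g : QuantumGroup b →ₗ[ℂ] ℂ) :
    V.carrier ⊗[ℂ] (QuantumGroup b ⊗[ℂ] QuantumGroup b) →ₗ[ℂ] V.carrier :=
  (TensorProduct.rid ℂ V.carrier).toLinearMap ∘ₗ
    (LinearMap.mul' ℂ ℂ ∘ₗ TensorProduct.map f g).lTensor V.carrier

theorem actionLin_mul (V : URep b) (u v : QuantumAlgebra b) :
    V.actionLin (u * v).ofConv = V.actionLin u.ofConv ∘ₗ V.actionLin v.ofConv := by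
  have h1 : ∀ z : V.carrier ⊗[ℂ] QuantumGroup b,
      V.actionLin u.ofConv (TensorProduct.rid ℂ _ (v.ofConv.lTensor V.carrier z)) =
        pairing V u.ofConv v.ofConv
          (TensorProduct.assoc ℂ V.carrier (QuantumGroup b) (QuantumGroup b)
            (V.coact.rTensor (QuantumGroup b) z)) := by
    intro z
    induction z using TensorProduct.induction_on with
    | zero => simp
    | add x y hx hy => simp only [map_add, hx, hy]
    | tmul x a =>
      simp only [actionLin, LinearMap.comp_apply, LinearMap.lTensor_tmul, LinearEquiv.coe_coe,
        TensorProduct.rid_tmul, map_smul, LinearMap.rTensor_tmul]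
      generalize V.coact x = y
      induction y using TensorProduct.induction_on with
      | zero => simp
      | add x y hx hy => simp only [map_add, smul_add, TensorProduct.add_tmul, hx, hy]
      | tmul y c => simp [pairing, smul_smul, mul_comm]
  have h2 : ∀ z : V.carrier ⊗[ℂ] QuantumGroup b,
      TensorProduct.rid ℂ _ ((u * v).ofConv.lTensor V.carrier z) =
        pairing V u.ofConv v.ofConv
          ((Coalgebra.comul (R := ℂ) (A := QuantumGroup b)).lTensor V.carrier z) := by
    intro z
    induction z using TensorProduct.induction_on with
    | zero => simp
    | add x y hx hy => simp only [map_add, hx, hy]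
    | tmul x a => simp [pairing, LinearMap.convMul_def]
  ext x
  have h := LinearMap.congr_fun V.coassoc x
  simp only [LinearMap.comp_apply, LinearEquiv.coe_coe] at h
  change TensorProduct.rid ℂ _ ((u * v).ofConv.lTensor V.carrier (V.coact x)) =
    V.actionLin u.ofConv (TensorProduct.rid ℂ _ (v.ofConv.lTensor V.carrier (V.coact x)))
  rw [h1, h2, h]

/-- The action of the quantum algebra on a representation. -/
def action (V : URep b) : QuantumAlgebra b →ₐ[ℂ] Module.End ℂ V.carrier :=
  AlgHom.ofLinearMap
    { toFun := fun u => V.actionLin u.ofConv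
      map_add' := by
        intro u v
        ext x
        simp [actionLin, LinearMap.lTensor_add]
      map_smul' := by
        intro c u
        ext x
        simp [actionLin, LinearMap.lTensor_smul] }
    (by
      have h : (1 : QuantumAlgebra b).ofConv =
          Coalgebra.counit (R := ℂ) (A := QuantumGroup b) := by
        ext a
        rfl
      change V.actionLin (1 : QuantumAlgebra b).ofConv = LinearMap.id
      rw [h]
      exact V.counit)
    (by
      intro u v
      exact V.actionLin_mul u v)

/-- Equivalence of representations. -/
def Equivalent (V W : URep b) : Prop :=
  ∃ f : V.carrier ≃ₗ[ℂ] W.carrier, ∀ (u : QuantumAlgebra b) (x : V.carrier),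
    f (V.action u x) = W.action u (f x)

/-- A subspace is invariant if it is stable under the whole quantum algebra. -/
def IsInvariant (V : URep b) (S : Submodule ℂ V.carrier) : Prop :=
  ∀ (u : QuantumAlgebra b), ∀ x ∈ S, V.action u x ∈ S

/-- Irreducibility: nonzero, without proper nonzero invariant subspaces. -/
def IsIrreducible (V : URep b) : Prop :=
  Nontrivial V.carrier ∧ ∀ S : Submodule ℂ V.carrier, V.IsInvariant S → S = ⊥ ∨ S = ⊤

/-- The scalar representation `v ↦ v ⊗ 1`. -/
def trivial (b : GL (Fin n) ℂ) : URep b where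
  carrier := ℂ
  coact := (TensorProduct.mk ℂ ℂ (QuantumGroup b)).flip 1
  coassoc := by
    ext
    simp [Algebra.TensorProduct.one_def]
  counit := by
    ext
    simp

/-- The fundamental representation on `ℂⁿ`, with coaction `e j ↦ ∑ i, e i ⊗ L i j`. -/
def fundamental (b : GL (Fin n) ℂ) : URep b where
  carrier := Fin n → ℂ
  coact := (Pi.basisFun ℂ (Fin n)).constr ℂ
    fun j => ∑ i, (Pi.single i 1 : Fin n → ℂ) ⊗ₜ[ℂ] QuantumGroup.L b i j
  coassoc := by
    apply (Pi.basisFun ℂ (Fin n)).ext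
    intro j
    simp [QuantumGroup.comul_L, TensorProduct.sum_tmul, TensorProduct.tmul_sum]
    exact Finset.sum_comm
  counit := by
    apply (Pi.basisFun ℂ (Fin n)).ext
    intro j
    simp [QuantumGroup.counit_L]

theorem coassoc_comp {M N : Type} [AddCommGroup M] [Module ℂ M] [AddCommGroup N] [Module ℂ N]
    {f : M →ₗ[ℂ] M ⊗[ℂ] QuantumGroup b} {g : N →ₗ[ℂ] N ⊗[ℂ] QuantumGroup b} (e : M →ₗ[ℂ] N)
    (he : g ∘ₗ e = e.rTensor (QuantumGroup b) ∘ₗ f)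
    (hf : (TensorProduct.assoc ℂ M (QuantumGroup b) (QuantumGroup b)).toLinearMap ∘ₗ
      f.rTensor (QuantumGroup b) ∘ₗ f =
        (Coalgebra.comul (R := ℂ) (A := QuantumGroup b)).lTensor M ∘ₗ f) :
    ((TensorProduct.assoc ℂ N (QuantumGroup b) (QuantumGroup b)).toLinearMap ∘ₗ
      g.rTensor (QuantumGroup b) ∘ₗ g) ∘ₗ e =
        ((Coalgebra.comul (R := ℂ) (A := QuantumGroup b)).lTensor N ∘ₗ g) ∘ₗ e := by
  have h1 : (TensorProduct.assoc ℂ N (QuantumGroup b) (QuantumGroup b)).toLinearMap ∘ₗ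
      (e.rTensor (QuantumGroup b)).rTensor (QuantumGroup b) =
      e.rTensor (QuantumGroup b ⊗[ℂ] QuantumGroup b) ∘ₗ
        (TensorProduct.assoc ℂ M (QuantumGroup b) (QuantumGroup b)).toLinearMap := by
    ext
    simp
  have h2 : (Coalgebra.comul (R := ℂ) (A := QuantumGroup b)).lTensor N ∘ₗ
      e.rTensor (QuantumGroup b) =
      e.rTensor (QuantumGroup b ⊗[ℂ] QuantumGroup b) ∘ₗ
        (Coalgebra.comul (R := ℂ) (A := QuantumGroup b)).lTensor M := by
    ext
    simp
  calc _ = (TensorProduct.assoc ℂ N (QuantumGroup b) (QuantumGroup b)).toLinearMap ∘ₗ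
        (g ∘ₗ e).rTensor (QuantumGroup b) ∘ₗ f := by
        rw [LinearMap.comp_assoc, LinearMap.comp_assoc, LinearMap.rTensor_comp,
          LinearMap.comp_assoc, he]
    _ = e.rTensor (QuantumGroup b ⊗[ℂ] QuantumGroup b) ∘ₗ
        ((TensorProduct.assoc ℂ M (QuantumGroup b) (QuantumGroup b)).toLinearMap ∘ₗ
          f.rTensor (QuantumGroup b) ∘ₗ f) := by
        rw [he, LinearMap.rTensor_comp, LinearMap.comp_assoc, ← LinearMap.comp_assoc, h1,
          LinearMap.comp_assoc]
    _ = _ := by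
        rw [hf, ← LinearMap.comp_assoc, ← h2, LinearMap.comp_assoc, LinearMap.comp_assoc, he]

theorem counit_comp {M N : Type} [AddCommGroup M] [Module ℂ M] [AddCommGroup N] [Module ℂ N]
    {f : M →ₗ[ℂ] M ⊗[ℂ] QuantumGroup b} {g : N →ₗ[ℂ] N ⊗[ℂ] QuantumGroup b} (e : M →ₗ[ℂ] N)
    (he : g ∘ₗ e = e.rTensor (QuantumGroup b) ∘ₗ f)
    (hf : (TensorProduct.rid ℂ M).toLinearMap ∘ₗ
      (Coalgebra.counit (R := ℂ) (A := QuantumGroup b)).lTensor M ∘ₗ f = LinearMap.id) :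
    ((TensorProduct.rid ℂ N).toLinearMap ∘ₗ
      (Coalgebra.counit (R := ℂ) (A := QuantumGroup b)).lTensor N ∘ₗ g) ∘ₗ e =
        LinearMap.id ∘ₗ e := by
  have h : (TensorProduct.rid ℂ N).toLinearMap ∘ₗ
      (Coalgebra.counit (R := ℂ) (A := QuantumGroup b)).lTensor N ∘ₗ
        e.rTensor (QuantumGroup b) =
      e ∘ₗ (TensorProduct.rid ℂ M).toLinearMap ∘ₗ
        (Coalgebra.counit (R := ℂ) (A := QuantumGroup b)).lTensor M := by
    ext
    simp
  calc _ = ((TensorProduct.rid ℂ N).toLinearMap ∘ₗ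
      (Coalgebra.counit (R := ℂ) (A := QuantumGroup b)).lTensor N ∘ₗ
        e.rTensor (QuantumGroup b)) ∘ₗ f := by
        simp only [LinearMap.comp_assoc, he]
    _ = _ := by
        rw [h, LinearMap.comp_assoc, LinearMap.comp_assoc, hf, LinearMap.comp_id,
          LinearMap.id_comp]

/-- The direct sum of representations. -/
def sum (V W : URep b) : URep b where
  carrier := V.carrier × W.carrier
  coact := LinearMap.coprod
    ((LinearMap.inl ℂ V.carrier W.carrier).rTensor (QuantumGroup b) ∘ₗ V.coact)
    ((LinearMap.inr ℂ V.carrier W.carrier).rTensor (QuantumGroup b) ∘ₗ W.coact)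
  coassoc := by
    apply LinearMap.prod_ext
    · exact coassoc_comp _ (by rw [LinearMap.coprod_inl]) V.coassoc
    · exact coassoc_comp _ (by rw [LinearMap.coprod_inr]) W.coassoc
  counit := by
    apply LinearMap.prod_ext
    · exact counit_comp _ (by rw [LinearMap.coprod_inl]) V.counit
    · exact counit_comp _ (by rw [LinearMap.coprod_inr]) W.counit

/-- `(v ⊗ a) ⊗ (w ⊗ c) ↦ (v ⊗ w) ⊗ (a * c)`. -/
def tensorMul {M N A : Type} [AddCommGroup M] [Module ℂ M] [AddCommGroup N] [Module ℂ N]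
    [Ring A] [Algebra ℂ A] :
    (M ⊗[ℂ] A) ⊗[ℂ] (N ⊗[ℂ] A) →ₗ[ℂ] (M ⊗[ℂ] N) ⊗[ℂ] A :=
  (LinearMap.mul' ℂ A).lTensor (M ⊗[ℂ] N) ∘ₗ
    (TensorProduct.tensorTensorTensorComm ℂ M A N A).toLinearMap

/-- The coaction `v ⊗ w ↦ ∑ (v₍₀₎ ⊗ w₍₀₎) ⊗ v₍₁₎ w₍₁₎` on a tensor product. -/
def tensorCoact (V W : URep b) :
    V.carrier ⊗[ℂ] W.carrier →ₗ[ℂ] (V.carrier ⊗[ℂ] W.carrier) ⊗[ℂ] QuantumGroup b :=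
  tensorMul ∘ₗ TensorProduct.map V.coact W.coact

@[simp]
theorem tensorMul_tmul {M N A : Type} [AddCommGroup M] [Module ℂ M] [AddCommGroup N] [Module ℂ N]
    [Ring A] [Algebra ℂ A] (m : M) (a : A) (x : N) (c : A) :
    tensorMul ((m ⊗ₜ[ℂ] a) ⊗ₜ[ℂ] (x ⊗ₜ[ℂ] c)) = (m ⊗ₜ[ℂ] x) ⊗ₜ[ℂ] (a * c) := by
  simp [tensorMul]

theorem tensorCoact_tmul (V W : URep b) (x : V.carrier) (y : W.carrier) :
    tensorCoact V W (x ⊗ₜ[ℂ] y) = tensorMul (V.coact x ⊗ₜ[ℂ] W.coact y) := rfl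

theorem tensorCoact_coassoc_left (V W : URep b) (x : V.carrier ⊗[ℂ] QuantumGroup b)
    (y : W.carrier ⊗[ℂ] QuantumGroup b) :
    TensorProduct.assoc ℂ (V.carrier ⊗[ℂ] W.carrier) (QuantumGroup b) (QuantumGroup b)
        ((tensorCoact V W).rTensor (QuantumGroup b) (tensorMul (x ⊗ₜ[ℂ] y))) =
      tensorMul
        ((TensorProduct.assoc ℂ V.carrier (QuantumGroup b) (QuantumGroup b)
            (V.coact.rTensor (QuantumGroup b) x)) ⊗ₜ[ℂ]
          (TensorProduct.assoc ℂ W.carrier (QuantumGroup b) (QuantumGroup b)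
            (W.coact.rTensor (QuantumGroup b) y))) := by
  induction x using TensorProduct.induction_on with
  | zero => simp
  | add x x' hx hx' => simp only [map_add, TensorProduct.add_tmul, hx, hx']
  | tmul v a =>
    induction y using TensorProduct.induction_on with
    | zero => simp
    | add y y' hy hy' => simp only [map_add, TensorProduct.tmul_add, hy, hy']
    | tmul w c =>
      simp only [tensorMul_tmul, LinearMap.rTensor_tmul, tensorCoact_tmul]
      generalize V.coact v = x
      generalize W.coact w = y
      induction x using TensorProduct.induction_on with
      | zero => simp
      | add x x' hx hx' => simp only [map_add, TensorProduct.add_tmul, hx, hx']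
      | tmul v' a' =>
        induction y using TensorProduct.induction_on with
        | zero => simp
        | add y y' hy hy' =>
          simp only [map_add, TensorProduct.tmul_add, TensorProduct.add_tmul, hy, hy']
        | tmul w' c' => simp

theorem tensorCoact_coassoc_right (V W : URep b) (x : V.carrier ⊗[ℂ] QuantumGroup b)
    (y : W.carrier ⊗[ℂ] QuantumGroup b) :
    (Coalgebra.comul (R := ℂ) (A := QuantumGroup b)).lTensor (V.carrier ⊗[ℂ] W.carrier)
        (tensorMul (x ⊗ₜ[ℂ] y)) =
      tensorMul
        (((Coalgebra.comul (R := ℂ) (A := QuantumGroup b)).lTensor V.carrier x) ⊗ₜ[ℂ]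
          ((Coalgebra.comul (R := ℂ) (A := QuantumGroup b)).lTensor W.carrier y)) := by
  induction x using TensorProduct.induction_on with
  | zero => simp
  | add x x' hx hx' => simp only [map_add, TensorProduct.add_tmul, hx, hx']
  | tmul v a =>
    induction y using TensorProduct.induction_on with
    | zero => simp
    | add y y' hy hy' => simp only [map_add, TensorProduct.tmul_add, hy, hy']
    | tmul w c => simp

theorem tensorCoact_counit (V W : URep b) (x : V.carrier ⊗[ℂ] QuantumGroup b)
    (y : W.carrier ⊗[ℂ] QuantumGroup b) :
    TensorProduct.rid ℂ (V.carrier ⊗[ℂ] W.carrier)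
        ((Coalgebra.counit (R := ℂ) (A := QuantumGroup b)).lTensor (V.carrier ⊗[ℂ] W.carrier)
          (tensorMul (x ⊗ₜ[ℂ] y))) =
      (TensorProduct.rid ℂ V.carrier
          ((Coalgebra.counit (R := ℂ) (A := QuantumGroup b)).lTensor V.carrier x)) ⊗ₜ[ℂ]
        (TensorProduct.rid ℂ W.carrier
          ((Coalgebra.counit (R := ℂ) (A := QuantumGroup b)).lTensor W.carrier y)) := by
  induction x using TensorProduct.induction_on with
  | zero => simp
  | add x x' hx hx' => simp only [map_add, TensorProduct.add_tmul, hx, hx']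
  | tmul v a =>
    induction y using TensorProduct.induction_on with
    | zero => simp
    | add y y' hy hy' => simp only [map_add, TensorProduct.tmul_add, hy, hy']
    | tmul w c => simp [TensorProduct.smul_tmul', TensorProduct.tmul_smul, smul_smul, mul_comm]

/-- The tensor product of representations. -/
def tensor (V W : URep b) : URep b where
  carrier := V.carrier ⊗[ℂ] W.carrier
  coact := tensorCoact V W
  coassoc := by
    apply TensorProduct.ext'
    intro x y
    have hx := LinearMap.congr_fun V.coassoc x
    have hy := LinearMap.congr_fun W.coassoc y
    simp only [LinearMap.comp_apply, LinearEquiv.coe_coe] at hx hy ⊢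
    rw [tensorCoact_tmul, tensorCoact_coassoc_left, tensorCoact_coassoc_right, hx, hy]
  counit := by
    apply TensorProduct.ext'
    intro x y
    have hx := LinearMap.congr_fun V.counit x
    have hy := LinearMap.congr_fun W.counit y
    simp only [LinearMap.comp_apply, LinearEquiv.coe_coe, LinearMap.id_apply] at hx hy ⊢
    rw [tensorCoact_tmul, tensorCoact_counit, hx, hy]

end URep

/-! ### Finite-dimensional representations of `sl₂` -/

/-- A finite-dimensional representation of the complex Lie algebra `sl₂`. -/
structure SlRep where
  carrier : Type
  [addCommGroup : AddCommGroup carrier]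
  [module : Module ℂ carrier]
  [finite : Module.Finite ℂ carrier]
  [lieRingModule : LieRingModule (LieAlgebra.SpecialLinear.sl (Fin 2) ℂ) carrier]
  [lieModule : LieModule ℂ (LieAlgebra.SpecialLinear.sl (Fin 2) ℂ) carrier]

namespace SlRep

attribute [instance] addCommGroup module finite lieRingModule lieModule

/-- Equivalence of representations. -/
def Equivalent (V W : SlRep) : Prop :=
  Nonempty (V.carrier ≃ₗ⁅ℂ, LieAlgebra.SpecialLinear.sl (Fin 2) ℂ⁆ W.carrier)

/-- Irreducibility (nonzero, without proper nonzero submodules). -/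
def IsIrreducible (V : SlRep) : Prop :=
  LieModule.IsIrreducible ℂ (LieAlgebra.SpecialLinear.sl (Fin 2) ℂ) V.carrier

/-- The one-dimensional representation with zero action. -/
def trivial : SlRep :=
  letI : LieRingModule (LieAlgebra.SpecialLinear.sl (Fin 2) ℂ) ℂ :=
    { bracket := fun _ _ => 0
      add_lie := by intros; exact (add_zero 0).symm
      lie_add := by intros; exact (add_zero 0).symm
      leibniz_lie := by intros; exact (add_zero 0).symm }
  letI : LieModule ℂ (LieAlgebra.SpecialLinear.sl (Fin 2) ℂ) ℂ :=
    { smul_lie := by intro t x m; exact (smul_zero t).symm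
      lie_smul := by intro t x m; exact (smul_zero t).symm }
  { carrier := ℂ }

/-- The direct sum of representations, with `⁅x, (v, w)⁆ = (⁅x, v⁆, ⁅x, w⁆)`. -/
def sum (V W : SlRep) : SlRep :=
  letI : LieRingModule (LieAlgebra.SpecialLinear.sl (Fin 2) ℂ) (V.carrier × W.carrier) :=
    { bracket := fun x p => (⁅x, p.1⁆, ⁅x, p.2⁆)
      add_lie := by intro x y m; exact Prod.ext (add_lie x y m.1) (add_lie x y m.2)
      lie_add := by intro x m m'; exact Prod.ext (lie_add x m.1 m'.1) (lie_add x m.2 m'.2)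
      leibniz_lie := by
        intro x y m; exact Prod.ext (leibniz_lie x y m.1) (leibniz_lie x y m.2) }
  letI : LieModule ℂ (LieAlgebra.SpecialLinear.sl (Fin 2) ℂ) (V.carrier × W.carrier) :=
    { smul_lie := by intro t x m; exact Prod.ext (smul_lie t x m.1) (smul_lie t x m.2)
      lie_smul := by intro t x m; exact Prod.ext (lie_smul t x m.1) (lie_smul t x m.2) }
  { carrier := V.carrier × W.carrier }

/-- The tensor product of representations, with `⁅x, v ⊗ w⁆ = ⁅x, v⁆ ⊗ w + v ⊗ ⁅x, w⁆`. -/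
def tensor (V W : SlRep) : SlRep where
  carrier := V.carrier ⊗[ℂ] W.carrier

end SlRep

/-! ### Representation rings -/

/-- The defining relations of the representation ring of a class `X` of representations. -/
inductive RepRingRel {X : Type 1} (iso : X → X → Prop) (sum tensor : X → X → X) (one : X) :
    FreeAlgebra ℤ X → FreeAlgebra ℤ X → Prop
  | iso {V W : X} (h : iso V W) :
      RepRingRel iso sum tensor one (FreeAlgebra.ι ℤ V) (FreeAlgebra.ι ℤ W)
  | sum (V W : X) : RepRingRel iso sum tensor one
      (FreeAlgebra.ι ℤ (sum V W)) (FreeAlgebra.ι ℤ V + FreeAlgebra.ι ℤ W)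
  | tensor (V W : X) : RepRingRel iso sum tensor one
      (FreeAlgebra.ι ℤ (tensor V W)) (FreeAlgebra.ι ℤ V * FreeAlgebra.ι ℤ W)
  | one : RepRingRel iso sum tensor one (FreeAlgebra.ι ℤ one) 1

/-- The representation ring: the ring generated by the symbols `[V]`, with `[V] = [W]` for
equivalent `V` and `W`, `[V ⊕ W] = [V] + [W]`, `[V ⊗ W] = [V] [W]` and `[1] = 1`.  Equivalently:
the free abelian group on equivalence classes modulo `[V ⊕ W] = [V] + [W]`, multiplied
by means of the tensor product. -/
abbrev RepRing {X : Type 1} (iso : X → X → Prop) (sum tensor : X → X → X) (one : X) : Type 1 :=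
  RingQuot (RepRingRel iso sum tensor one)

/-- The representation ring of the quantum algebra. -/
abbrev URepRing {n : ℕ} (b : GL (Fin n) ℂ) : Type 1 :=
  RepRing (X := URep b) URep.Equivalent URep.sum URep.tensor (URep.trivial b)

/-- The class of a representation of the quantum algebra in its representation ring. -/
def URep.cls {n : ℕ} {b : GL (Fin n) ℂ} (V : URep b) : URepRing b :=
  RingQuot.mkRingHom _ (FreeAlgebra.ι ℤ V)

/-- The representation ring of the Lie algebra `sl₂`. -/
abbrev SlRepRing : Type 1 :=
  RepRing (X := SlRep) SlRep.Equivalent SlRep.sum SlRep.tensor SlRep.trivial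

/-- The class of a representation of `sl₂` in its representation ring. -/
def SlRep.cls (V : SlRep) : SlRepRing :=
  RingQuot.mkRingHom _ (FreeAlgebra.ι ℤ V)

end

/-! The form `b` gives an invariant vector of `V ⊗ V`, where `V = ℂⁿ`, and `b⁻¹` gives an invariant
functional on it; together they generate an image of the Temperley–Lieb category with loop parameter
`δ = tr(bᵗ b⁻¹) = -(q + q⁻¹)`. As `q` is not a root of unity, all Jones–Wenzl projections exist. The
next irreducible representation is the kernel of the contraction `V ⊗ X (m + 1) → X m`, which is
complementary to the image of `X m → V ⊗ X (m + 1)` as soon as the composite `X m → V ⊗ X (m + 1) →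
X m`, a scalar `γ m`, is nonzero. The scalars satisfy `γ 1 = δ` and `γ (m + 2) = δ - (γ (m + 1))⁻¹`,
whence `γ m = -[m + 1] / [m]` in quantum integers for `m ≥ 1`. A `Ladder` records these spaces by
the components `up` and `dn` of the projections and inclusions, with `X 0 = 0` and `X (k + 1) =
V_k`.

The crux is that the quantum algebra is the full product `∏ End (X m)`. For a family `φ` of
endomorphisms, the decomposition `V ⊗ X (m + 1) = X (m + 2) ⊕ X m` prescribes what precomposition
with multiplication by a generator must do to `φ` (`rmul`). The ladder relations imply the defining
relations of the quantum group for these operators, so its universal property yields a functional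
that acts on every `X m` by `φ m` (`contract_functional`). Conversely, multiplying a matrix
coefficient by a generator moves the index `m` by one (`tensorAct_L_coact`), so every element of the
quantum group is a combination of matrix coefficients of finitely many `X m`, and a functional is
determined by its action on them (`functional_ext`). Matrix units then give irreducibility,
inequivalence, complete reducibility and the classification.

The representation rings are compared through a third ring: each is `ℤ[X]`, with the class of index
`k` corresponding to the rescaled Chebyshev polynomial `S k` (`exists_chebyshev_ringEquiv`). This
requires that the classes of the irreducibles span, are independent, and satisfy the Clebsch–Gordan
recursion. For the quantum algebra, independence follows by evaluating characters at matrix units.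
For `sl₂`, an irreducible summand is split off by a highest weight vector together with a functional
of the same weight, and the rest follows from the formal character `tr exp(t h)`. The dimensions
follow from the Clebsch–Gordan rule. -/

noncomputable section

/-! ### Ladders and their construction by Jones–Wenzl projections -/

/-- A sequence of spaces `X m` with raising and lowering operators, satisfying the relations of the
morphisms `V ⊗ X m → X (m + 1)` and `X (m + 1) → V ⊗ X m` between the irreducible representations
`X 1 = ℂ`, `X 2 = V`, ... of the quantum group of the bilinear form `b`. -/
structure Ladder {n : ℕ} (b : GL (Fin n) ℂ) where
  X : ℕ → Type
  [addCommGroup : ∀ m, AddCommGroup (X m)]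
  [module : ∀ m, Module ℂ (X m)]
  [finite : ∀ m, Module.Finite ℂ (X m)]
  -- The zero space before the scalar representation makes `V ⊗ X (m + 1) ≃ X (m + 2) ⊕ X m` uniform
  -- in `m`.
  [subsingleton : Subsingleton (X 0)]
  vac : X 1 ≃ₗ[ℂ] ℂ
  up : ∀ m, Fin n → X m →ₗ[ℂ] X (m + 1)
  dn : ∀ m, Fin n → X (m + 1) →ₗ[ℂ] X m
  -- The scalar of `X m → V ⊗ X (m + 1) → X m`, see `cap_cup`. For `m = 0` that relation is empty,
  -- and `γ 0` is an arbitrary nonzero number.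
  γ : ℕ → ℂ
  γ_ne : ∀ m, γ m ≠ 0
  dn_up' : ∀ m k l (x : X (m + 1)), dn (m + 1) k (up (m + 1) l x) = (if k = l then x else 0) -
    (γ m)⁻¹ • ∑ i, (b : Matrix (Fin n) (Fin n) ℂ) k i •
      up m i (∑ j, ((b⁻¹ : GL (Fin n) ℂ) : Matrix (Fin n) (Fin n) ℂ) l j • dn m j x)
  -- The index starts at `m + 2`: on `X 1` the sum factors through `X 0 = 0`, and the relation
  -- fails.
  up_dn : ∀ m (x : X (m + 2)), ∑ l, up (m + 1) l (dn (m + 1) l x) = x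
  up_up : ∀ m (x : X m), ∑ k, ∑ l, (b : Matrix (Fin n) (Fin n) ℂ) k l •
    up (m + 1) k (up m l x) = 0
  dn_dn : ∀ m (x : X (m + 2)), ∑ k, ∑ l,
    ((b⁻¹ : GL (Fin n) ℂ) : Matrix (Fin n) (Fin n) ℂ) k l • dn m l (dn (m + 1) k x) = 0
  cap_cup : ∀ m (x : X m), ∑ k, ∑ j, ((b⁻¹ : GL (Fin n) ℂ) : Matrix (Fin n) (Fin n) ℂ) k j •
    dn m j (∑ i, (b : Matrix (Fin n) (Fin n) ℂ) k i • up m i x) = γ m • x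

/-- Two consecutive spaces of a ladder. -/
structure LadderStage (n : ℕ) where
  U : Type
  W : Type
  [addCommGroupU : AddCommGroup U]
  [moduleU : Module ℂ U]
  [finiteU : Module.Finite ℂ U]
  [addCommGroupW : AddCommGroup W]
  [moduleW : Module ℂ W]
  [finiteW : Module.Finite ℂ W]
  up : Fin n → U →ₗ[ℂ] W
  dn : Fin n → W →ₗ[ℂ] U

theorem GL_sum_inv_mul {n : ℕ} (b : GL (Fin n) ℂ) (k j : Fin n) :
    ∑ l, ((b⁻¹ : GL (Fin n) ℂ) : Matrix (Fin n) (Fin n) ℂ) k l *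
      (b : Matrix (Fin n) (Fin n) ℂ) l j = if k = j then 1 else 0 := by
  rw [← Matrix.mul_apply, ← Units.val_mul, inv_mul_cancel, Units.val_one, Matrix.one_apply]

theorem GL_sum_mul_inv {n : ℕ} (b : GL (Fin n) ℂ) (k j : Fin n) :
    ∑ l, (b : Matrix (Fin n) (Fin n) ℂ) k l *
      ((b⁻¹ : GL (Fin n) ℂ) : Matrix (Fin n) (Fin n) ℂ) l j = if k = j then 1 else 0 := by
  rw [← Matrix.mul_apply, ← Units.val_mul, mul_inv_cancel, Units.val_one, Matrix.one_apply]

theorem sum_smul_sum_smul {n : ℕ} {M : Type*} [AddCommGroup M] [Module ℂ M]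
    (P Q : Matrix (Fin n) (Fin n) ℂ) (h : ∀ i j, ∑ k, P i k * Q k j = if i = j then 1 else 0)
    (i : Fin n) (v : Fin n → M) : ∑ k, P i k • ∑ j, Q k j • v j = v i := by
  simp only [Finset.smul_sum, smul_smul]
  rw [Finset.sum_comm]
  simp only [← Finset.sum_smul, h]
  simp

/-- The recursion for the loop scalars: one strand of a Jones–Wenzl projection is closed up by means
of `b` and `b⁻¹`. The identity term contributes the loop `δ`; in the correction term `b` and `b⁻¹`
cancel and leave `∑ up l ∘ dn l = ε`. -/
theorem sum_dn_sum_up {n : ℕ} (b : GL (Fin n) ℂ) {U W Z : Type*} [AddCommGroup U] [Module ℂ U]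
    [AddCommGroup W] [Module ℂ W] [AddCommGroup Z] [Module ℂ Z]
    (up : Fin n → U →ₗ[ℂ] W) (dn : Fin n → W →ₗ[ℂ] U) (up' : Fin n → W →ₗ[ℂ] Z)
    (dn' : Fin n → Z →ₗ[ℂ] W) (g : ℂ)
    (h : ∀ k l w, dn' k (up' l w) = (if k = l then w else 0) -
      g⁻¹ • ∑ i, (b : Matrix (Fin n) (Fin n) ℂ) k i •
        up i (∑ j, ((b⁻¹ : GL (Fin n) ℂ) : Matrix (Fin n) (Fin n) ℂ) l j • dn j w))
    {δ ε : ℂ} (hδ : ∑ k, ∑ j, ((b⁻¹ : GL (Fin n) ℂ) :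
      Matrix (Fin n) (Fin n) ℂ) k j * (b : Matrix (Fin n) (Fin n) ℂ) k j = δ)
    (hε : ∀ w, ∑ l, up l (dn l w) = ε • w) (w : W) :
    ∑ k, ∑ j, ((b⁻¹ : GL (Fin n) ℂ) : Matrix (Fin n) (Fin n) ℂ) k j •
      dn' j (∑ i, (b : Matrix (Fin n) (Fin n) ℂ) k i • up' i w) = (δ - g⁻¹ * ε) • w := by
  have h0 : ∀ k j : Fin n, dn' j (∑ i, (b : Matrix (Fin n) (Fin n) ℂ) k i • up' i w) =
      (b : Matrix (Fin n) (Fin n) ℂ) k j • w -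
        ∑ a, (b : Matrix (Fin n) (Fin n) ℂ) j a • g⁻¹ • up a (dn k w) := by
    intro k j
    simp only [map_sum, map_smul, h, smul_sub, Finset.sum_sub_distrib, smul_ite, smul_zero,
      Finset.sum_ite_eq, Finset.mem_univ, if_true]
    congr 1
    have h3 : ∀ a : Fin n, up a (dn k w) = ∑ i, (b : Matrix (Fin n) (Fin n) ℂ) k i •
        ∑ c, ((b⁻¹ : GL (Fin n) ℂ) : Matrix (Fin n) (Fin n) ℂ) i c • up a (dn c w) :=
      fun a => (sum_smul_sum_smul _ _ (GL_sum_mul_inv b) k (fun c => up a (dn c w))).symm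
    simp only [h3, Finset.smul_sum]
    rw [Finset.sum_comm]
    refine Finset.sum_congr rfl fun a _ => Finset.sum_congr rfl fun i _ =>
      Finset.sum_congr rfl fun c _ => ?_
    simp only [smul_smul]
    congr 1
    ring
  simp only [h0, smul_sub, Finset.sum_sub_distrib, sum_smul_sum_smul _ _ (GL_sum_inv_mul b)]
  rw [← Finset.smul_sum, hε]
  simp only [smul_smul, ← Finset.sum_smul, hδ, sub_smul]

namespace LadderStage

attribute [instance] addCommGroupU moduleU finiteU addCommGroupW moduleW finiteW

variable {n : ℕ} (b : GL (Fin n) ℂ)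

/-- `x ↦ (v ↦ β ⊗ x)`, projected to `V ⊗ W`. -/
def cup (S : LadderStage n) : S.U →ₗ[ℂ] (Fin n → S.W) :=
  LinearMap.pi fun k => ∑ i, (b : Matrix (Fin n) (Fin n) ℂ) k i • S.up i

/-- The contraction `V ⊗ W ⊆ V ⊗ V ⊗ U → U` with the inverse form. -/
def cap (S : LadderStage n) : (Fin n → S.W) →ₗ[ℂ] S.U :=
  ∑ k, (∑ j, ((b⁻¹ : GL (Fin n) ℂ) : Matrix (Fin n) (Fin n) ℂ) k j • S.dn j) ∘ₗ LinearMap.proj k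

theorem cup_apply (S : LadderStage n) (x : S.U) (k : Fin n) :
    S.cup b x k = ∑ i, (b : Matrix (Fin n) (Fin n) ℂ) k i • S.up i x := by
  simp [cup]

theorem cap_apply (S : LadderStage n) (f : Fin n → S.W) :
    S.cap b f = ∑ k, ∑ j, ((b⁻¹ : GL (Fin n) ℂ) : Matrix (Fin n) (Fin n) ℂ) k j •
      S.dn j (f k) := by
  simp [cap, LinearMap.sum_apply]

theorem cap_single (S : LadderStage n) (l : Fin n) (w : S.W) :
    S.cap b (Pi.single l w) = ∑ j, ((b⁻¹ : GL (Fin n) ℂ) : Matrix (Fin n) (Fin n) ℂ) l j •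
      S.dn j w := by
  rw [cap_apply, Finset.sum_eq_single l]
  · simp
  · intro k _ hk
    simp [hk]
  · simp

/-- The projection onto the kernel of `cap`, if `cap ∘ cup = g`. -/
def jw (S : LadderStage n) (g : ℂ) : (Fin n → S.W) →ₗ[ℂ] (Fin n → S.W) :=
  LinearMap.id - g⁻¹ • S.cup b ∘ₗ S.cap b

/-- The next stage of a ladder. -/
abbrev next (S : LadderStage n) (g : ℂ) : LadderStage n where
  U := S.W
  -- This is the kernel of `cap` when `cap ∘ cup = g ≠ 0`. As a range it makes sense for every `g`,
  -- and the raising operators are corestrictions that need no proof.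
  W := LinearMap.range (S.jw b g)
  up l := (S.jw b g).rangeRestrict ∘ₗ LinearMap.single ℂ (fun _ => S.W) l
  dn k := LinearMap.proj k ∘ₗ (LinearMap.range (S.jw b g)).subtype

/-- The stage `0 → ℂ`. -/
def zero (n : ℕ) : LadderStage n where
  U := PUnit
  W := ℂ
  up _ := 0
  dn _ := 0

variable {b} {S : LadderStage n} {g : ℂ}

theorem jw_apply (f : Fin n → S.W) : S.jw b g f = f - g⁻¹ • S.cup b (S.cap b f) := rfl

theorem jw_cup (hg : g ≠ 0) (h : ∀ x, S.cap b (S.cup b x) = g • x) (x : S.U) :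
    S.jw b g (S.cup b x) = 0 := by
  rw [jw_apply, h, map_smul, smul_smul, inv_mul_cancel₀ hg, one_smul, sub_self]

theorem cap_jw (hg : g ≠ 0) (h : ∀ x, S.cap b (S.cup b x) = g • x) (f : Fin n → S.W) :
    S.cap b (S.jw b g f) = 0 := by
  rw [jw_apply, map_sub, map_smul, h, smul_smul, inv_mul_cancel₀ hg, one_smul, sub_self]

theorem next_dn_up (k l : Fin n) (w : S.W) :
    (S.next b g).dn k ((S.next b g).up l w) = (if k = l then w else 0) -
    g⁻¹ • ∑ i, (b : Matrix (Fin n) (Fin n) ℂ) k i •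
      S.up i (∑ j, ((b⁻¹ : GL (Fin n) ℂ) : Matrix (Fin n) (Fin n) ℂ) l j • S.dn j w) := by
  change (S.jw b g (Pi.single l w)) k = _
  rw [jw_apply, Pi.sub_apply, Pi.smul_apply, cup_apply, cap_single, Pi.single_apply]

theorem next_cap (hg : g ≠ 0) (h : ∀ x, S.cap b (S.cup b x) = g • x) (f : (S.next b g).W) :
    S.cap b (fun k => (S.next b g).dn k f) = 0 := by
  obtain ⟨_, f, rfl⟩ := f
  exact cap_jw hg h f

theorem next_up_dn (hg : g ≠ 0) (h : ∀ x, S.cap b (S.cup b x) = g • x) (f : (S.next b g).W) :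
    ∑ l, (S.next b g).up l ((S.next b g).dn l f) = f := by
  have h0 := next_cap hg h f
  apply Subtype.ext
  have : ((∑ l, (S.next b g).up l ((S.next b g).dn l f) : (S.next b g).W) : Fin n → S.W) =
      S.jw b g (∑ l, Pi.single l (f.1 l)) := by
    rw [map_sum]
    exact AddSubmonoidClass.coe_finsetSum _ _
  rw [this, Finset.univ_sum_single, jw_apply]
  change S.cap b f.1 = 0 at h0
  rw [h0, map_zero, smul_zero, sub_zero]

theorem next_up_up (hg : g ≠ 0) (h : ∀ x, S.cap b (S.cup b x) = g • x) (x : S.U) :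
    ∑ k, ∑ l, (b : Matrix (Fin n) (Fin n) ℂ) k l • (S.next b g).up k (S.up l x) = 0 := by
  have : ∑ k, ∑ l, (b : Matrix (Fin n) (Fin n) ℂ) k l • (S.next b g).up k (S.up l x) =
      (S.jw b g).rangeRestrict (∑ k, Pi.single k (S.cup b x k)) := by
    rw [map_sum]
    refine Finset.sum_congr rfl fun k _ => ?_
    rw [cup_apply]
    change _ = (S.next b g).up k _
    rw [map_sum]
    simp only [map_smul]
  rw [this, Finset.univ_sum_single]
  exact Subtype.ext (jw_cup hg h x)

theorem next_cap_cup {δ ε : ℂ} (hδ : ∑ k, ∑ j, ((b⁻¹ : GL (Fin n) ℂ) :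
      Matrix (Fin n) (Fin n) ℂ) k j * (b : Matrix (Fin n) (Fin n) ℂ) k j = δ)
    (hε : ∀ w, ∑ l, S.up l (S.dn l w) = ε • w) (w : S.W) :
    (S.next b g).cap b ((S.next b g).cup b w) = (δ - g⁻¹ * ε) • w := by
  rw [cap_apply, ← sum_dn_sum_up b S.up S.dn (S.next b g).up (S.next b g).dn g next_dn_up hδ hε w]
  refine Finset.sum_congr rfl fun k _ => Finset.sum_congr rfl fun j _ => ?_
  rw [cup_apply]

end LadderStage

namespace Ladder

variable {n : ℕ} (b : GL (Fin n) ℂ) (g : ℕ → ℂ)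

/-- The stages of a ladder. -/
def stage : ℕ → LadderStage n
  | 0 => LadderStage.zero n
  | m + 1 => (stage m).next b (g m)

/-- The two claims feed each other: the first at `m` gives the second at `m + 1`, and the second at
`m` gives the first at `m + 1`. The exceptional scalar `0` at the stage `0 → ℂ` is what makes `γ 1 =
δ`. -/
theorem stage_cap_cup {δ : ℂ} (hδ : ∑ k, ∑ j, ((b⁻¹ : GL (Fin n) ℂ) :
      Matrix (Fin n) (Fin n) ℂ) k j * (b : Matrix (Fin n) (Fin n) ℂ) k j = δ)
    (hg : ∀ m, g m ≠ 0) (hg1 : g 1 = δ) (hg2 : ∀ m, g (m + 2) = δ - (g (m + 1))⁻¹) (m : ℕ) :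
    (∀ x, (stage b g m).cap b ((stage b g m).cup b x) = g m • x) ∧
    (∀ x, ∑ l, (stage b g m).up l ((stage b g m).dn l x) =
      (if m = 0 then (0 : ℂ) else 1) • x) := by
  induction m with
  | zero => exact ⟨fun x => Subsingleton.elim (α := PUnit) _ _,
      fun x => by
        rw [if_pos rfl, zero_smul]
        exact Finset.sum_eq_zero fun _ _ => rfl⟩
  | succ m ih =>
    refine ⟨fun x => ?_, fun x => ?_⟩
    · refine (LadderStage.next_cap_cup hδ ih.2 x).trans ?_
      congr 1
      cases m with
      | zero => simp [hg1]
      | succ m => simp [hg2]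
    · rw [if_neg (Nat.succ_ne_zero m), one_smul]
      exact LadderStage.next_up_dn (hg m) ih.1 x

/-- The ladder of a bilinear form of generic loop parameter. -/
def mk' {δ : ℂ} (hδ : ∑ k, ∑ j, ((b⁻¹ : GL (Fin n) ℂ) :
      Matrix (Fin n) (Fin n) ℂ) k j * (b : Matrix (Fin n) (Fin n) ℂ) k j = δ)
    (hg : ∀ m, g m ≠ 0) (hg1 : g 1 = δ) (hg2 : ∀ m, g (m + 2) = δ - (g (m + 1))⁻¹) :
    Ladder b where
  X m := (stage b g m).U
  subsingleton := inferInstanceAs (Subsingleton PUnit)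
  vac := LinearEquiv.refl ℂ ℂ
  up m := (stage b g m).up
  dn m := (stage b g m).dn
  γ := g
  γ_ne := hg
  dn_up' m := LadderStage.next_dn_up
  up_dn m := LadderStage.next_up_dn (hg m) (stage_cap_cup b g hδ hg hg1 hg2 m).1
  up_up m := LadderStage.next_up_up (hg m) (stage_cap_cup b g hδ hg hg1 hg2 m).1
  dn_dn m x := by
    exact (LadderStage.cap_apply b (stage b g m) _).symm.trans
      (LadderStage.next_cap (hg m) (stage_cap_cup b g hδ hg hg1 hg2 m).1 x)
  cap_cup m x := by
    have h := (stage_cap_cup b g hδ hg hg1 hg2 m).1 x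
    rw [LadderStage.cap_apply] at h
    simp only [LadderStage.cup_apply] at h
    exact h

end Ladder

/-! ### Identities between raising and lowering operators -/

namespace Ladder

attribute [instance] addCommGroup module finite subsingleton

variable {n : ℕ} {b : GL (Fin n) ℂ} (Λ : Ladder b)

/-- The raising operators transposed by means of `b`. -/
def upt (m : ℕ) (k : Fin n) : Λ.X m →ₗ[ℂ] Λ.X (m + 1) :=
  ∑ i, (b : Matrix (Fin n) (Fin n) ℂ) k i • Λ.up m i

/-- The lowering operators transposed by means of `b⁻¹`. -/
def dnt (m : ℕ) (l : Fin n) : Λ.X (m + 1) →ₗ[ℂ] Λ.X m :=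
  ∑ j, ((b⁻¹ : GL (Fin n) ℂ) : Matrix (Fin n) (Fin n) ℂ) l j • Λ.dn m j

theorem upt_apply (m : ℕ) (k : Fin n) (x : Λ.X m) :
    Λ.upt m k x = ∑ i, (b : Matrix (Fin n) (Fin n) ℂ) k i • Λ.up m i x := by
  simp [upt, LinearMap.sum_apply]

theorem dnt_apply (m : ℕ) (l : Fin n) (x : Λ.X (m + 1)) :
    Λ.dnt m l x = ∑ j, ((b⁻¹ : GL (Fin n) ℂ) : Matrix (Fin n) (Fin n) ℂ) l j • Λ.dn m j x := by
  simp [dnt, LinearMap.sum_apply]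

theorem sum_smul_dnt (m : ℕ) (k : Fin n) (x : Λ.X (m + 1)) :
    ∑ l, (b : Matrix (Fin n) (Fin n) ℂ) k l • Λ.dnt m l x = Λ.dn m k x := by
  simp only [dnt_apply]
  exact sum_smul_sum_smul _ _ (GL_sum_mul_inv b) k fun j => Λ.dn m j x

theorem sum_smul_upt (m : ℕ) (k : Fin n) (x : Λ.X m) :
    ∑ l, ((b⁻¹ : GL (Fin n) ℂ) : Matrix (Fin n) (Fin n) ℂ) k l • Λ.upt m l x = Λ.up m k x := by
  simp only [upt_apply]
  exact sum_smul_sum_smul _ _ (GL_sum_inv_mul b) k fun j => Λ.up m j x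

theorem dn_up (m : ℕ) (k l : Fin n) (x : Λ.X (m + 1)) :
    Λ.dn (m + 1) k (Λ.up (m + 1) l x) =
      (if k = l then x else 0) - (Λ.γ m)⁻¹ • Λ.upt m k (Λ.dnt m l x) := by
  rw [dn_up', upt_apply, dnt_apply]

theorem dn_upt (m : ℕ) (j i : Fin n) (x : Λ.X (m + 1)) :
    Λ.dn (m + 1) j (Λ.upt (m + 1) i x) =
      (b : Matrix (Fin n) (Fin n) ℂ) i j • x - (Λ.γ m)⁻¹ • Λ.upt m j (Λ.dn m i x) := by
  rw [upt_apply, ← sum_smul_dnt Λ m i x]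
  simp [dn_up, smul_sub, Finset.sum_sub_distrib, Finset.smul_sum, smul_comm (Λ.γ m)⁻¹]

theorem dnt_up (m : ℕ) (i j : Fin n) (x : Λ.X (m + 1)) :
    Λ.dnt (m + 1) i (Λ.up (m + 1) j x) =
      ((b⁻¹ : GL (Fin n) ℂ) : Matrix (Fin n) (Fin n) ℂ) i j • x -
        (Λ.γ m)⁻¹ • Λ.up m i (Λ.dnt m j x) := by
  rw [dnt_apply, ← sum_smul_upt Λ m i]
  simp only [dn_up, smul_sub, Finset.sum_sub_distrib, Finset.smul_sum, smul_comm (Λ.γ m)⁻¹,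
    smul_ite, smul_zero, Finset.sum_ite_eq', Finset.mem_univ, if_true]

theorem sum_up_upt (m : ℕ) (x : Λ.X m) : ∑ k, Λ.up (m + 1) k (Λ.upt m k x) = 0 := by
  rw [← Λ.up_up m x]
  simp [upt_apply]

theorem sum_dnt_dn (m : ℕ) (x : Λ.X (m + 2)) : ∑ k, Λ.dnt m k (Λ.dn (m + 1) k x) = 0 := by
  rw [← Λ.dn_dn m x]
  simp [dnt_apply]

theorem sum_dnt_upt (m : ℕ) (x : Λ.X m) : ∑ k, Λ.dnt m k (Λ.upt m k x) = Λ.γ m • x := by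
  rw [← Λ.cap_cup m x]
  simp only [dnt_apply, upt_apply]

/-- From here to `sum_smul_upt_upt`: the eight contractions with `b` and `b⁻¹`, in the shape in
which they occur when the two defining relations of the quantum group are verified for `rmul`. -/
theorem sum_smul_up_up (m : ℕ) (x : Λ.X m) :
    ∑ k, ∑ l, (b : Matrix (Fin n) (Fin n) ℂ) k l • Λ.up (m + 1) k (Λ.up m l x) = 0 :=
  Λ.up_up m x

theorem sum_smul_dnt_up (m : ℕ) (x : Λ.X m) :
    ∑ k, ∑ l, (b : Matrix (Fin n) (Fin n) ℂ) k l • Λ.dnt m k (Λ.up m l x) = Λ.γ m • x := by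
  rw [← sum_dnt_upt]
  simp [upt_apply]

theorem sum_smul_up_dnt (m : ℕ) (x : Λ.X (m + 2)) :
    ∑ k, ∑ l, (b : Matrix (Fin n) (Fin n) ℂ) k l • Λ.up (m + 1) k (Λ.dnt (m + 1) l x) = x := by
  conv_rhs => rw [← Λ.up_dn m x]
  simp [← sum_smul_dnt]

theorem sum_smul_dnt_dnt (m : ℕ) (x : Λ.X (m + 2)) :
    ∑ k, ∑ l, (b : Matrix (Fin n) (Fin n) ℂ) k l • Λ.dnt m k (Λ.dnt (m + 1) l x) = 0 := by
  rw [← sum_dnt_dn Λ m x]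
  simp [← sum_smul_dnt]

theorem sum_smul_dn_dn (m : ℕ) (x : Λ.X (m + 2)) :
    ∑ k, ∑ l, ((b⁻¹ : GL (Fin n) ℂ) : Matrix (Fin n) (Fin n) ℂ) k l •
      Λ.dn m l (Λ.dn (m + 1) k x) = 0 :=
  Λ.dn_dn m x

theorem sum_smul_dn_upt (m : ℕ) (x : Λ.X m) :
    ∑ k, ∑ l, ((b⁻¹ : GL (Fin n) ℂ) : Matrix (Fin n) (Fin n) ℂ) k l •
      Λ.dn m l (Λ.upt m k x) = Λ.γ m • x := by
  rw [← sum_dnt_upt]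
  simp [dnt_apply]

theorem sum_smul_upt_dn (m : ℕ) (x : Λ.X (m + 2)) :
    ∑ k, ∑ l, ((b⁻¹ : GL (Fin n) ℂ) : Matrix (Fin n) (Fin n) ℂ) k l •
      Λ.upt (m + 1) l (Λ.dn (m + 1) k x) = x := by
  simp only [sum_smul_upt, up_dn]

theorem sum_smul_upt_upt (m : ℕ) (x : Λ.X m) :
    ∑ k, ∑ l, ((b⁻¹ : GL (Fin n) ℂ) : Matrix (Fin n) (Fin n) ℂ) k l •
      Λ.upt (m + 1) l (Λ.upt m k x) = 0 := by
  simp only [sum_smul_upt, sum_up_upt]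

end Ladder

/-! ### The coaction on a ladder -/

/-- `v ⊗ c ↦ f v ⊗ a c`. -/
def tensorAct {A M N : Type*} [Ring A] [Algebra ℂ A] [AddCommGroup M] [Module ℂ M]
    [AddCommGroup N] [Module ℂ N] (f : M →ₗ[ℂ] N) (a : A) : M ⊗[ℂ] A →ₗ[ℂ] N ⊗[ℂ] A :=
  TensorProduct.map f (LinearMap.mulLeft ℂ a)

section tensorAct

variable {A M N P : Type*} [Ring A] [Algebra ℂ A] [AddCommGroup M] [Module ℂ M]
    [AddCommGroup N] [Module ℂ N] [AddCommGroup P] [Module ℂ P]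

@[simp]
theorem tensorAct_tmul (f : M →ₗ[ℂ] N) (a : A) (x : M) (c : A) :
    tensorAct f a (x ⊗ₜ[ℂ] c) = f x ⊗ₜ[ℂ] (a * c) := rfl

theorem tensorAct_tensorAct (f : N →ₗ[ℂ] P) (g : M →ₗ[ℂ] N) (a c : A) (t : M ⊗[ℂ] A) :
    tensorAct f a (tensorAct g c t) = tensorAct (f ∘ₗ g) (a * c) t := by
  induction t using TensorProduct.induction_on with
  | zero => simp
  | add x y hx hy => simp only [map_add, hx, hy]
  | tmul x y => simp [mul_assoc]

theorem tensorAct_sum_left {ι : Type*} (s : Finset ι) (f : ι → M →ₗ[ℂ] N) (a : A)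
    (t : M ⊗[ℂ] A) : tensorAct (∑ i ∈ s, f i) a t = ∑ i ∈ s, tensorAct (f i) a t := by
  simp only [tensorAct, ← LinearMap.sum_apply]
  congr 1
  exact map_sum ((TensorProduct.mapBilinear (RingHom.id ℂ) M A N A).flip _) f s

theorem tensorAct_smul_left (r : ℂ) (f : M →ₗ[ℂ] N) (a : A) (t : M ⊗[ℂ] A) :
    tensorAct (r • f) a t = r • tensorAct f a t := by
  simp only [tensorAct, TensorProduct.map_smul_left, LinearMap.smul_apply]

theorem tensorAct_zero_left (a : A) (t : M ⊗[ℂ] A) :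
    tensorAct (0 : M →ₗ[ℂ] N) a t = 0 := by
  simp [tensorAct, TensorProduct.map_zero_left]

theorem tensorAct_sub_left (f g : M →ₗ[ℂ] N) (a : A) (t : M ⊗[ℂ] A) :
    tensorAct (f - g) a t = tensorAct f a t - tensorAct g a t := by
  have h := tensorAct_sum_left {0, 1} ![f, -g] a t
  have h' : tensorAct (-g) a t = - tensorAct g a t := by
    rw [← neg_one_smul ℂ g, tensorAct_smul_left, neg_one_smul]
  simpa [h', ← sub_eq_add_neg] using h

theorem sum_sum_smul_tensorAct {ι κ : Type*} [Fintype ι] [Fintype κ] (r : ι → κ → ℂ)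
    (f : M →ₗ[ℂ] N) (a : ι → κ → A) (c : ℂ)
    (h : ∑ i, ∑ j, r i j • a i j = algebraMap ℂ A c) (t : M ⊗[ℂ] A) :
    ∑ i, ∑ j, r i j • tensorAct f (a i j) t = c • tensorAct f 1 t := by
  induction t using TensorProduct.induction_on with
  | zero => simp
  | add x y hx hy => simp only [map_add, smul_add, Finset.sum_add_distrib, hx, hy]
  | tmul x y =>
    simp only [tensorAct_tmul, ← TensorProduct.tmul_smul, ← smul_mul_assoc,
      ← TensorProduct.tmul_sum, ← Finset.sum_mul, h, Algebra.algebraMap_eq_smul_one]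

theorem tensorAct_id_one (t : M ⊗[ℂ] A) : tensorAct LinearMap.id (1 : A) t = t := by
  simp [tensorAct]

end tensorAct

namespace Ladder

variable {n : ℕ} {b : GL (Fin n) ℂ} (Λ : Ladder b)

open QuantumGroup (L)

/-- The coaction of the quantum group on the spaces of a ladder. -/
def coact : ∀ m, Λ.X m →ₗ[ℂ] Λ.X m ⊗[ℂ] QuantumGroup b
  | 0 => 0
  | 1 => (TensorProduct.mk ℂ (Λ.X 1) (QuantumGroup b)).flip 1
  -- Inclusion into `V ⊗ X (m + 1)`, coaction of the tensor product with `e l ↦ ∑ e k ⊗ L k l`,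
  -- projection back to `X (m + 2)`.
  | m + 2 => ∑ k, ∑ l, tensorAct (Λ.up (m + 1) k) (L b k l) ∘ₗ coact (m + 1) ∘ₗ Λ.dn (m + 1) l

theorem coact_one (x : Λ.X 1) : Λ.coact 1 x = x ⊗ₜ[ℂ] 1 := rfl

theorem coact_add_two (m : ℕ) (x : Λ.X (m + 2)) : Λ.coact (m + 2) x =
    ∑ k, ∑ l, tensorAct (Λ.up (m + 1) k) (L b k l) (Λ.coact (m + 1) (Λ.dn (m + 1) l x)) := by
  simp [coact, LinearMap.sum_apply]

/-- The contraction `V ⊗ X (m + 1) → X m` is compatible with the coactions wherever the lowering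
operators are, by `Lᵗ b⁻¹ L = b⁻¹`. The hypothesis concerns a single vector so that it can be
supplied by the induction hypothesis of `tensorAct_dn`. -/
theorem sum_tensorAct_dnt_of {m : ℕ} {w : Λ.X (m + 1)}
    (h : ∀ k, tensorAct (Λ.dn m k) 1 (Λ.coact (m + 1) w) =
      ∑ l, tensorAct LinearMap.id (L b k l) (Λ.coact m (Λ.dn m l w))) (l : Fin n) :
    ∑ a, tensorAct (Λ.dnt m a) (L b a l) (Λ.coact (m + 1) w) = Λ.coact m (Λ.dnt m l w) := by
  have h1 : ∀ a c : Fin n, tensorAct (Λ.dn m c) (L b a l) (Λ.coact (m + 1) w) =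
      ∑ x, tensorAct LinearMap.id (L b a l * L b c x) (Λ.coact m (Λ.dn m x w)) := by
    intro a c
    have : tensorAct (Λ.dn m c) (L b a l) (Λ.coact (m + 1) w) =
        tensorAct LinearMap.id (L b a l) (tensorAct (Λ.dn m c) 1 (Λ.coact (m + 1) w)) := by
      rw [tensorAct_tensorAct, LinearMap.id_comp, mul_one]
    rw [this, h, map_sum]
    simp only [tensorAct_tensorAct, LinearMap.id_comp]
  simp only [dnt, tensorAct_sum_left, tensorAct_smul_left, h1, Finset.smul_sum]
  have h2 : ∀ F : Fin n → Fin n → Fin n → Λ.X m ⊗[ℂ] QuantumGroup b,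
      ∑ a, ∑ c, ∑ x, F a c x = ∑ x, ∑ a, ∑ c, F a c x := by
    intro F
    rw [Finset.sum_comm]
    refine (Finset.sum_congr rfl fun a _ => Finset.sum_comm).trans ?_
    rw [Finset.sum_comm]
    exact Finset.sum_congr rfl fun x _ => Finset.sum_comm
  rw [h2]
  simp only [sum_sum_smul_tensorAct _ _ _ _ (QuantumGroup.rel_right b l _), tensorAct_id_one,
    LinearMap.sum_apply, LinearMap.smul_apply, map_sum, map_smul]

/-- The lowering operators form a morphism of comodules `X (m + 1) → V ⊗ X m`. -/
theorem tensorAct_dn (m : ℕ) (k : Fin n) (w : Λ.X (m + 1)) :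
    tensorAct (Λ.dn m k) 1 (Λ.coact (m + 1) w) =
      ∑ l, tensorAct LinearMap.id (L b k l) (Λ.coact m (Λ.dn m l w)) := by
  induction m generalizing k with
  | zero =>
    have h : Λ.dn 0 = 0 := by
      ext
      exact Subsingleton.elim _ _
    simp [h, tensorAct_zero_left]
  | succ m ih =>
    have h : ∀ a : Fin n, Λ.dn (m + 1) k ∘ₗ Λ.up (m + 1) a =
        (if k = a then LinearMap.id else 0) - (Λ.γ m)⁻¹ • (Λ.upt m k ∘ₗ Λ.dnt m a) := by
      intro a
      ext x
      simp only [LinearMap.comp_apply, dn_up, LinearMap.sub_apply, LinearMap.smul_apply]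
      split_ifs <;> rfl
    have h1 : ∀ a l : Fin n, ∀ t : Λ.X (m + 1) ⊗[ℂ] QuantumGroup b,
        tensorAct (Λ.upt m k ∘ₗ Λ.dnt m a) (L b a l) t =
        tensorAct (Λ.upt m k) 1 (tensorAct (Λ.dnt m a) (L b a l) t) := by
      intro a l t
      rw [tensorAct_tensorAct, one_mul]
    rw [coact_add_two]
    simp only [map_sum, tensorAct_tensorAct, one_mul, h, tensorAct_sub_left,
      tensorAct_smul_left, Finset.sum_sub_distrib]
    simp only [h1]
    -- The correction term of `dn ∘ up` disappears: by the induction hypothesis the contraction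
    -- passes through the coaction, where it meets `∑ dnt l ∘ dn l = 0`.
    have h2 : ∑ a, ∑ l, (Λ.γ m)⁻¹ • tensorAct (Λ.upt m k) 1 (tensorAct (Λ.dnt m a) (L b a l)
        (Λ.coact (m + 1) (Λ.dn (m + 1) l w))) = 0 := by
      rw [Finset.sum_comm]
      simp_rw [← Finset.smul_sum, ← map_sum]
      rw [Finset.sum_congr rfl fun l _ => sum_tensorAct_dnt_of Λ (fun k => ih k _) l, ← map_sum,
        sum_dnt_dn, map_zero, map_zero, smul_zero]
    rw [h2, sub_zero]
    rw [Finset.sum_eq_single k]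
    · simp
    · intro a _ ha
      simp [ha.symm, tensorAct_zero_left]
    · simp

/-- The dual statement for `X m → V ⊗ X (m + 1)`, which rests on `L b Lᵗ = b`. -/
theorem sum_tensorAct_coact_upt_of {m : ℕ} {v : Λ.X m}
    (h : ∀ l, Λ.coact (m + 1) (Λ.up m l v) =
      ∑ k, tensorAct (Λ.up m k) (L b k l) (Λ.coact m v)) (a : Fin n) :
    ∑ c, tensorAct LinearMap.id (L b a c) (Λ.coact (m + 1) (Λ.upt m c v)) =
      tensorAct (Λ.upt m a) 1 (Λ.coact m v) := by
  simp only [upt_apply, map_sum, map_smul, h, tensorAct_tensorAct, LinearMap.id_comp,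
    Finset.smul_sum]
  have h2 : ∀ F : Fin n → Fin n → Fin n → Λ.X (m + 1) ⊗[ℂ] QuantumGroup b,
      ∑ a, ∑ c, ∑ x, F a c x = ∑ x, ∑ a, ∑ c, F a c x := by
    intro F
    rw [Finset.sum_comm]
    refine (Finset.sum_congr rfl fun a _ => Finset.sum_comm).trans ?_
    rw [Finset.sum_comm]
    exact Finset.sum_congr rfl fun x _ => Finset.sum_comm
  rw [h2]
  simp only [sum_sum_smul_tensorAct _ _ _ _ (QuantumGroup.rel_left b a _), upt,
    tensorAct_sum_left, tensorAct_smul_left]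

/-- The raising operators form a morphism of comodules `V ⊗ X m → X (m + 1)`. -/
theorem coact_up (m : ℕ) (l : Fin n) (v : Λ.X m) : Λ.coact (m + 1) (Λ.up m l v) =
    ∑ k, tensorAct (Λ.up m k) (L b k l) (Λ.coact m v) := by
  induction m generalizing l with
  | zero => simp [Subsingleton.elim v 0]
  | succ m ih =>
    rw [coact_add_two]
    simp only [dn_up, map_sub, map_smul, Finset.sum_sub_distrib, ← Finset.smul_sum]
    have h : ∀ k : Fin n, ∑ c, tensorAct (Λ.up (m + 1) k) (L b k c)
        (Λ.coact (m + 1) (Λ.upt m c (Λ.dnt m l v))) =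
        tensorAct (Λ.up (m + 1) k ∘ₗ Λ.upt m k) 1 (Λ.coact m (Λ.dnt m l v)) := by
      intro k
      rw [← one_mul (1 : QuantumGroup b), ← tensorAct_tensorAct,
        ← sum_tensorAct_coact_upt_of Λ fun l => ih l _, map_sum]
      simp only [tensorAct_tensorAct, LinearMap.comp_id, one_mul]
    have h0 : ∑ k, Λ.up (m + 1) k ∘ₗ Λ.upt m k = 0 := by
      ext x
      simp [LinearMap.sum_apply, sum_up_upt]
    simp only [h, ← tensorAct_sum_left, h0, tensorAct_zero_left, smul_zero, sub_zero]
    refine Finset.sum_congr rfl fun k _ => ?_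
    rw [Finset.sum_eq_single l]
    · simp
    · intro a _ ha
      simp [ha]
    · simp

theorem sum_tensorAct_coact_upt (m : ℕ) (a : Fin n) (v : Λ.X m) :
    ∑ c, tensorAct LinearMap.id (L b a c) (Λ.coact (m + 1) (Λ.upt m c v)) =
      tensorAct (Λ.upt m a) 1 (Λ.coact m v) :=
  Λ.sum_tensorAct_coact_upt_of (fun l => Λ.coact_up m l v) a

end Ladder

/-! ### Evaluation of functionals and the comodule axioms -/

section contract

variable {A M N : Type*} [Ring A] [Algebra ℂ A] [AddCommGroup M] [Module ℂ M]
    [AddCommGroup N] [Module ℂ N]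

/-- `v ⊗ a ↦ u a • v`. -/
def contract (u : A →ₗ[ℂ] ℂ) : M ⊗[ℂ] A →ₗ[ℂ] M :=
  (TensorProduct.rid ℂ M).toLinearMap ∘ₗ u.lTensor M

@[simp]
theorem contract_tmul (u : A →ₗ[ℂ] ℂ) (x : M) (a : A) :
    contract u (x ⊗ₜ[ℂ] a) = u a • x := by
  simp [contract]

theorem contract_tensorAct (u : A →ₗ[ℂ] ℂ) (f : M →ₗ[ℂ] N) (a : A) (t : M ⊗[ℂ] A) :
    contract u (tensorAct f a t) = f (contract (u ∘ₗ LinearMap.mulLeft ℂ a) t) := by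
  induction t using TensorProduct.induction_on with
  | zero => simp
  | add x y hx hy => simp only [map_add, hx, hy]
  | tmul x c => simp

theorem tensorAct_sum_right {ι : Type*} (s : Finset ι) (f : M →ₗ[ℂ] N) (a : ι → A)
    (t : M ⊗[ℂ] A) : tensorAct f (∑ i ∈ s, a i) t = ∑ i ∈ s, tensorAct f (a i) t := by
  induction t using TensorProduct.induction_on with
  | zero => simp
  | add x y hx hy => simp only [map_add, Finset.sum_add_distrib, hx, hy]
  | tmul x c => simp [Finset.sum_mul, TensorProduct.tmul_sum]

end contract

theorem URep.action_apply {n : ℕ} {b : GL (Fin n) ℂ} (V : URep b) (u : QuantumAlgebra b)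
    (x : V.carrier) : V.action u x = contract u.ofConv (V.coact x) := rfl

namespace Ladder

variable {n : ℕ} {b : GL (Fin n) ℂ} (Λ : Ladder b)

open QuantumGroup (L)

theorem lTensor_comul_tensorAct {M N : Type} [AddCommGroup M] [Module ℂ M] [AddCommGroup N]
    [Module ℂ N] (f : M →ₗ[ℂ] N) (a : QuantumGroup b) (t : M ⊗[ℂ] QuantumGroup b) :
    (Coalgebra.comul (R := ℂ) (A := QuantumGroup b)).lTensor N (tensorAct f a t) =
      tensorAct f (Coalgebra.comul (R := ℂ) a)
        ((Coalgebra.comul (R := ℂ) (A := QuantumGroup b)).lTensor M t) := by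
  induction t using TensorProduct.induction_on with
  | zero => simp
  | add x y hx hy => simp only [map_add, hx, hy]
  | tmul x c => simp [Bialgebra.comul_mul]

theorem assoc_tensorAct_tmul {A M N : Type} [AddCommGroup M] [Module ℂ M] [AddCommGroup N]
    [Module ℂ N] [Ring A] [Algebra ℂ A] (f : M →ₗ[ℂ] N) (a c c' : A) (t : M ⊗[ℂ] A) :
    TensorProduct.assoc ℂ N A A (tensorAct f a t ⊗ₜ[ℂ] (c * c')) =
      tensorAct f (a ⊗ₜ[ℂ] c) (TensorProduct.assoc ℂ M A A (t ⊗ₜ[ℂ] c')) := by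
  induction t using TensorProduct.induction_on with
  | zero => simp
  | add x y hx hy => simp only [map_add, TensorProduct.add_tmul, hx, hy]
  | tmul x c => simp

theorem assoc_rTensor_coact_tensorAct_up (m : ℕ) (k : Fin n) (c : QuantumGroup b)
    (t : Λ.X m ⊗[ℂ] QuantumGroup b) :
    TensorProduct.assoc ℂ _ _ _ ((Λ.coact (m + 1)).rTensor (QuantumGroup b)
      (tensorAct (Λ.up m k) c t)) = ∑ a, tensorAct (Λ.up m a) (L b a k ⊗ₜ[ℂ] c)
        (TensorProduct.assoc ℂ _ _ _ ((Λ.coact m).rTensor (QuantumGroup b) t)) := by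
  induction t using TensorProduct.induction_on with
  | zero => simp
  | add x y hx hy => simp only [map_add, hx, hy, Finset.sum_add_distrib]
  | tmul x c' =>
    simp only [tensorAct_tmul, LinearMap.rTensor_tmul, coact_up, TensorProduct.sum_tmul, map_sum,
      assoc_tensorAct_tmul]

theorem coact_coassoc (m : ℕ) (x : Λ.X m) :
    TensorProduct.assoc ℂ _ _ _ ((Λ.coact m).rTensor (QuantumGroup b) (Λ.coact m x)) =
      (Coalgebra.comul (R := ℂ) (A := QuantumGroup b)).lTensor _ (Λ.coact m x) := by
  induction m with
  | zero => simp [Subsingleton.elim x 0]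
  | succ m ih =>
    cases m with
    | zero => simp [coact_one, Algebra.TensorProduct.one_def]
    | succ m =>
      simp only [coact_add_two Λ m x, map_sum, assoc_rTensor_coact_tensorAct_up, ih,
        lTensor_comul_tensorAct, QuantumGroup.comul_L, tensorAct_sum_right]
      rw [Finset.sum_comm]
      conv_rhs => rw [Finset.sum_comm]
      refine Finset.sum_congr rfl fun l _ => ?_
      rw [Finset.sum_comm]

theorem coact_counit (m : ℕ) (x : Λ.X m) :
    contract (Coalgebra.counit (R := ℂ) (A := QuantumGroup b)) (Λ.coact m x) = x := by
  induction m with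
  | zero => exact Subsingleton.elim _ _
  | succ m ih =>
    cases m with
    | zero => simp [coact_one]
    | succ m =>
      have h : ∀ k l : Fin n, Coalgebra.counit (R := ℂ) (A := QuantumGroup b) ∘ₗ
          LinearMap.mulLeft ℂ (L b k l) = (if k = l then (1 : ℂ) else 0) •
            Coalgebra.counit (R := ℂ) (A := QuantumGroup b) := by
        intro k l
        ext a
        rw [LinearMap.comp_apply, LinearMap.mulLeft_apply, Bialgebra.counit_mul,
          QuantumGroup.counit_L, LinearMap.smul_apply, smul_eq_mul]
      have h1 : ∀ (r : ℂ) (t : Λ.X (m + 1) ⊗[ℂ] QuantumGroup b),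
          contract (r • Coalgebra.counit (R := ℂ) (A := QuantumGroup b)) t =
          r • contract (Coalgebra.counit (R := ℂ) (A := QuantumGroup b)) t := by
        intro r t
        simp [contract, LinearMap.lTensor_smul]
      simp only [coact_add_two Λ m x, map_sum, contract_tensorAct, h, h1, ih, map_smul]
      simp [up_dn]

/-- The spaces of a ladder as representations of the quantum algebra. -/
abbrev rep (m : ℕ) : URep b where
  carrier := Λ.X m
  coact := Λ.coact m
  coassoc := LinearMap.ext fun x => Λ.coact_coassoc m x
  counit := LinearMap.ext fun x => Λ.coact_counit m x

/-! ### Functionals with prescribed action on all spaces of a ladder -/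

/-- The right action of a generator `L k l` on `∏ End (X m)`. -/
def rmul (k l : Fin n) : (∀ m, Module.End ℂ (Λ.X m)) →ₗ[ℂ] (∀ m, Module.End ℂ (Λ.X m)) where
  toFun φ := fun
    | 0 => 0
    -- If `u` acts on each `X m` by `φ m`, then `u (L k l * ·)` acts on `X (m + 1)` by the `(k, l)`
    -- entry, in the direction of `V`, of the action of `u` on `V ⊗ X (m + 1) = X (m + 2) ⊕ X m`.
    -- The inclusions of the summands have components `dn` and `upt`, the projections `up` and `γ⁻¹
    -- dnt`.
    | m + 1 => Λ.dn (m + 1) k ∘ₗ φ (m + 2) ∘ₗ Λ.up (m + 1) l +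
        (Λ.γ m)⁻¹ • Λ.upt m k ∘ₗ φ m ∘ₗ Λ.dnt m l
  map_add' φ ψ := by
    funext m
    cases m with
    | zero => simp
    | succ m =>
      ext x
      simp only [Pi.add_apply, LinearMap.add_apply, LinearMap.comp_apply, LinearMap.smul_apply,
        map_add, smul_add]
      abel
  map_smul' r φ := by
    funext m
    cases m with
    | zero => simp
    | succ m =>
      ext x
      simp only [Pi.smul_apply, LinearMap.add_apply, LinearMap.comp_apply, LinearMap.smul_apply,
        map_smul, smul_add, RingHom.id_apply, smul_comm r]

theorem rmul_zero (k l : Fin n) (φ : ∀ m, Module.End ℂ (Λ.X m)) : Λ.rmul k l φ 0 = 0 := rfl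

theorem rmul_succ (k l : Fin n) (φ : ∀ m, Module.End ℂ (Λ.X m)) (m : ℕ) (x : Λ.X (m + 1)) :
    Λ.rmul k l φ (m + 1) x = Λ.dn (m + 1) k (φ (m + 2) (Λ.up (m + 1) l x)) +
      (Λ.γ m)⁻¹ • Λ.upt m k (φ m (Λ.dnt m l x)) := rfl

theorem sum_sum_smul_map {ι κ M N : Type*} [Fintype ι] [Fintype κ] [AddCommGroup M] [Module ℂ M]
    [AddCommGroup N] [Module ℂ N] (F : M →ₗ[ℂ] N) (r : ι → κ → ℂ) (g : ι → κ → M) :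
    ∑ i, ∑ j, r i j • F (g i j) = F (∑ i, ∑ j, r i j • g i j) := by
  simp only [map_sum, map_smul]

theorem sum_sum_smul_smul {ι κ M : Type*} [Fintype ι] [Fintype κ] [AddCommGroup M] [Module ℂ M]
    (s : ℂ) (r : ι → κ → ℂ) (g : ι → κ → M) :
    ∑ i, ∑ j, r i j • s • g i j = s • ∑ i, ∑ j, r i j • g i j := by
  simp only [Finset.smul_sum, smul_comm s]

/-- This is `L b Lᵗ = b`. At `X (m + 1)` the terms through `φ (m + 3)` and `φ (m - 1)` vanish, as
they contain `∑ b up up` or `∑ b dnt dnt`. The two terms through `φ (m + 1)` differ only in the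
operators applied after `φ`, and `dn_upt` adds them up. -/
theorem sum_rmul_rmul_left (i j : Fin n) (φ : ∀ m, Module.End ℂ (Λ.X m)) :
    ∑ k, ∑ l, (b : Matrix (Fin n) (Fin n) ℂ) k l • Λ.rmul j l (Λ.rmul i k φ) =
      (b : Matrix (Fin n) (Fin n) ℂ) i j • φ := by
  funext m
  cases m with
  | zero => exact LinearMap.ext fun x => Subsingleton.elim _ _
  | succ m =>
    ext x
    simp only [Finset.sum_apply, Pi.smul_apply, LinearMap.sum_apply, LinearMap.smul_apply,
      rmul_succ, map_add, map_smul, smul_add, Finset.sum_add_distrib]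
    have h1 : ∑ k, ∑ l, (b : Matrix (Fin n) (Fin n) ℂ) k l • Λ.dn (m + 1) j (Λ.dn (m + 2) i
        (φ (m + 3) (Λ.up (m + 2) k (Λ.up (m + 1) l x)))) = 0 := by
      refine (sum_sum_smul_map (Λ.dn (m + 1) j ∘ₗ Λ.dn (m + 2) i ∘ₗ φ (m + 3)) _ _).trans ?_
      rw [sum_smul_up_up, map_zero]
    have h2 : ∑ k, ∑ l, (b : Matrix (Fin n) (Fin n) ℂ) k l • (Λ.γ (m + 1))⁻¹ •
        Λ.dn (m + 1) j (Λ.upt (m + 1) i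
          (φ (m + 1) (Λ.dnt (m + 1) k (Λ.up (m + 1) l x)))) =
        Λ.dn (m + 1) j (Λ.upt (m + 1) i (φ (m + 1) x)) := by
      refine (sum_sum_smul_map ((Λ.γ (m + 1))⁻¹ •
        (Λ.dn (m + 1) j ∘ₗ Λ.upt (m + 1) i ∘ₗ φ (m + 1))) _ _).trans ?_
      rw [sum_smul_dnt_up, LinearMap.smul_apply, map_smul, smul_smul,
        inv_mul_cancel₀ (Λ.γ_ne _), one_smul]
      rfl
    have h3 : ∑ k, ∑ l, (b : Matrix (Fin n) (Fin n) ℂ) k l • (Λ.γ m)⁻¹ •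
        Λ.upt m j (Λ.rmul i k φ m (Λ.dnt m l x)) =
        (Λ.γ m)⁻¹ • Λ.upt m j (Λ.dn m i (φ (m + 1) x)) := by
      cases m with
      | zero => simp [rmul_zero, Subsingleton.elim (Λ.dn 0 i (φ 1 x)) 0]
      | succ m =>
        simp only [rmul_succ, map_add, map_smul, smul_add, Finset.sum_add_distrib]
        have h4 : ∑ k, ∑ l, (b : Matrix (Fin n) (Fin n) ℂ) k l • (Λ.γ (m + 1))⁻¹ •
            Λ.upt (m + 1) j (Λ.dn (m + 1) i
              (φ (m + 2) (Λ.up (m + 1) k (Λ.dnt (m + 1) l x)))) =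
            (Λ.γ (m + 1))⁻¹ • Λ.upt (m + 1) j (Λ.dn (m + 1) i (φ (m + 2) x)) := by
          refine (sum_sum_smul_map ((Λ.γ (m + 1))⁻¹ •
            (Λ.upt (m + 1) j ∘ₗ Λ.dn (m + 1) i ∘ₗ φ (m + 2))) _ _).trans ?_
          rw [sum_smul_up_dnt]
          rfl
        have h5 : ∑ k, ∑ l, (b : Matrix (Fin n) (Fin n) ℂ) k l • (Λ.γ (m + 1))⁻¹ •
            (Λ.γ m)⁻¹ • Λ.upt (m + 1) j (Λ.upt m i
              (φ m (Λ.dnt m k (Λ.dnt (m + 1) l x)))) = 0 := by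
          refine (sum_sum_smul_map ((Λ.γ (m + 1))⁻¹ • (Λ.γ m)⁻¹ •
            (Λ.upt (m + 1) j ∘ₗ Λ.upt m i ∘ₗ φ m)) _ _).trans ?_
          rw [sum_smul_dnt_dnt, map_zero]
        rw [h4, h5, add_zero]
    rw [h1, h2, h3, dn_upt, zero_add, sub_add_cancel]

/-- This is `Lᵗ b⁻¹ L = b⁻¹`. The contraction now concerns the operators applied after `φ`, and the
two surviving terms are added up by `dnt_up` on the argument of `φ`. -/
theorem sum_rmul_rmul_right (i j : Fin n) (φ : ∀ m, Module.End ℂ (Λ.X m)) :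
    ∑ k, ∑ l, ((b⁻¹ : GL (Fin n) ℂ) : Matrix (Fin n) (Fin n) ℂ) k l •
        Λ.rmul l j (Λ.rmul k i φ) =
      ((b⁻¹ : GL (Fin n) ℂ) : Matrix (Fin n) (Fin n) ℂ) i j • φ := by
  funext m
  cases m with
  | zero => exact LinearMap.ext fun x => Subsingleton.elim _ _
  | succ m =>
    ext x
    simp only [Finset.sum_apply, Pi.smul_apply, LinearMap.sum_apply, LinearMap.smul_apply,
      rmul_succ, map_add, map_smul, smul_add, Finset.sum_add_distrib]
    rw [sum_smul_dn_dn]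
    have h2 : ∑ k, ∑ l, ((b⁻¹ : GL (Fin n) ℂ) : Matrix (Fin n) (Fin n) ℂ) k l •
        (Λ.γ (m + 1))⁻¹ • Λ.dn (m + 1) l (Λ.upt (m + 1) k
          (φ (m + 1) (Λ.dnt (m + 1) i (Λ.up (m + 1) j x)))) =
        φ (m + 1) (Λ.dnt (m + 1) i (Λ.up (m + 1) j x)) := by
      refine (sum_sum_smul_smul _ _ _).trans ?_
      rw [sum_smul_dn_upt, smul_smul, inv_mul_cancel₀ (Λ.γ_ne _), one_smul]
    have h3 : ∑ k, ∑ l, ((b⁻¹ : GL (Fin n) ℂ) : Matrix (Fin n) (Fin n) ℂ) k l • (Λ.γ m)⁻¹ •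
        Λ.upt m l (Λ.rmul k i φ m (Λ.dnt m j x)) =
        (Λ.γ m)⁻¹ • φ (m + 1) (Λ.up m i (Λ.dnt m j x)) := by
      cases m with
      | zero => simp [Subsingleton.elim (Λ.dnt 0 j x) 0]
      | succ m =>
        simp only [rmul_succ, map_add, map_smul, smul_add, Finset.sum_add_distrib]
        have h4 : ∑ k, ∑ l, ((b⁻¹ : GL (Fin n) ℂ) : Matrix (Fin n) (Fin n) ℂ) k l •
            (Λ.γ (m + 1))⁻¹ • Λ.upt (m + 1) l (Λ.dn (m + 1) k
              (φ (m + 2) (Λ.up (m + 1) i (Λ.dnt (m + 1) j x)))) =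
            (Λ.γ (m + 1))⁻¹ • φ (m + 2) (Λ.up (m + 1) i (Λ.dnt (m + 1) j x)) := by
          refine (sum_sum_smul_smul _ _ _).trans ?_
          rw [sum_smul_upt_dn]
        have h5 : ∑ k, ∑ l, ((b⁻¹ : GL (Fin n) ℂ) : Matrix (Fin n) (Fin n) ℂ) k l •
            (Λ.γ (m + 1))⁻¹ • (Λ.γ m)⁻¹ • Λ.upt (m + 1) l (Λ.upt m k
              (φ m (Λ.dnt m i (Λ.dnt (m + 1) j x)))) = 0 := by
          refine ((sum_sum_smul_smul _ _ _).trans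
            (congrArg _ (sum_sum_smul_smul _ _ _))).trans ?_
          rw [sum_smul_upt_upt, smul_zero, smul_zero]
        rw [h4, h5, add_zero]
    rw [h2, h3, zero_add, dnt_up, map_sub, map_smul, map_smul, sub_add_cancel]

/-- The right action of the quantum group on `∏ End (X m)`. -/
def rightAction : QuantumGroup b →ₐ[ℂ] (Module.End ℂ (∀ m, Module.End ℂ (Λ.X m)))ᵐᵒᵖ :=
  -- Precomposition with multiplication by `a * c` is precomposition first with that by `a`, then
  -- with that by `c`; hence the opposite algebra.
  QuantumGroup.lift (fun k l => MulOpposite.op (Λ.rmul k l))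
    (fun i j => MulOpposite.unop_injective <| LinearMap.ext fun φ => by
      simpa [LinearMap.sum_apply, Algebra.algebraMap_eq_smul_one] using
        Λ.sum_rmul_rmul_left i j φ)
    (fun i j => MulOpposite.unop_injective <| LinearMap.ext fun φ => by
      have h := Λ.sum_rmul_rmul_right i j φ
      simp only [← MulOpposite.op_mul, ← MulOpposite.op_smul, Finset.unop_sum,
        MulOpposite.unop_op, LinearMap.sum_apply, LinearMap.smul_apply, Module.End.mul_apply,
        Algebra.algebraMap_eq_smul_one, MulOpposite.unop_smul, MulOpposite.unop_one,
        Module.End.one_apply]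
      exact h)

/-- The functional on the quantum group that acts on `X m` by `φ m`. -/
def functional (φ : ∀ m, Module.End ℂ (Λ.X m)) : QuantumGroup b →ₗ[ℂ] ℂ where
  -- A functional acts on the scalar representation `X 1` by its value at `1`; the value of `u` at
  -- `a` is therefore the action of `u (a * ·)` on `X 1`.
  toFun a := Λ.vac ((Λ.rightAction a).unop φ 1 (Λ.vac.symm 1))
  map_add' a c := by simp
  map_smul' r a := by simp

theorem functional_apply (φ : ∀ m, Module.End ℂ (Λ.X m)) (a : QuantumGroup b) :
    Λ.functional φ a = Λ.vac ((Λ.rightAction a).unop φ 1 (Λ.vac.symm 1)) := rfl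

theorem functional_comp_mulLeft_L (φ : ∀ m, Module.End ℂ (Λ.X m)) (k l : Fin n) :
    Λ.functional φ ∘ₗ LinearMap.mulLeft ℂ (L b k l) = Λ.functional (Λ.rmul k l φ) := by
  ext a
  simp [functional_apply, rightAction]

/-- Density in its strongest form: arbitrary endomorphisms of all `X m` are realised simultaneously.
Unfolding the coaction of `X (m + 2)` replaces `φ` by the families `rmul k l φ` on `X (m + 1)`,
which is why the induction is over all `φ`; the part of `rmul` that passes through `X m` is killed
by `∑ up k ∘ upt k = 0`. -/
theorem contract_functional (φ : ∀ m, Module.End ℂ (Λ.X m)) (m : ℕ) (x : Λ.X m) :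
    contract (Λ.functional φ) (Λ.coact m x) = φ m x := by
  induction m generalizing φ with
  | zero => exact Subsingleton.elim _ _
  | succ m ih =>
    cases m with
    | zero =>
      have h : x = Λ.vac x • Λ.vac.symm 1 := by
        apply Λ.vac.injective
        simp
      have h1 : φ 1 (Λ.vac.symm 1) = Λ.vac (φ 1 (Λ.vac.symm 1)) • Λ.vac.symm 1 := by
        apply Λ.vac.injective
        simp
      rw [coact_one, contract_tmul, functional_apply, map_one, MulOpposite.unop_one,
        Module.End.one_apply]
      conv_lhs => rw [h]
      conv_rhs => rw [h]
      rw [map_smul, smul_comm, ← h1]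
    | succ m =>
      have h : ∀ l : Fin n, ∑ k, Λ.up (m + 1) k (Λ.rmul k l φ (m + 1) (Λ.dn (m + 1) l x)) =
          φ (m + 2) (Λ.up (m + 1) l (Λ.dn (m + 1) l x)) := by
        intro l
        simp only [rmul_succ, map_add, map_smul, Finset.sum_add_distrib, ← Finset.smul_sum,
          up_dn, sum_up_upt, smul_zero, add_zero]
      simp only [coact_add_two Λ m x, map_sum, contract_tensorAct, functional_comp_mulLeft_L, ih]
      rw [Finset.sum_comm]
      simp only [h, ← map_sum, up_dn]

end Ladder

/-! ### The quantum algebra as a product of matrix algebras; complete reducibility -/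

theorem QuantumGroup.induction_on {n : ℕ} {b : GL (Fin n) ℂ} {P : QuantumGroup b → Prop}
    (a : QuantumGroup b) (scalar : ∀ r : ℂ, P (algebraMap ℂ _ r)) (gen : ∀ i j, P (L b i j))
    (mul : ∀ a c, P a → P c → P (a * c)) (add : ∀ a c, P a → P c → P (a + c)) : P a := by
  obtain ⟨a, rfl⟩ := RingQuot.mkAlgHom_surjective ℂ (BilinearQuantumGroup.Rel b) a
  change P (QuantumGroup.mk b a)
  induction a using FreeAlgebra.induction with
  | grade0 r =>
    rw [AlgHom.commutes]
    exact scalar r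
  | grade1 p => exact gen p.1 p.2
  | mul x y hx hy =>
    rw [map_mul]
    exact mul _ _ hx hy
  | add x y hx hy =>
    rw [map_add]
    exact add _ _ hx hy

section contract

variable {A M : Type*} [Ring A] [Algebra ℂ A] [AddCommGroup M] [Module ℂ M]

theorem contract_add_left (u v : A →ₗ[ℂ] ℂ) (t : M ⊗[ℂ] A) :
    contract (u + v) t = contract u t + contract v t := by
  simp [contract, LinearMap.lTensor_add]

theorem contract_sub_left (u v : A →ₗ[ℂ] ℂ) (t : M ⊗[ℂ] A) :
    contract (u - v) t = contract u t - contract v t := by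
  simp [contract, LinearMap.lTensor_sub]

theorem contract_smul_left (r : ℂ) (u : A →ₗ[ℂ] ℂ) (t : M ⊗[ℂ] A) :
    contract (r • u) t = r • contract u t := by
  simp [contract, LinearMap.lTensor_smul]

end contract

namespace URep

variable {n : ℕ} {b : GL (Fin n) ℂ}

/-- Representations as modules over the quantum algebra. -/
instance moduleQuantumAlgebra (V : URep b) : Module (QuantumAlgebra b) V.carrier :=
  Module.compHom V.carrier V.action.toRingHom

theorem smul_def (V : URep b) (u : QuantumAlgebra b) (x : V.carrier) : u • x = V.action u x := rfl

instance isScalarTower (V : URep b) : IsScalarTower ℂ (QuantumAlgebra b) V.carrier :=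
  ⟨fun r u x => by simp [smul_def]⟩

/-- An invariant subspace as a submodule over the quantum algebra. -/
def IsInvariant.toSubmodule {V : URep b} {S : Submodule ℂ V.carrier} (h : V.IsInvariant S) :
    Submodule (QuantumAlgebra b) V.carrier where
  carrier := S
  add_mem' := S.add_mem
  zero_mem' := S.zero_mem
  smul_mem' u x hx := h u x hx

theorem isInvariant_restrictScalars {V : URep b} (S : Submodule (QuantumAlgebra b) V.carrier) :
    V.IsInvariant (S.restrictScalars ℂ) := fun u _ hx => S.smul_mem u hx

theorem IsIrreducible.isSimpleModule {V : URep b} (h : V.IsIrreducible) :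
    IsSimpleModule (QuantumAlgebra b) V.carrier := by
  have := h.1
  rw [isSimpleModule_iff]
  refine { eq_bot_or_eq_top := fun S => ?_ }
  rcases h.2 _ (isInvariant_restrictScalars S) with h | h
  · exact Or.inl (Submodule.restrictScalars_injective ℂ _ _ h)
  · exact Or.inr (Submodule.restrictScalars_injective ℂ _ _ h)

theorem Equivalent.of_linearEquiv {V W : URep b} (e : V.carrier ≃ₗ[QuantumAlgebra b] W.carrier) :
    V.Equivalent W :=
  ⟨e.restrictScalars ℂ, fun u x => e.map_smul u x⟩

theorem Equivalent.of_coact {V W : URep b} (e : V.carrier ≃ₗ[ℂ] W.carrier)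
    (h : ∀ x, W.coact (e x) = tensorAct e.toLinearMap 1 (V.coact x)) : V.Equivalent W :=
  ⟨e, fun u x => by
    rw [action_apply, action_apply, h, contract_tensorAct, LinearMap.mulLeft_one,
      LinearMap.comp_id]
    rfl⟩

theorem Equivalent.symm {V W : URep b} : V.Equivalent W → W.Equivalent V := fun ⟨e, h⟩ =>
  ⟨e.symm, fun u x => by rw [LinearEquiv.symm_apply_eq, h, LinearEquiv.apply_symm_apply]⟩

theorem Equivalent.trans {U V W : URep b} : U.Equivalent V → V.Equivalent W → U.Equivalent W :=
  fun ⟨e, h⟩ ⟨f, h'⟩ => ⟨e.trans f, fun u x => by simp [h, h']⟩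

end URep

namespace Ladder

variable {n : ℕ} {b : GL (Fin n) ℂ} (Λ : Ladder b)

open QuantumGroup (L)

/-- The Clebsch–Gordan rule for matrix coefficients: a generator times a coefficient of `X (m + 1)`
is a combination of coefficients of `X (m + 2)` and `X m`. -/
theorem tensorAct_L_coact (m : ℕ) (k l : Fin n) (x : Λ.X (m + 1)) :
    tensorAct LinearMap.id (L b k l) (Λ.coact (m + 1) x) =
      tensorAct (Λ.dn (m + 1) k) 1 (Λ.coact (m + 2) (Λ.up (m + 1) l x)) +
        (Λ.γ m)⁻¹ • tensorAct (Λ.upt m k) 1 (Λ.coact m (Λ.dnt m l x)) := by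
  rw [tensorAct_dn, ← sum_tensorAct_coact_upt]
  simp only [dn_up, map_sub, map_smul, Finset.sum_sub_distrib, ← Finset.smul_sum, sub_add_cancel]
  rw [Finset.sum_eq_single l]
  · simp
  · intro c _ hc
    simp [hc]
  · simp

/-- A functional vanishes to order `N` if it acts by zero on `X 0, ..., X N`. -/
def Vanishes (N : ℕ) (u : QuantumGroup b →ₗ[ℂ] ℂ) : Prop :=
  ∀ m ≤ N, ∀ x, contract u (Λ.coact m x) = 0

variable {Λ} in
theorem Vanishes.mono {N N' : ℕ} (h : N' ≤ N) {u : QuantumGroup b →ₗ[ℂ] ℂ} (hu : Λ.Vanishes N u) :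
    Λ.Vanishes N' u := fun m hm => hu m (hm.trans h)

/-- The number `d` bounds the degree of `a` in the generators, since each generator moves the index
by one. -/
theorem exists_vanishes_mulLeft (a : QuantumGroup b) : ∃ d : ℕ, ∀ M u, Λ.Vanishes (M + d) u →
    Λ.Vanishes M (u ∘ₗ LinearMap.mulLeft ℂ a) := by
  induction a using QuantumGroup.induction_on with
  | scalar r =>
    refine ⟨0, fun M u hu m hm x => ?_⟩
    have h : u ∘ₗ LinearMap.mulLeft ℂ (algebraMap ℂ _ r) = r • u := by
      ext a
      simp [← Algebra.smul_def]
    rw [h, contract_smul_left, hu m hm, smul_zero]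
  | gen k l =>
    refine ⟨1, fun M u hu m hm x => ?_⟩
    cases m with
    | zero => exact Subsingleton.elim _ _
    | succ m =>
      have h := contract_tensorAct u LinearMap.id (L b k l) (Λ.coact (m + 1) x)
      rw [LinearMap.id_apply] at h
      rw [← h, tensorAct_L_coact, map_add, map_smul, contract_tensorAct, contract_tensorAct,
        LinearMap.mulLeft_one, LinearMap.comp_id, hu (m + 2) (by omega), hu m (by omega),
        map_zero, map_zero, smul_zero, add_zero]
  | mul a c ha hc =>
    obtain ⟨d, ha⟩ := ha
    obtain ⟨e, hc⟩ := hc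
    refine ⟨e + d, fun M u hu => ?_⟩
    rw [LinearMap.mulLeft_mul, ← LinearMap.comp_assoc]
    exact hc _ _ (ha _ _ (hu.mono (by omega)))
  | add a c ha hc =>
    obtain ⟨d, ha⟩ := ha
    obtain ⟨e, hc⟩ := hc
    refine ⟨d + e, fun M u hu m hm x => ?_⟩
    have h : u ∘ₗ LinearMap.mulLeft ℂ (a + c) =
        u ∘ₗ LinearMap.mulLeft ℂ a + u ∘ₗ LinearMap.mulLeft ℂ c := by
      ext x
      simp [add_mul]
    rw [h, contract_add_left, ha M u (hu.mono (by omega)) m hm,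
      hc M u (hu.mono (by omega)) m hm, add_zero]

/-- The algebraic Peter–Weyl theorem: as `u a` is the action of `u (a * ·)` on `X 1`, each `a` lies
in the span of the matrix coefficients of finitely many `X m`. -/
theorem exists_vanishes_apply (a : QuantumGroup b) : ∃ d : ℕ, ∀ u, Λ.Vanishes d u → u a = 0 := by
  obtain ⟨d, h⟩ := Λ.exists_vanishes_mulLeft a
  refine ⟨1 + d, fun u hu => ?_⟩
  have := h 1 u hu 1 le_rfl (Λ.vac.symm 1)
  rw [coact_one, contract_tmul, LinearMap.comp_apply, LinearMap.mulLeft_apply, mul_one] at this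
  simpa using congrArg Λ.vac this

theorem exists_vanishes_contract {M : Type*} [AddCommGroup M] [Module ℂ M]
    (t : M ⊗[ℂ] QuantumGroup b) : ∃ d : ℕ, ∀ u, Λ.Vanishes d u → contract u t = 0 := by
  induction t using TensorProduct.induction_on with
  | zero => exact ⟨0, fun u _ => map_zero _⟩
  | add x y hx hy =>
    obtain ⟨d, hx⟩ := hx
    obtain ⟨e, hy⟩ := hy
    exact ⟨d + e, fun u hu => by
      rw [map_add, hx u (hu.mono (by omega)), hy u (hu.mono (by omega)), add_zero]⟩
  | tmul x a =>
    obtain ⟨d, h⟩ := Λ.exists_vanishes_apply a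
    exact ⟨d, fun u hu => by rw [contract_tmul, h u hu, zero_smul]⟩

/-- Together with `contract_functional` this identifies the quantum algebra with `∏ End (X m)`. -/
theorem functional_ext {u v : QuantumGroup b →ₗ[ℂ] ℂ}
    (h : ∀ m x, contract u (Λ.coact m x) = contract v (Λ.coact m x)) : u = v := by
  ext a
  obtain ⟨d, hd⟩ := Λ.exists_vanishes_apply a
  have := hd (u - v) fun m _ x => by rw [contract_sub_left, h, sub_self]
  exact sub_eq_zero.mp this

theorem functional_sum {ι : Type*} (s : Finset ι) (φ : ι → ∀ m, Module.End ℂ (Λ.X m)) :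
    Λ.functional (∑ i ∈ s, φ i) = ∑ i ∈ s, Λ.functional (φ i) := by
  ext a
  simp only [functional_apply, map_sum, Finset.sum_apply, LinearMap.sum_apply]

/-- The projection of representations onto their isotypic components of index at most `N`. -/
theorem exists_functional_action_eq (W : URep b) (w : W.carrier) : ∃ N : ℕ,
    W.action (WithConv.toConv (Λ.functional (∑ m ∈ Finset.range N, Pi.single m 1))) w = w := by
  obtain ⟨d, h⟩ := Λ.exists_vanishes_contract (W.coact w)
  refine ⟨d + 1, ?_⟩
  have h1 := h (Coalgebra.counit (R := ℂ) (A := QuantumGroup b) -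
    Λ.functional (∑ m ∈ Finset.range (d + 1), Pi.single m 1)) fun m hm x => by
      have : (∑ i ∈ Finset.range (d + 1), Pi.single i 1 :
          ∀ m, Module.End ℂ (Λ.X m)) m = 1 := by
        rw [Finset.sum_apply, Finset.sum_eq_single m]
        · simp
        · intro j _ hj
          exact Pi.single_eq_of_ne hj.symm _
        · intro hm'
          exact absurd (Finset.mem_range.mpr (by omega)) hm'
      rw [contract_sub_left, contract_functional, coact_counit, this, Module.End.one_apply,
        sub_self]
  rw [contract_sub_left, sub_eq_zero] at h1
  rw [URep.action_apply]
  exact h1.symm.trans (LinearMap.congr_fun W.counit w)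

/-- The matrix unit `v ⊗ ξ` of `End (X m)` as an element of the quantum algebra. -/
def unit (m : ℕ) (ξ : Module.Dual ℂ (Λ.X m)) (v : Λ.X m) : QuantumAlgebra b :=
  WithConv.toConv (Λ.functional (Pi.single m (ξ.smulRight v)))

theorem action_unit_same (m : ℕ) (ξ : Module.Dual ℂ (Λ.X m)) (v x : Λ.X m) :
    (Λ.rep m).action (Λ.unit m ξ v) x = ξ x • v := by
  refine (Λ.contract_functional _ m x).trans ?_
  rw [Pi.single_eq_same, LinearMap.smulRight_apply]

theorem action_unit_ne {j m : ℕ} (h : j ≠ m) (ξ : Module.Dual ℂ (Λ.X m)) (v : Λ.X m)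
    (x : Λ.X j) : (Λ.rep j).action (Λ.unit m ξ v) x = (0 : Λ.X j) := by
  refine (Λ.contract_functional _ j x).trans ?_
  rw [Pi.single_eq_of_ne h, LinearMap.zero_apply]

theorem quantumAlgebra_ext {u v : QuantumAlgebra b}
    (h : ∀ m x, (Λ.rep m).action u x = (Λ.rep m).action v x) : u = v :=
  WithConv.ofConv_injective (Λ.functional_ext h)

/-- For fixed `ξ` the matrix units form a left ideal that is an image of `X m`; this makes `hom`
linear over the quantum algebra. -/
theorem mul_unit (u : QuantumAlgebra b) (m : ℕ) (ξ : Module.Dual ℂ (Λ.X m)) (v : Λ.X m) :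
    u * Λ.unit m ξ v = Λ.unit m ξ ((Λ.rep m).action u v) := by
  refine Λ.quantumAlgebra_ext fun j x => ?_
  rw [map_mul, Module.End.mul_apply]
  by_cases h : j = m
  · subst h
    rw [action_unit_same, action_unit_same]
    exact map_smul _ _ _
  · rw [action_unit_ne Λ h, action_unit_ne Λ h]
    exact map_zero _

theorem unit_add (m : ℕ) (ξ : Module.Dual ℂ (Λ.X m)) (v w : Λ.X m) :
    Λ.unit m ξ (v + w) = Λ.unit m ξ v + Λ.unit m ξ w := by
  refine Λ.quantumAlgebra_ext fun j x => ?_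
  rw [map_add, LinearMap.add_apply]
  by_cases h : j = m
  · subst h
    rw [action_unit_same, action_unit_same, action_unit_same]
    exact smul_add _ _ _
  · rw [action_unit_ne Λ h, action_unit_ne Λ h, action_unit_ne Λ h]
    exact (add_zero (0 : Λ.X j)).symm

instance (m : ℕ) : Module (QuantumAlgebra b) (Λ.X m) := (Λ.rep m).moduleQuantumAlgebra

/-- The morphism `v ↦ (v ⊗ ξ) w` from `X m` to a representation. -/
def hom (W : URep b) (m : ℕ) (ξ : Module.Dual ℂ (Λ.X m)) (w : W.carrier) :
    (Λ.rep m).carrier →ₗ[QuantumAlgebra b] W.carrier where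
  toFun v := Λ.unit m ξ v • w
  map_add' v v' := by
    rw [← add_smul]
    exact congrArg (· • w) (Λ.unit_add m ξ v v')
  map_smul' u v := by
    rw [RingHom.id_apply, ← mul_smul, mul_unit]
    rfl

/-- On a given vector `w` the identity agrees with finitely many identities of the factors `End (X
m)`, and each of these is a sum of matrix units. So every representation is spanned by images of
morphisms from the `X m`; semisimplicity and the classification both follow from this. -/
theorem exists_sum_hom (W : URep b) (w : W.carrier) : ∃ N : ℕ, w = ∑ m ∈ Finset.range N,
    ∑ i, Λ.hom W m ((Module.finBasis ℂ (Λ.X m)).coord i) w (Module.finBasis ℂ (Λ.X m) i) := by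
  obtain ⟨N, h⟩ := Λ.exists_functional_action_eq W w
  refine ⟨N, ?_⟩
  have h1 : ∀ m : ℕ, (Pi.single m 1 : ∀ m, Module.End ℂ (Λ.X m)) = ∑ i,
      Pi.single m (((Module.finBasis ℂ (Λ.X m)).coord i).smulRight
        (Module.finBasis ℂ (Λ.X m) i)) := by
    intro m
    have : (1 : Module.End ℂ (Λ.X m)) = ∑ i, ((Module.finBasis ℂ (Λ.X m)).coord i).smulRight
        (Module.finBasis ℂ (Λ.X m) i) := by
      ext x
      simp only [LinearMap.sum_apply, LinearMap.smulRight_apply, Module.Basis.coord_apply,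
        Module.Basis.sum_repr, Module.End.one_apply]
    rw [this]
    exact map_sum (AddMonoidHom.single (fun m => Module.End ℂ (Λ.X m)) m) _ _
  simp only [h1, functional_sum] at h
  conv_lhs => rw [← h]
  have h2 : ∀ {ι : Type} (s : Finset ι) (f : ι → QuantumGroup b →ₗ[ℂ] ℂ),
      WithConv.toConv (∑ i ∈ s, f i) = ∑ i ∈ s, WithConv.toConv (f i) := by
    intro ι s f
    exact map_sum (WithConv.linearEquiv ℂ (QuantumGroup b →ₗ[ℂ] ℂ)).symm f s
  simp only [h2, map_sum, LinearMap.sum_apply]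
  rfl

theorem isIrreducible_rep (m : ℕ) [Nontrivial (Λ.X m)] : (Λ.rep m).IsIrreducible := by
  refine ⟨inferInstanceAs (Nontrivial (Λ.X m)), fun S hS => ?_⟩
  by_cases h : S = ⊥
  · exact Or.inl h
  obtain ⟨x, hx, hx0⟩ := (Submodule.ne_bot_iff S).mp h
  obtain ⟨ξ, hξ⟩ : ∃ ξ : Module.Dual ℂ (Λ.X m), ξ x ≠ 0 := by
    by_contra! h'
    exact hx0 ((Module.forall_dual_apply_eq_zero_iff ℂ (x : Λ.X m)).mp h')
  refine Or.inr (eq_top_iff.mpr fun y _ => ?_)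
  have := S.smul_mem (ξ x)⁻¹ (hS (Λ.unit m ξ y) x hx)
  rw [action_unit_same] at this
  change (ξ x)⁻¹ • (ξ x • (y : Λ.X m)) ∈ S at this
  rwa [smul_smul, inv_mul_cancel₀ hξ, one_smul] at this

theorem isSimpleModule_X (m : ℕ) [Nontrivial (Λ.X m)] :
    IsSimpleModule (QuantumAlgebra b) (Λ.X m) := (Λ.isIrreducible_rep m).isSimpleModule

/-- A matrix unit of `X m` acts by zero on every other `X j`, but not on `X m`. -/
theorem eq_of_equivalent {j m : ℕ} [Nontrivial (Λ.X m)]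
    (h : (Λ.rep j).Equivalent (Λ.rep m)) : j = m := by
  obtain ⟨e, he⟩ := h
  by_contra hne
  obtain ⟨x, hx⟩ := exists_ne (0 : Λ.X m)
  obtain ⟨ξ, hξ⟩ : ∃ ξ : Module.Dual ℂ (Λ.X m), ξ x ≠ 0 := by
    by_contra! h'
    exact hx ((Module.forall_dual_apply_eq_zero_iff ℂ (x : Λ.X m)).mp h')
  have h1 := he (Λ.unit m ξ x) (e.symm x)
  rw [action_unit_ne Λ hne, LinearEquiv.apply_symm_apply, action_unit_same] at h1
  have h2 : ξ x • x = 0 := h1.symm.trans (map_zero e)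
  exact smul_ne_zero hξ hx h2

theorem isSemisimpleModule (Λ : Ladder b) (W : URep b) :
    IsSemisimpleModule (QuantumAlgebra b) W.carrier := by
  have hX : ∀ m, IsSemisimpleModule (QuantumAlgebra b) (Λ.X m) := by
    intro m
    rcases subsingleton_or_nontrivial (Λ.X m) with h | h
    · exact IsSemisimpleModule.of_sSup_simples_eq_top (Subsingleton.elim _ _)
    · have := Λ.isSimpleModule_X m
      infer_instance
  refine isSemisimpleModule_of_isSemisimpleModule_submodule'
    (p := fun i : Σ m : ℕ, Module.Dual ℂ (Λ.X m) × W.carrier =>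
      LinearMap.range (Λ.hom W i.1 i.2.1 i.2.2)) (fun i => ?_) ?_
  · have := hX i.1
    exact IsSemisimpleModule.range _
  · refine eq_top_iff.mpr fun w _ => ?_
    obtain ⟨N, h⟩ := Λ.exists_sum_hom W w
    rw [h]
    refine Submodule.sum_mem _ fun m _ => Submodule.sum_mem _ fun i _ => ?_
    exact Submodule.mem_iSup_of_mem
      (⟨m, (Module.finBasis ℂ (Λ.X m)).coord i, w⟩ : Σ m : ℕ, Module.Dual ℂ (Λ.X m) × W.carrier)
      ⟨_, rfl⟩

theorem exists_hom_ne_zero (W : URep b) [Nontrivial W.carrier] :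
    ∃ m, ∃ f : (Λ.rep m).carrier →ₗ[QuantumAlgebra b] W.carrier, f ≠ 0 := by
  by_contra! h
  obtain ⟨w, hw⟩ := exists_ne (0 : W.carrier)
  obtain ⟨N, hN⟩ := Λ.exists_sum_hom W w
  refine hw (hN.trans (Finset.sum_eq_zero fun m _ => Finset.sum_eq_zero fun i _ => ?_))
  rw [h m (Λ.hom W m _ w), LinearMap.zero_apply]

theorem nontrivial_of_hom_ne_zero {W : URep b} {m : ℕ}
    {f : (Λ.rep m).carrier →ₗ[QuantumAlgebra b] W.carrier} (hf : f ≠ 0) :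
    Nontrivial (Λ.X m) := by
  by_contra h
  rw [not_nontrivial_iff_subsingleton] at h
  refine hf (LinearMap.ext fun x => ?_)
  have : x = 0 := h.elim x (0 : Λ.X m)
  rw [this, map_zero, LinearMap.zero_apply]

theorem exists_equivalent_rep (W : URep b) (hW : W.IsIrreducible) :
    ∃ m, W.Equivalent (Λ.rep m) := by
  have := hW.1
  have := hW.isSimpleModule
  obtain ⟨m, f, hf⟩ := Λ.exists_hom_ne_zero W
  have := Λ.nontrivial_of_hom_ne_zero hf
  have := Λ.isSimpleModule_X m
  exact ⟨m, (URep.Equivalent.of_linearEquiv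
    (LinearEquiv.ofBijective f (LinearMap.bijective_of_ne_zero hf))).symm⟩

theorem exists_isCompl (Λ : Ladder b) (W : URep b) (S : Submodule ℂ W.carrier)
    (hS : W.IsInvariant S) :
    ∃ T : Submodule ℂ W.carrier, W.IsInvariant T ∧ IsCompl S T := by
  have := Λ.isSemisimpleModule W
  obtain ⟨T, hT⟩ := ComplementedLattice.exists_isCompl hS.toSubmodule
  refine ⟨T.restrictScalars ℂ, URep.isInvariant_restrictScalars T, ?_⟩
  rw [isCompl_iff, Submodule.disjoint_def, Submodule.codisjoint_iff_exists_add_eq] at hT ⊢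
  exact hT

end Ladder

/-! ### The Clebsch–Gordan rule and the dimensions -/

theorem tensorMul_tmul_left {M N A : Type} [AddCommGroup M] [Module ℂ M] [AddCommGroup N]
    [Module ℂ N] [Ring A] [Algebra ℂ A] (x : M) (c : A) (t : N ⊗[ℂ] A) :
    URep.tensorMul ((x ⊗ₜ[ℂ] c) ⊗ₜ[ℂ] t) = tensorAct (TensorProduct.mk ℂ M N x) c t := by
  induction t using TensorProduct.induction_on with
  | zero => simp
  | add y z hy hz => simp only [map_add, TensorProduct.tmul_add, hy, hz]
  | tmul y d => simp

theorem rTensor_eq_tensorAct {M N A : Type*} [AddCommGroup M] [Module ℂ M] [AddCommGroup N]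
    [Module ℂ N] [Ring A] [Algebra ℂ A] (f : M →ₗ[ℂ] N) : f.rTensor A = tensorAct f 1 := by
  rw [tensorAct, LinearMap.mulLeft_one]
  rfl

theorem URep.coact_sum_apply {n : ℕ} {b : GL (Fin n) ℂ} (V W : URep b)
    (p : V.carrier × W.carrier) :
    (V.sum W).coact p = tensorAct (LinearMap.inl ℂ V.carrier W.carrier) 1 (V.coact p.1) +
      tensorAct (LinearMap.inr ℂ V.carrier W.carrier) 1 (W.coact p.2) := by
  rw [← rTensor_eq_tensorAct, ← rTensor_eq_tensorAct]
  rfl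

theorem URep.action_sum_apply {n : ℕ} {b : GL (Fin n) ℂ} (V W : URep b) (u : QuantumAlgebra b)
    (p : V.carrier × W.carrier) :
    (V.sum W).action u p = (V.action u p.1, W.action u p.2) := by
  refine (congrArg (contract (M := V.carrier × W.carrier) u.ofConv)
    (coact_sum_apply V W p)).trans ?_
  rw [map_add, contract_tensorAct, contract_tensorAct, LinearMap.mulLeft_one, LinearMap.comp_id,
    ← action_apply, ← action_apply]
  exact Prod.ext (add_zero _) (zero_add _)

theorem URep.equivalent_sum_of_subsingleton {n : ℕ} {b : GL (Fin n) ℂ} (V W : URep b)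
    [Subsingleton W.carrier] : (V.sum W).Equivalent V :=
  ⟨{ LinearMap.fst ℂ V.carrier W.carrier with
      invFun := fun x => (x, 0)
      left_inv := fun _ => Prod.ext rfl (Subsingleton.elim _ _)
      right_inv := fun _ => rfl },
    fun u _ => congrArg Prod.fst (action_sum_apply V W u _)⟩

namespace Ladder

variable {n : ℕ} {b : GL (Fin n) ℂ} (Λ : Ladder b)

open QuantumGroup (L)

/-- The standard basis of `X 2`. -/
def vec (k : Fin n) : Λ.X 2 := Λ.up 1 k (Λ.vac.symm 1)

theorem coact_vec (k : Fin n) : Λ.coact 2 (Λ.vec k) = ∑ a, Λ.vec a ⊗ₜ[ℂ] L b a k := by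
  rw [vec, coact_up]
  simp [coact_one, vec]

theorem dn_vec (k l : Fin n) : Λ.dn 1 k (Λ.vec l) = if k = l then Λ.vac.symm 1 else 0 := by
  rw [vec, dn_up, Subsingleton.elim (Λ.dnt 0 l _) 0, map_zero, smul_zero, sub_zero]

theorem sum_smul_vec (x : Λ.X 2) : ∑ k, Λ.vac (Λ.dn 1 k x) • Λ.vec k = x := by
  conv_rhs => rw [← Λ.up_dn 0 x]
  refine Finset.sum_congr rfl fun k _ => ?_
  rw [vec, ← map_smul, ← map_smul, smul_eq_mul, mul_one, LinearEquiv.symm_apply_apply]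

/-- `(w, v) ↦ ∑ e k ⊗ (dn k w + upt k v)`. -/
def toTensor (m : ℕ) : Λ.X (m + 2) × Λ.X m →ₗ[ℂ] Λ.X 2 ⊗[ℂ] Λ.X (m + 1) :=
  ∑ k, TensorProduct.mk ℂ (Λ.X 2) (Λ.X (m + 1)) (Λ.vec k) ∘ₗ
    (Λ.dn (m + 1) k).coprod (Λ.upt m k)

theorem toTensor_apply (m : ℕ) (p : Λ.X (m + 2) × Λ.X m) : Λ.toTensor m p =
    ∑ k, Λ.vec k ⊗ₜ[ℂ] (Λ.dn (m + 1) k p.1 + Λ.upt m k p.2) := by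
  simp [toTensor, LinearMap.sum_apply]

/-- `x ⊗ y ↦ ∑ (dn k x) (up k y, γ⁻¹ dnt k y)`. -/
def ofTensor (m : ℕ) : Λ.X 2 ⊗[ℂ] Λ.X (m + 1) →ₗ[ℂ] Λ.X (m + 2) × Λ.X m :=
  TensorProduct.lift (∑ k, (LinearMap.lsmul ℂ (Λ.X (m + 1) →ₗ[ℂ] Λ.X (m + 2) × Λ.X m)).flip
    ((Λ.up (m + 1) k).prod ((Λ.γ m)⁻¹ • Λ.dnt m k)) ∘ₗ Λ.vac.toLinearMap ∘ₗ Λ.dn 1 k)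

theorem ofTensor_vec_tmul (m : ℕ) (k : Fin n) (y : Λ.X (m + 1)) :
    Λ.ofTensor m (Λ.vec k ⊗ₜ[ℂ] y) = (Λ.up (m + 1) k y, (Λ.γ m)⁻¹ • Λ.dnt m k y) := by
  simp only [ofTensor, TensorProduct.lift.tmul, LinearMap.sum_apply, LinearMap.comp_apply, dn_vec]
  rw [Finset.sum_eq_single k]
  · simp
  · intro l _ hl
    simp [hl]
  · simp

/-- The relation `dn_up` says precisely that the projections to the two summands add up to the
identity. The composite in the other order, `ofTensor_toTensor`, consumes the relations `up_dn`,
`sum_up_upt`, `sum_dnt_dn` and `sum_dnt_upt`. -/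
theorem toTensor_ofTensor (m : ℕ) (t : Λ.X 2 ⊗[ℂ] Λ.X (m + 1)) :
    Λ.toTensor m (Λ.ofTensor m t) = t := by
  induction t using TensorProduct.induction_on with
  | zero => simp
  | add x y hx hy => simp only [map_add, hx, hy]
  | tmul x y =>
    rw [← Λ.sum_smul_vec x, TensorProduct.sum_tmul, map_sum, map_sum]
    refine Finset.sum_congr rfl fun k _ => ?_
    rw [← TensorProduct.smul_tmul', map_smul, map_smul, ofTensor_vec_tmul, toTensor_apply]
    simp only [dn_up, map_smul, sub_add_cancel]
    congr 1
    rw [Finset.sum_eq_single k]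
    · simp
    · intro l _ hl
      simp [hl]
    · simp

theorem ofTensor_toTensor (m : ℕ) (p : Λ.X (m + 2) × Λ.X m) :
    Λ.ofTensor m (Λ.toTensor m p) = p := by
  rw [toTensor_apply, map_sum]
  simp only [ofTensor_vec_tmul, map_add]
  refine Prod.ext ?_ ?_
  · simp only [Prod.fst_sum, Finset.sum_add_distrib, up_dn, sum_up_upt, add_zero]
  · simp only [Prod.snd_sum, ← Finset.smul_sum, Finset.sum_add_distrib, sum_dnt_dn, sum_dnt_upt,
      zero_add, smul_smul, inv_mul_cancel₀ (Λ.γ_ne m), one_smul]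

/-- `X 2 ⊗ X (m + 1) ≃ X (m + 2) ⊕ X m`. -/
def tensorEquiv (m : ℕ) : (Λ.X (m + 2) × Λ.X m) ≃ₗ[ℂ] Λ.X 2 ⊗[ℂ] Λ.X (m + 1) :=
  LinearEquiv.ofLinearMap (Λ.toTensor m) (Λ.ofTensor m) (LinearMap.ext (Λ.toTensor_ofTensor m))
    (LinearMap.ext (Λ.ofTensor_toTensor m))

theorem tensorMul_coact_vec (k : Fin n) {m : ℕ} (t : Λ.X m ⊗[ℂ] QuantumGroup b) :
    URep.tensorMul (Λ.coact 2 (Λ.vec k) ⊗ₜ[ℂ] t) =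
      ∑ a, tensorAct (TensorProduct.mk ℂ (Λ.X 2) (Λ.X m) (Λ.vec a)) 1
        (tensorAct LinearMap.id (L b a k) t) := by
  simp only [coact_vec, TensorProduct.sum_tmul, map_sum, tensorMul_tmul_left, tensorAct_tensorAct,
    LinearMap.comp_id, one_mul]

theorem tensorCoact_vec_tmul (k : Fin n) {m : ℕ} (y : Λ.X m) :
    URep.tensorCoact (Λ.rep 2) (Λ.rep m) (Λ.vec k ⊗ₜ[ℂ] y) =
      ∑ a, tensorAct (TensorProduct.mk ℂ (Λ.X 2) (Λ.X m) (Λ.vec a)) 1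
        (tensorAct LinearMap.id (L b a k) (Λ.coact m y)) :=
  Λ.tensorMul_coact_vec k (Λ.coact m y)

theorem coact_toTensor (m : ℕ) (p : Λ.X (m + 2) × Λ.X m) :
    URep.tensorCoact (Λ.rep 2) (Λ.rep (m + 1)) (Λ.toTensor m p) = tensorAct (Λ.toTensor m) 1
      (tensorAct (LinearMap.inl ℂ (Λ.X (m + 2)) (Λ.X m)) 1 (Λ.coact (m + 2) p.1) +
        tensorAct (LinearMap.inr ℂ (Λ.X (m + 2)) (Λ.X m)) 1 (Λ.coact m p.2)) := by
  rw [toTensor_apply, map_add, tensorAct_tensorAct, tensorAct_tensorAct, one_mul, map_sum]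
  have h1 : Λ.toTensor m ∘ₗ LinearMap.inl ℂ (Λ.X (m + 2)) (Λ.X m) =
      ∑ k, TensorProduct.mk ℂ (Λ.X 2) (Λ.X (m + 1)) (Λ.vec k) ∘ₗ Λ.dn (m + 1) k := by
    ext x
    simp [toTensor_apply, LinearMap.sum_apply]
  have h2 : Λ.toTensor m ∘ₗ LinearMap.inr ℂ (Λ.X (m + 2)) (Λ.X m) =
      ∑ k, TensorProduct.mk ℂ (Λ.X 2) (Λ.X (m + 1)) (Λ.vec k) ∘ₗ Λ.upt m k := by
    ext x
    simp [toTensor_apply, LinearMap.sum_apply]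
  rw [h1, h2, tensorAct_sum_left, tensorAct_sum_left]
  refine (Finset.sum_congr rfl fun k _ => Λ.tensorCoact_vec_tmul k _).trans ?_
  have h3 : ∀ a : Fin n, tensorAct
      (TensorProduct.mk ℂ (Λ.X 2) (Λ.X (m + 1)) (Λ.vec a) ∘ₗ Λ.dn (m + 1) a) 1
        (Λ.coact (m + 2) p.1) = ∑ k, tensorAct (TensorProduct.mk ℂ _ _ (Λ.vec a)) 1
          (tensorAct LinearMap.id (L b a k) (Λ.coact (m + 1) (Λ.dn (m + 1) k p.1))) := by
    intro a
    rw [← map_sum, ← tensorAct_dn, tensorAct_tensorAct, one_mul]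
  have h4 : ∀ a : Fin n, tensorAct
      (TensorProduct.mk ℂ (Λ.X 2) (Λ.X (m + 1)) (Λ.vec a) ∘ₗ Λ.upt m a) 1
        (Λ.coact m p.2) = ∑ k, tensorAct (TensorProduct.mk ℂ _ _ (Λ.vec a)) 1
          (tensorAct LinearMap.id (L b a k) (Λ.coact (m + 1) (Λ.upt m k p.2))) := by
    intro a
    rw [← map_sum, sum_tensorAct_coact_upt, tensorAct_tensorAct, one_mul]
  simp only [map_add, Finset.sum_add_distrib]
  refine congrArg₂ (· + ·) ?_ ?_
  · rw [Finset.sum_comm]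
    exact Finset.sum_congr rfl fun a _ => (h3 a).symm
  · rw [Finset.sum_comm]
    exact Finset.sum_congr rfl fun a _ => (h4 a).symm

/-- The Clebsch–Gordan rule. -/
theorem equivalent_tensor (m : ℕ) :
    ((Λ.rep 2).tensor (Λ.rep (m + 1))).Equivalent ((Λ.rep (m + 2)).sum (Λ.rep m)) :=
  URep.Equivalent.symm (URep.Equivalent.of_coact (Λ.tensorEquiv m) fun p =>
    (Λ.coact_toTensor m p).trans (congrArg (tensorAct (Λ.toTensor m) 1)
      (URep.coact_sum_apply (Λ.rep (m + 2)) (Λ.rep m) p)).symm)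

theorem equivalent_trivial : (Λ.rep 1).Equivalent (URep.trivial b) :=
  URep.Equivalent.of_coact Λ.vac fun x => by
    rw [coact_one, tensorAct_tmul, mul_one]
    rfl

/-- `X 2 ≃ ℂⁿ`. -/
def fundamentalEquiv : (Fin n → ℂ) ≃ₗ[ℂ] Λ.X 2 :=
  LinearEquiv.ofLinearMap (∑ k, (LinearMap.toSpanSingleton ℂ (Λ.X 2) (Λ.vec k)) ∘ₗ LinearMap.proj k)
    (LinearMap.pi fun k => Λ.vac.toLinearMap ∘ₗ Λ.dn 1 k)
    (by
      ext x
      simpa [LinearMap.sum_apply] using Λ.sum_smul_vec x)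
    (by
      ext f k
      simp [dn_vec, Pi.single_apply, apply_ite])

theorem fundamentalEquiv_single (k : Fin n) : Λ.fundamentalEquiv (Pi.single k 1) = Λ.vec k := by
  simp [fundamentalEquiv, LinearMap.sum_apply, Pi.single_apply]

theorem equivalent_fundamental : (Λ.rep 2).Equivalent (URep.fundamental b) := by
  refine URep.Equivalent.symm (URep.Equivalent.of_coact Λ.fundamentalEquiv fun x => ?_)
  refine LinearMap.congr_fun (f := Λ.coact 2 ∘ₗ Λ.fundamentalEquiv.toLinearMap)
    (g := tensorAct Λ.fundamentalEquiv.toLinearMap 1 ∘ₗ (URep.fundamental b).coact) ?_ x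
  refine (Pi.basisFun ℂ (Fin n)).ext fun j => ?_
  simp [URep.fundamental, fundamentalEquiv_single, coact_vec]

theorem finrank_zero : Module.finrank ℂ (Λ.X 0) = 0 := Module.finrank_zero_of_subsingleton

theorem finrank_one : Module.finrank ℂ (Λ.X 1) = 1 := by
  rw [Λ.vac.finrank_eq, Module.finrank_self]

theorem finrank_two : Module.finrank ℂ (Λ.X 2) = n := by
  rw [← Λ.fundamentalEquiv.finrank_eq, Module.finrank_fin_fun]

theorem finrank_add_two (m : ℕ) : n * Module.finrank ℂ (Λ.X (m + 1)) =
    Module.finrank ℂ (Λ.X (m + 2)) + Module.finrank ℂ (Λ.X m) := by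
  have h := (Λ.tensorEquiv m).finrank_eq
  rw [Module.finrank_prod, Module.finrank_tensorProduct, finrank_two] at h
  exact h.symm

/-- The recurrence with `n ≥ 2` makes the increments of the dimension nondecreasing. This is the
source of the nontriviality of all `X (m + 1)`. -/
theorem finrank_lt (hn : 2 ≤ n) (m : ℕ) :
    Module.finrank ℂ (Λ.X m) < Module.finrank ℂ (Λ.X (m + 1)) := by
  induction m with
  | zero => rw [finrank_zero, finrank_one]; exact one_pos
  | succ m ih =>
    have h := Λ.finrank_add_two m
    nlinarith

theorem nontrivial (hn : 2 ≤ n) (m : ℕ) : Nontrivial (Λ.X (m + 1)) :=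
  Module.nontrivial_of_finrank_pos (lt_of_le_of_lt (Nat.zero_le _) (Λ.finrank_lt hn m))

end Ladder

/-! ### Splitting off direct summands as comodules -/

theorem contract_ext {M A : Type*} [AddCommGroup M] [Module ℂ M] [Ring A] [Algebra ℂ A]
    {s t : M ⊗[ℂ] A} (h : ∀ u : A →ₗ[ℂ] ℂ, contract u s = contract u t) : s = t := by
  rw [← sub_eq_zero]
  have h0 : ∀ u : A →ₗ[ℂ] ℂ, contract u (s - t) = 0 := fun u => by rw [map_sub, h, sub_self]
  generalize s - t = t at h0
  let e := Module.Free.chooseBasis ℂ M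
  obtain ⟨c, rfl⟩ := TensorProduct.eq_repr_basis_left e t
  have hc : c = 0 := by
    ext i
    refine (Module.forall_dual_apply_eq_zero_iff ℂ _).mp fun u => ?_
    have h1 := h0 u
    simp only [Finsupp.sum, map_sum, contract_tmul] at h1
    by_cases hi : i ∈ c.support
    · exact linearIndependent_iff'.mp e.linearIndependent c.support _ h1 i hi
    · rw [Finsupp.notMem_support_iff.mp hi, map_zero]
  rw [hc, Finsupp.sum_zero_index]

namespace URep

variable {n : ℕ} {b : GL (Fin n) ℂ}

/-- Functionals on `A` separate the elements of `M ⊗ A`, so a map that commutes with the action of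
the quantum algebra is automatically a map of comodules. -/
theorem coact_map (V W : URep b) (f : V.carrier →ₗ[ℂ] W.carrier)
    (hf : ∀ (u : QuantumAlgebra b) x, f (V.action u x) = W.action u (f x)) (x : V.carrier) :
    W.coact (f x) = tensorAct f 1 (V.coact x) :=
  contract_ext fun u => by
    rw [contract_tensorAct, LinearMap.mulLeft_one, LinearMap.comp_id]
    exact (hf (WithConv.toConv u) x).symm

/-- A retract of a representation along a pair of maps whose composition is a morphism. -/
def retract (W : URep b) (M : Type) [AddCommGroup M] [Module ℂ M] [Module.Finite ℂ M]
    (i : M →ₗ[ℂ] W.carrier) (p : W.carrier →ₗ[ℂ] M) (h : p ∘ₗ i = LinearMap.id)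
    (hc : W.coact ∘ₗ (i ∘ₗ p) = (i ∘ₗ p).rTensor (QuantumGroup b) ∘ₗ W.coact) : URep b where
  carrier := M
  coact := p.rTensor (QuantumGroup b) ∘ₗ W.coact ∘ₗ i
  coassoc := by
    have he : (p.rTensor (QuantumGroup b) ∘ₗ W.coact ∘ₗ i) ∘ₗ p =
        p.rTensor (QuantumGroup b) ∘ₗ W.coact := by
      rw [LinearMap.comp_assoc, LinearMap.comp_assoc, hc, ← LinearMap.comp_assoc,
        ← LinearMap.rTensor_comp, ← LinearMap.comp_assoc, h, LinearMap.id_comp]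
    have h1 := congrArg (· ∘ₗ i) (coassoc_comp p he W.coassoc)
    simpa only [LinearMap.comp_assoc, h, LinearMap.comp_id] using h1
  counit := by
    have he : (p.rTensor (QuantumGroup b) ∘ₗ W.coact ∘ₗ i) ∘ₗ p =
        p.rTensor (QuantumGroup b) ∘ₗ W.coact := by
      rw [LinearMap.comp_assoc, LinearMap.comp_assoc, hc, ← LinearMap.comp_assoc,
        ← LinearMap.rTensor_comp, ← LinearMap.comp_assoc, h, LinearMap.id_comp]
    have h1 := congrArg (· ∘ₗ i) (counit_comp p he W.counit)
    simpa only [LinearMap.comp_assoc, h, LinearMap.comp_id] using h1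

/-- The complement is the kernel of `r`. It has to carry a coaction and not only an action; it
receives one as the retract defined by the idempotent `1 - f ∘ r`. -/
theorem exists_equivalent_sum {V W : URep b} (f : V.carrier →ₗ[QuantumAlgebra b] W.carrier)
    (r : W.carrier →ₗ[QuantumAlgebra b] V.carrier) (h : r ∘ₗ f = LinearMap.id) :
    ∃ T : URep b, W.Equivalent (V.sum T) := by
  have hrf : ∀ x, r (f x) = x := fun x => LinearMap.congr_fun h x
  let q : W.carrier →ₗ[QuantumAlgebra b] W.carrier := LinearMap.id - f ∘ₗ r
  have hq : ∀ x, q x = x - f (r x) := fun x => rfl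
  have hrq : ∀ x, r (q x) = 0 := fun x => by rw [hq, map_sub, hrf, sub_self]
  let K : Submodule ℂ W.carrier := (LinearMap.ker r).restrictScalars ℂ
  let p : W.carrier →ₗ[ℂ] K := (q.restrictScalars ℂ).codRestrict K hrq
  have hp : p ∘ₗ K.subtype = LinearMap.id := by
    ext x
    have : r x.1 = 0 := x.2
    change x.1 - f (r x.1) = x.1
    rw [this, map_zero, sub_zero]
  have hc : W.coact ∘ₗ (K.subtype ∘ₗ p) =
      (K.subtype ∘ₗ p).rTensor (QuantumGroup b) ∘ₗ W.coact := by
    refine LinearMap.ext fun x => ?_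
    rw [rTensor_eq_tensorAct]
    exact coact_map W W (q.restrictScalars ℂ) (fun u x => q.map_smul u x) x
  let T := W.retract K K.subtype p hp hc
  have hT : ∀ (u : QuantumAlgebra b) (t : T.carrier),
      K.subtype (T.action u t) = W.action u (K.subtype t) := by
    intro u t
    have h1 : T.action u t = p (W.action u (K.subtype t)) := by
      rw [action_apply, action_apply]
      change contract _ (p.rTensor (QuantumGroup b) (W.coact (K.subtype t))) = _
      rw [rTensor_eq_tensorAct, contract_tensorAct, LinearMap.mulLeft_one, LinearMap.comp_id]
    have h2 : r (K.subtype t) = 0 := t.2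
    have h3 : r (W.action u (K.subtype t)) = 0 := by
      refine (r.map_smul u (K.subtype t)).trans ?_
      rw [h2, smul_zero]
    rw [h1]
    change W.action u (K.subtype t) - f (r (W.action u (K.subtype t))) = _
    rw [h3, map_zero, sub_zero]
  refine ⟨T, Equivalent.symm ⟨LinearEquiv.ofLinearMap
    ((f.restrictScalars ℂ).coprod K.subtype) ((r.restrictScalars ℂ).prod p) ?_ ?_, ?_⟩⟩
  · refine LinearMap.ext fun x => ?_
    change f (r x) + (x - f (r x)) = x
    abel
  · refine LinearMap.ext fun x => Prod.ext ?_ (Subtype.ext ?_)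
    · change r (f x.1 + x.2.1) = x.1
      have : r x.2.1 = 0 := x.2.2
      rw [map_add, hrf, this, add_zero]
    · change (f x.1 + x.2.1) - f (r (f x.1 + x.2.1)) = x.2.1
      have : r x.2.1 = 0 := x.2.2
      rw [map_add, hrf, this, add_zero, add_sub_cancel_left]
  · intro u x
    refine (congrArg ((f.restrictScalars ℂ).coprod K.subtype) (action_sum_apply V T u x)).trans ?_
    refine (congrArg₂ (· + ·) (f.map_smul u x.1) (hT u x.2)).trans ?_
    exact (map_add (W.action u) (f x.1) (K.subtype x.2)).symm

end URep

theorem Ladder.exists_equivalent_rep_sum {n : ℕ} {b : GL (Fin n) ℂ} (Λ : Ladder b) (W : URep b)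
    [Nontrivial W.carrier] :
    ∃ m T, Nontrivial (Λ.X m) ∧ W.Equivalent ((Λ.rep m).sum T) := by
  obtain ⟨m, f, hf⟩ := Λ.exists_hom_ne_zero W
  have := Λ.nontrivial_of_hom_ne_zero hf
  have := Λ.isSimpleModule_X m
  have := Λ.isSemisimpleModule W
  obtain ⟨r, hr⟩ := IsSemisimpleModule.extension_property f (LinearMap.injective_of_ne_zero hf)
    LinearMap.id
  obtain ⟨T, hT⟩ := URep.exists_equivalent_sum (V := Λ.rep m) f r hr
  exact ⟨m, T, inferInstance, hT⟩

/-! ### Representation rings and Chebyshev polynomials -/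

namespace RepRing

variable {X : Type 1} {iso : X → X → Prop} {sum tensor : X → X → X} {one : X}

/-- The class of a representation. -/
def of (iso : X → X → Prop) (sum tensor : X → X → X) (one : X) (V : X) :
    RepRing iso sum tensor one :=
  RingQuot.mkRingHom _ (FreeAlgebra.ι ℤ V)

local notation "cl" => of iso sum tensor one

theorem of_eq {V W : X} (h : iso V W) : cl V = cl W :=
  RingQuot.mkRingHom_rel (RepRingRel.iso h)

theorem of_sum (V W : X) : cl (sum V W) = cl V + cl W :=
  (RingQuot.mkRingHom_rel (RepRingRel.sum V W)).trans (map_add _ _ _)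

theorem of_tensor (V W : X) : cl (tensor V W) = cl V * cl W :=
  (RingQuot.mkRingHom_rel (RepRingRel.tensor V W)).trans (map_mul _ _ _)

theorem of_one : cl one = 1 :=
  (RingQuot.mkRingHom_rel RepRingRel.one).trans (map_one _)

/-- The universal property of the representation ring. -/
def lift {R : Type*} [Ring R] (c : X → R) (h_iso : ∀ V W, iso V W → c V = c W)
    (h_sum : ∀ V W, c (sum V W) = c V + c W) (h_tensor : ∀ V W, c (tensor V W) = c V * c W)
    (h_one : c one = 1) : RepRing iso sum tensor one →+* R :=
  RingQuot.lift ⟨(FreeAlgebra.lift ℤ c : FreeAlgebra ℤ X →ₐ[ℤ] R).toRingHom, by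
    intro x y h
    cases h with
    | iso h => simpa using h_iso _ _ h
    | sum V W => simpa using h_sum V W
    | tensor V W => simpa using h_tensor V W
    | one => simpa using h_one⟩

theorem lift_of {R : Type*} [Ring R] (c : X → R) (h_iso : ∀ V W, iso V W → c V = c W)
    (h_sum : ∀ V W, c (sum V W) = c V + c W) (h_tensor : ∀ V W, c (tensor V W) = c V * c W)
    (h_one : c one = 1) (V : X) : lift c h_iso h_sum h_tensor h_one (cl V) = c V := by
  rw [lift, of, RingQuot.lift_mkRingHom_apply]
  simp

theorem subring_eq_top (S : Subring (RepRing iso sum tensor one)) (h : ∀ V, cl V ∈ S) :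
    S = ⊤ := by
  refine eq_top_iff.mpr fun x _ => ?_
  obtain ⟨x, rfl⟩ := RingQuot.mkRingHom_surjective _ x
  induction x using FreeAlgebra.induction with
  | grade0 r => simp
  | grade1 V => exact h V
  | mul x y hx hy =>
    rw [map_mul]
    exact S.mul_mem (hx trivial) (hy trivial)
  | add x y hx hy =>
    rw [map_add]
    exact S.add_mem (hx trivial) (hy trivial)

/-- Induction on the dimension. The first alternative is the one met by zero spaces: `[W] = [W] +
[W]` forces `[W] = 0`. -/
theorem of_mem_closure (v : ℕ → X) (dim : X → ℕ) (h : ∀ W, iso W (sum W W) ∨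
    ∃ k T, iso W (sum (v k) T) ∧ dim T < dim W) (W : X) :
    cl W ∈ AddSubgroup.closure (Set.range fun k => cl (v k)) := by
  induction hd : dim W using Nat.strong_induction_on generalizing W with
  | _ d ih =>
    subst hd
    rcases h W with h | ⟨k, T, h, hT⟩
    · have h1 := of_eq (iso := iso) (sum := sum) (tensor := tensor) (one := one) h
      rw [of_sum, left_eq_add] at h1
      rw [h1]
      exact zero_mem _
    · rw [of_eq h, of_sum]
      exact add_mem (AddSubgroup.subset_closure ⟨k, rfl⟩) (ih _ hT T rfl)

end RepRing

-- Since `X * S (k + 1) = S (k + 2) + S k`, the span is stable under multiplication by `X`, and it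
-- contains `1 = S 0`.
open Polynomial in
theorem Polynomial.Chebyshev.span_S : Submodule.span ℤ (Set.range fun k : ℕ => S ℤ k) = ⊤ := by
  set M := Submodule.span ℤ (Set.range fun k : ℕ => S ℤ k) with hM
  have hX : ∀ P ∈ M, X * P ∈ M := by
    intro P hP
    induction hP using Submodule.span_induction with
    | mem x hx =>
      obtain ⟨k, rfl⟩ := hx
      cases k with
      | zero =>
        refine Submodule.subset_span ⟨1, ?_⟩
        simp
      | succ k =>
        have h : X * S ℤ ((k + 1 : ℕ) : ℤ) = S ℤ ((k + 2 : ℕ) : ℤ) + S ℤ (k : ℤ) := by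
          have := S_add_two ℤ (k : ℤ)
          push_cast
          rw [this, sub_add_cancel]
        simp only [h]
        exact add_mem (Submodule.subset_span ⟨k + 2, rfl⟩) (Submodule.subset_span ⟨k, rfl⟩)
    | zero => simp
    | add x y _ _ hx hy =>
      rw [mul_add]
      exact add_mem hx hy
    | smul a x _ hx =>
      rw [mul_smul_comm]
      exact M.smul_mem a hx
  have hXn : ∀ k : ℕ, (X : ℤ[X]) ^ k ∈ M := by
    intro k
    induction k with
    | zero =>
      refine Submodule.subset_span ⟨0, ?_⟩
      simp
    | succ k ih =>
      rw [pow_succ']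
      exact hX _ ih
  refine eq_top_iff.mpr fun P _ => ?_
  rw [Polynomial.as_sum_range_C_mul_X_pow P]
  refine Submodule.sum_mem _ fun i _ => ?_
  rw [← Polynomial.smul_eq_C_mul]
  exact M.smul_mem _ (hXn i)

-- The presentation shared by both representation rings. The substitution `X ↦ v 1` maps `S k` to `v
-- k`, since both sequences satisfy the same recursion. It is injective because the `S k` span and
-- the `v k` are independent, and surjective because the `v k` generate the ring.
open Polynomial in
theorem exists_chebyshev_ringEquiv {R : Type*} [Ring R] (v : ℕ → R) (h0 : v 0 = 1)
    (h1 : ∀ k, v 1 * v (k + 1) = v (k + 2) + v k)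
    (htop : ∀ S : Subring R, (∀ k, v k ∈ S) → S = ⊤) (hv : LinearIndependent ℤ v) :
    ∃ e : ℤ[X] ≃+* R, ∀ k : ℕ, e (Chebyshev.S ℤ k) = v k := by
  let f : ℤ[X] →+* R := (aeval (v 1) : ℤ[X] →ₐ[ℤ] R).toRingHom
  have hf : ∀ k : ℕ, f (Chebyshev.S ℤ k) = v k := by
    intro k
    induction k using Nat.twoStepInduction with
    | zero => simp [f, h0]
    | one => simp [f]
    | more k ih0 ih1 =>
      have h := Chebyshev.S_add_two ℤ (k : ℤ)
      push_cast at ih1 ⊢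
      rw [h, map_sub, map_mul, ih0, ih1]
      have hX : f X = v 1 := by simp [f]
      rw [hX, h1, add_sub_cancel_right]
  refine ⟨RingEquiv.ofBijective f ⟨?_, ?_⟩, hf⟩
  · rw [injective_iff_map_eq_zero]
    intro P hP
    have hmem : P ∈ Submodule.span ℤ (Set.range fun k : ℕ => Chebyshev.S ℤ k) := by
      rw [Chebyshev.span_S]
      trivial
    obtain ⟨c, rfl⟩ := Finsupp.mem_span_range_iff_exists_finsupp.mp hmem
    have hc : c = 0 := by
      refine linearIndependent_iff.mp hv c ?_
      rw [Finsupp.linearCombination_apply, ← hP, Finsupp.sum, Finsupp.sum, map_sum]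
      exact Finset.sum_congr rfl fun k _ => by rw [map_zsmul, hf]
    rw [hc, Finsupp.sum_zero_index]
  · have := htop f.range fun k => ⟨_, hf k⟩
    exact RingHom.range_eq_top.mp this

/-! ### Characters and the representation ring of the quantum algebra -/

section character

variable {A M N : Type*} [Ring A] [Algebra ℂ A] [AddCommGroup M] [Module ℂ M]
  [AddCommGroup N] [Module ℂ N]

/-- `v ⊗ a ↦ ξ v • a`. -/
def evalLeft (ξ : Module.Dual ℂ M) : M ⊗[ℂ] A →ₗ[ℂ] A :=
  (TensorProduct.lid ℂ A).toLinearMap ∘ₗ ξ.rTensor A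

@[simp]
theorem evalLeft_tmul (ξ : Module.Dual ℂ M) (x : M) (a : A) :
    evalLeft ξ (x ⊗ₜ[ℂ] a) = ξ x • a := by
  simp [evalLeft]

theorem apply_evalLeft (u : A →ₗ[ℂ] ℂ) (ξ : Module.Dual ℂ M) (t : M ⊗[ℂ] A) :
    u (evalLeft ξ t) = ξ (contract u t) := by
  induction t using TensorProduct.induction_on with
  | zero => simp
  | add x y hx hy => simp only [map_add, hx, hy]
  | tmul x a => simp [mul_comm]

theorem sum_apply_evalLeft {ι : Type*} [Fintype ι] [DecidableEq ι] (e : Module.Basis ι ℂ M)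
    (ρ : M →ₗ[ℂ] M ⊗[ℂ] A) (u : A →ₗ[ℂ] ℂ) :
    u (∑ i, evalLeft (e.coord i) (ρ (e i))) = LinearMap.trace ℂ M (contract u ∘ₗ ρ) := by
  rw [LinearMap.trace_eq_matrix_trace ℂ e, map_sum, Matrix.trace]
  refine Finset.sum_congr rfl fun i _ => ?_
  rw [apply_evalLeft, Matrix.diag_apply, LinearMap.toMatrix_apply]
  rfl

theorem dual_ext {x y : M} (h : ∀ u : M →ₗ[ℂ] ℂ, u x = u y) : x = y := by
  rw [← sub_eq_zero]
  refine (Module.forall_dual_apply_eq_zero_iff ℂ _).mp fun u => ?_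
  rw [map_sub, h, sub_self]

end character

theorem evalLeft_tensorMul {M N A : Type} [AddCommGroup M] [Module ℂ M] [AddCommGroup N]
    [Module ℂ N] [Ring A] [Algebra ℂ A] (ξ : Module.Dual ℂ M) (η : Module.Dual ℂ N)
    (ζ : Module.Dual ℂ (M ⊗[ℂ] N)) (h : ∀ x y, ζ (x ⊗ₜ[ℂ] y) = ξ x * η y)
    (s : M ⊗[ℂ] A) (t : N ⊗[ℂ] A) :
    evalLeft ζ (URep.tensorMul (s ⊗ₜ[ℂ] t)) = evalLeft ξ s * evalLeft η t := by
  induction s using TensorProduct.induction_on with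
  | zero => simp
  | add x y hx hy => simp only [map_add, TensorProduct.add_tmul, add_mul, hx, hy]
  | tmul x a =>
    induction t using TensorProduct.induction_on with
    | zero => simp
    | add z w hz hw => simp only [map_add, TensorProduct.tmul_add, mul_add, hz, hw]
    | tmul z c => simp [h, smul_smul, mul_comm]

namespace URep

variable {n : ℕ} {b : GL (Fin n) ℂ}

/-- The character of a representation, an element of the quantum group. -/
def character (V : URep b) : QuantumGroup b :=
  ∑ i, evalLeft ((Module.finBasis ℂ V.carrier).coord i) (V.coact (Module.finBasis ℂ V.carrier i))

/-- Functionals separate the points of the quantum group, so identities between characters reduce to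
identities between traces. -/
theorem apply_character (V : URep b) (u : QuantumGroup b →ₗ[ℂ] ℂ) :
    u V.character = LinearMap.trace ℂ V.carrier (V.action (WithConv.toConv u)) :=
  sum_apply_evalLeft _ _ u

theorem character_eq (V : URep b) {ι : Type*} [Fintype ι] [DecidableEq ι]
    (e : Module.Basis ι ℂ V.carrier) :
    V.character = ∑ i, evalLeft (e.coord i) (V.coact (e i)) :=
  dual_ext fun u => by
    rw [sum_apply_evalLeft, apply_character]
    rfl

theorem character_eq_of_equivalent {V W : URep b} (h : V.Equivalent W) :
    V.character = W.character := by
  obtain ⟨e, he⟩ := h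
  refine dual_ext fun u => ?_
  rw [apply_character, apply_character, ← LinearMap.trace_conj' _ e]
  congr 1
  ext x
  rw [LinearEquiv.conj_apply_apply, he, LinearEquiv.apply_symm_apply]

theorem character_sum (V W : URep b) : (V.sum W).character = V.character + W.character := by
  refine dual_ext fun u => ?_
  rw [map_add, apply_character, apply_character, apply_character, ← LinearMap.trace_prodMap']
  congr 1
  exact LinearMap.ext fun p => action_sum_apply V W _ p

theorem character_tensor (V W : URep b) :
    (V.tensor W).character = V.character * W.character := by
  let e := Module.finBasis ℂ V.carrier
  let f := Module.finBasis ℂ W.carrier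
  rw [(V.tensor W).character_eq (e.tensorProduct f), V.character_eq e, W.character_eq f,
    Finset.sum_mul_sum, Fintype.sum_prod_type]
  refine Finset.sum_congr rfl fun i _ => Finset.sum_congr rfl fun j _ => ?_
  refine (congrArg (fun z => evalLeft _ (tensorCoact V W z))
    (Module.Basis.tensorProduct_apply e f i j)).trans ?_
  refine evalLeft_tensorMul (e.coord i) (f.coord j) _ (fun x y => ?_) _ _
  exact (Module.Basis.tensorProduct_repr_tmul_apply e f x y i j).trans (mul_comm _ _)

theorem character_trivial : (trivial b).character = 1 := by
  rw [(trivial b).character_eq (Module.Basis.singleton Unit ℂ), Fintype.sum_unique]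
  have h : ∀ x : ℂ, (trivial b).coact x = x ⊗ₜ[ℂ] 1 := fun _ => rfl
  have h' : (Module.Basis.singleton Unit ℂ).coord default
      (Module.Basis.singleton Unit ℂ default) = (1 : ℂ) := by simp
  exact (congrArg (evalLeft _) (h _)).trans ((evalLeft_tmul _ _ _).trans
    ((congrArg (· • (1 : QuantumGroup b)) h').trans (one_smul _ _)))

/-- The character as a homomorphism on the representation ring. -/
def characterHom (b : GL (Fin n) ℂ) : URepRing b →+* QuantumGroup b :=
  RepRing.lift character (fun _ _ => character_eq_of_equivalent) character_sum character_tensor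
    character_trivial

theorem characterHom_cls (V : URep b) : characterHom b V.cls = V.character :=
  RepRing.lift_of _ _ _ _ _ V

end URep

namespace Ladder

variable {n : ℕ} {b : GL (Fin n) ℂ}

/-- The matrix unit `x ⊗ ξ` of `X (k + 1)` with `ξ x ≠ 0` has trace `ξ x` on `X (k + 1)` and zero on
the other spaces; evaluated on a relation between characters it isolates the coefficient of index
`k`. -/
theorem linearIndependent_cls (Λ : Ladder b) (hn : 2 ≤ n) :
    LinearIndependent ℤ fun k => (Λ.rep (k + 1)).cls := by
  refine LinearIndependent.of_comp (URep.characterHom b).toAddMonoidHom.toIntLinearMap ?_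
  rw [linearIndependent_iff']
  intro s g hg k hk
  have := Λ.nontrivial hn k
  obtain ⟨x, hx⟩ := exists_ne (0 : Λ.X (k + 1))
  obtain ⟨ξ, hξ⟩ : ∃ ξ : Module.Dual ℂ (Λ.X (k + 1)), ξ x ≠ 0 := by
    by_contra! h'
    exact hx ((Module.forall_dual_apply_eq_zero_iff ℂ _).mp h')
  have h1 : ∀ j : ℕ, (Λ.unit (k + 1) ξ x).ofConv (Λ.rep (j + 1)).character =
      if j = k then ξ x else 0 := by
    intro j
    rw [URep.apply_character]
    split_ifs with h
    · subst h
      have : (Λ.rep (j + 1)).action (Λ.unit (j + 1) ξ x) = ξ.smulRight x :=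
        LinearMap.ext fun y => Λ.action_unit_same _ ξ x y
      exact (congrArg (LinearMap.trace ℂ (Λ.X (j + 1))) this).trans
        (LinearMap.trace_smulRight ξ x)
    · have : (Λ.rep (j + 1)).action (Λ.unit (k + 1) ξ x) = 0 :=
        LinearMap.ext fun y => Λ.action_unit_ne (by simpa using h) ξ x y
      exact (congrArg (LinearMap.trace ℂ (Λ.X (j + 1))) this).trans (map_zero _)
  have h2 := congrArg (Λ.unit (k + 1) ξ x).ofConv hg
  have h3 : ∀ j : ℕ, (Λ.unit (k + 1) ξ x).ofConv
      (g j • URep.characterHom b (Λ.rep (j + 1)).cls) = if j = k then (g j : ℂ) * ξ x else 0 := by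
    intro j
    rw [map_zsmul, URep.characterHom_cls, h1, zsmul_eq_mul, mul_ite, mul_zero]
  rw [map_sum, map_zero] at h2
  have h4 := (Finset.sum_congr rfl fun j _ => (h3 j).symm).trans h2
  rw [Finset.sum_ite_eq' s k, if_pos hk] at h4
  exact_mod_cast (mul_eq_zero.mp h4).resolve_right hξ

theorem cls_mem_closure (Λ : Ladder b) (W : URep b) :
    W.cls ∈ AddSubgroup.closure (Set.range fun k => (Λ.rep (k + 1)).cls) := by
  refine RepRing.of_mem_closure (fun k => Λ.rep (k + 1))
    (fun W => Module.finrank ℂ W.carrier) (fun W => ?_) W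
  rcases subsingleton_or_nontrivial W.carrier with h | h
  · exact Or.inl (W.equivalent_sum_of_subsingleton W).symm
  · obtain ⟨m, T, hm, hT⟩ := Λ.exists_equivalent_rep_sum W
    cases m with
    | zero => exact absurd hm (not_nontrivial _)
    | succ m =>
      refine Or.inr ⟨m, T, hT, ?_⟩
      obtain ⟨e, -⟩ := hT
      have h1 : Module.finrank ℂ W.carrier =
          Module.finrank ℂ (Λ.X (m + 1)) + Module.finrank ℂ T.carrier :=
        e.finrank_eq.trans (Module.finrank_prod (R := ℂ) (M := Λ.X (m + 1)) (M' := T.carrier))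
      have h2 : 0 < Module.finrank ℂ (Λ.X (m + 1)) := Module.finrank_pos
      omega

open Polynomial in
/-- The representation ring of the quantum algebra is a polynomial ring, in which the classes of
the irreducible representations are Chebyshev polynomials. -/
theorem exists_ringEquiv (Λ : Ladder b) (hn : 2 ≤ n) :
    ∃ e : ℤ[X] ≃+* URepRing b, ∀ k : ℕ, e (Chebyshev.S ℤ k) = (Λ.rep (k + 1)).cls := by
  refine exists_chebyshev_ringEquiv (fun k => (Λ.rep (k + 1)).cls) ?_ (fun k => ?_)
    (fun S hS => RepRing.subring_eq_top S fun W => ?_) (Λ.linearIndependent_cls hn)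
  · exact (RepRing.of_eq Λ.equivalent_trivial).trans RepRing.of_one
  · exact (RepRing.of_tensor _ _).symm.trans
      ((RepRing.of_eq (Λ.equivalent_tensor (k + 1))).trans (RepRing.of_sum _ _))
  · refine (AddSubgroup.closure_le S.toAddSubgroup).mpr ?_ (Λ.cls_mem_closure W)
    rintro _ ⟨k, rfl⟩
    exact hS k

end Ladder

/-! ### Triples of operators and highest weights -/

/-- The relations of `sl₂` in an associative algebra. -/
structure SlTriple {A : Type*} [Ring A] (h e f : A) : Prop where
  h_mul_e : h * e = e * h + 2 * e
  h_mul_f : h * f = f * h - 2 * f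
  e_mul_f : e * f = f * e + h

namespace SlTriple

variable {A : Type*} [Ring A] {h e f : A}

theorem h_mul_f_pow (t : SlTriple h e f) (i : ℕ) : h * f ^ i = f ^ i * (h - 2 * (i : A)) := by
  induction i with
  | zero => simp
  | succ i ih =>
    have hc : (i : A) * f = f * (i : A) := Nat.cast_comm i f
    calc h * f ^ (i + 1) = h * f ^ i * f := by rw [pow_succ, mul_assoc]
      _ = f ^ i * (h * f - 2 * ((i : A) * f)) := by rw [ih]; noncomm_ring
      _ = f ^ (i + 1) * (h - 2 * ((i + 1 : ℕ) : A)) := by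
        rw [t.h_mul_f, hc, pow_succ]
        push_cast
        noncomm_ring

theorem e_mul_f_pow (t : SlTriple h e f) (i : ℕ) :
    e * f ^ (i + 1) = f ^ (i + 1) * e + ((i + 1 : ℕ) : A) * f ^ i * (h - (i : A)) := by
  induction i with
  | zero => simpa using t.e_mul_f
  | succ i ih =>
    have hc : (i : A) * f = f * (i : A) := Nat.cast_comm i f
    have hc' : ∀ x, (i : A) * (f * x) = f * ((i : A) * x) :=
      fun x => (Nat.cast_commute i f).left_comm x
    have hc'' : ∀ j x, (i : A) * (f ^ j * x) = f ^ j * ((i : A) * x) :=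
      fun j x => (Nat.cast_commute i _).left_comm x
    calc e * f ^ (i + 2) = e * f ^ (i + 1) * f := by rw [pow_succ f (i + 1), mul_assoc]
      _ = f ^ (i + 1) * (e * f) + ((i + 1 : ℕ) : A) * f ^ i * (h * f - (i : A) * f) := by
        rw [ih]
        noncomm_ring
      _ = f ^ (i + 2) * e + ((i + 2 : ℕ) : A) * f ^ (i + 1) * (h - ((i + 1 : ℕ) : A)) := by
        rw [t.e_mul_f, t.h_mul_f, hc, pow_succ f (i + 1), pow_succ f i]
        push_cast
        simp only [mul_add, add_mul, mul_sub, mul_assoc, hc, hc', hc'', one_mul, mul_one, two_mul]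
        abel

/-- Nonzero powers `f ^ i` would be eigenvectors of the commutator with `h` for the distinct
eigenvalues `-2 i`, infinitely many in a finite-dimensional algebra. -/
theorem exists_f_pow_eq_zero [Algebra ℂ A] [Module.Finite ℂ A] (t : SlTriple h e f) :
    ∃ N : ℕ, f ^ N = 0 := by
  by_contra! hN
  have h1 := Module.End.eigenvectors_linearIndependent'
    (LinearMap.mulLeft ℂ h - LinearMap.mulRight ℂ h) (fun i : ℕ => -2 * (i : ℂ))
    (fun i j hij => by simpa using hij) (fun i => f ^ i) (fun i => by
      refine ⟨Module.End.mem_eigenspace_iff.mpr ?_, hN i⟩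
      rw [LinearMap.sub_apply, LinearMap.mulLeft_apply, LinearMap.mulRight_apply, t.h_mul_f_pow,
        mul_sub, sub_sub_cancel_left, neg_mul, neg_smul, mul_smul, Algebra.smul_def (i : ℂ),
        map_natCast, Nat.cast_comm, two_mul, two_smul, mul_add])
  exact Set.infinite_univ.not_finite (Set.finite_univ_iff.mpr h1.finite)

section Module

variable {W : Type*} [AddCommGroup W] [Module ℂ W]

variable {H E F : Module.End ℂ W}

theorem h_apply_f_pow (t : SlTriple H E F) {v : W} {μ : ℂ} (hv : H v = μ • v) (i : ℕ) :
    H ((F ^ i) v) = (μ - 2 * i) • (F ^ i) v := by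
  have h := LinearMap.congr_fun (t.h_mul_f_pow i) v
  rw [Module.End.mul_apply, Module.End.mul_apply] at h
  rw [h, LinearMap.sub_apply, hv, Module.End.mul_apply, Module.End.natCast_apply, sub_smul,
    map_sub, map_smul, mul_smul, two_smul]
  simp [Module.End.ofNat_apply, two_smul, Nat.cast_smul_eq_nsmul]

theorem e_apply_f_pow (t : SlTriple H E F) {v : W} {μ : ℂ} (hv : H v = μ • v) (he : E v = 0)
    (i : ℕ) : E ((F ^ (i + 1)) v) = ((i + 1) * (μ - i)) • (F ^ i) v := by
  have h := LinearMap.congr_fun (t.e_mul_f_pow i) v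
  simp only [Module.End.mul_apply, LinearMap.add_apply, he, map_zero, zero_add, LinearMap.sub_apply,
    hv, Module.End.natCast_apply, map_sub, map_smul] at h
  rw [h, map_nsmul]
  module

/-- At the last nonzero vector `F ^ k v` the formula for `E (F ^ (k + 1) v)` reads `0 = (k + 1) (μ -
k) F ^ k v`. -/
theorem exists_weight (t : SlTriple H E F) [Module.Finite ℂ W] {v : W} {μ : ℂ}
    (hv : H v = μ • v) (he : E v = 0) (h0 : v ≠ 0) :
    ∃ k : ℕ, μ = k ∧ (F ^ (k + 1)) v = 0 ∧ (F ^ k) v ≠ 0 := by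
  obtain ⟨N, hN⟩ := t.exists_f_pow_eq_zero
  obtain ⟨k, hk1, hk2⟩ := Nat.exists_not_and_succ_of_not_zero_of_exists
    (p := fun i => (F ^ i) v = 0) (by simpa using h0) ⟨N, by rw [hN]; rfl⟩
  refine ⟨k, ?_, hk2, hk1⟩
  have h := t.e_apply_f_pow hv he k
  rw [hk2, map_zero, eq_comm, smul_eq_zero] at h
  rcases mul_eq_zero.mp (h.resolve_right hk1) with h | h
  · exact absurd h (Nat.cast_add_one_ne_zero k)
  · exact sub_eq_zero.mp h

/-- A vector `v` of weight `k` annihilated by `e` is not of the form `(h - k) w` with `e w = 0`. -/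
theorem eq_zero_of_generalized (t : SlTriple H E F) [Module.Finite ℂ W] {v w : W} {μ : ℂ}
    (hv : H v = μ • v) (he : E v = 0) (hw : H w = μ • w + v) (he' : E w = 0) : v = 0 := by
  by_contra h0
  obtain ⟨k, rfl, hk, hk'⟩ := t.exists_weight hv he h0
  have h1 : ∀ i : ℕ, E ((F ^ (i + 1)) w) =
      ((i + 1 : ℕ) : ℂ) • (((k : ℂ) - i) • (F ^ i) w + (F ^ i) v) := by
    intro i
    have h := LinearMap.congr_fun (t.e_mul_f_pow i) w
    simp only [Module.End.mul_apply, LinearMap.add_apply, he', map_zero, zero_add,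
      LinearMap.sub_apply, hw, Module.End.natCast_apply, map_sub] at h
    rw [h, map_nsmul, map_add, map_smul]
    module
  -- This contradicts the nilpotency of `F`. For `i = 0`, `E` maps the vector to `(k + 1) F ^ k v ≠
  -- 0`; beyond that the terms with `v` vanish and the factor `k - (k + 1 + i)` is not zero.
  have h2 : ∀ i : ℕ, (F ^ (k + 1 + i)) w ≠ 0 := by
    intro i
    induction i with
    | zero =>
      intro h
      have := h1 k
      rw [Nat.add_zero] at h
      rw [h, map_zero, sub_self, zero_smul, zero_add, eq_comm, smul_eq_zero] at this
      exact this.elim (Nat.cast_ne_zero.mpr (Nat.succ_ne_zero _)) hk'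
    | succ i ih =>
      intro h
      have := h1 (k + 1 + i)
      have hv' : (F ^ (k + 1 + i)) v = 0 := by
        rw [add_comm, pow_add, Module.End.mul_apply, hk, map_zero]
      rw [← add_assoc] at h
      rw [h, map_zero, hv', add_zero, eq_comm, smul_eq_zero, smul_eq_zero] at this
      rcases this with h | h | h
      · exact Nat.cast_ne_zero.mpr (Nat.succ_ne_zero _) h
      · push_cast at h
        have : ((i + 1 : ℕ) : ℂ) = 0 := by push_cast; linear_combination -h
        exact Nat.cast_ne_zero.mpr (Nat.succ_ne_zero _) this
      · exact ih h
  obtain ⟨N, hN⟩ := t.exists_f_pow_eq_zero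
  refine h2 N ?_
  rw [pow_add, Module.End.mul_apply, hN, LinearMap.zero_apply, map_zero]

/-- A nonzero finite-dimensional representation of `sl₂` has a vector `v` of highest weight that is
detected by a functional `ξ` of the same weight which vanishes on the image of `f`. -/
theorem exists_highest_weight (t : SlTriple H E F) [Module.Finite ℂ W] [Nontrivial W] :
    ∃ (k : ℕ) (v : W) (ξ : Module.Dual ℂ W), H v = (k : ℂ) • v ∧ E v = 0 ∧ (F ^ (k + 1)) v = 0 ∧
      (∀ w, ξ (H w) = k * ξ w) ∧ (∀ w, ξ (F w) = 0) ∧ ξ v = 1 := by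
  -- A string of eigenvalues with step `2` must end in finite dimension. That `μ + 2` is not an
  -- eigenvalue is used twice: for `E v = 0` and for the surjectivity of `H - (k + 2)`.
  obtain ⟨μ, hμ, hμ'⟩ : ∃ μ, H.HasEigenvalue μ ∧ ¬ H.HasEigenvalue (μ + 2) := by
    by_contra! hall
    obtain ⟨μ, hμ⟩ := Module.End.exists_eigenvalue H
    have h1 : ∀ i : ℕ, H.HasEigenvalue (μ + 2 * i) := by
      intro i
      induction i with
      | zero => simpa using hμ
      | succ i ih =>
        have := hall _ ih
        push_cast
        convert this using 1
        ring
    choose v hv using fun i => (h1 i).exists_hasEigenvector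
    have h2 := Module.End.eigenvectors_linearIndependent' H (fun i : ℕ => μ + 2 * (i : ℂ))
      (fun i j hij => by simpa using hij) v hv
    exact Set.infinite_univ.not_finite (Set.finite_univ_iff.mpr h2.finite)
  have hinj : ∀ w, H w = (μ + 2) • w → w = 0 := by
    intro w hw
    by_contra h0
    exact hμ' (Module.End.hasEigenvalue_of_hasEigenvector
      ⟨Module.End.mem_eigenspace_iff.mpr hw, h0⟩)
  obtain ⟨v, hv, hv0⟩ := hμ.exists_hasEigenvector
  rw [Module.End.mem_eigenspace_iff] at hv
  have hE : ∀ w, H (E w) = E (H w) + (2 : ℂ) • E w := by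
    intro w
    have := LinearMap.congr_fun t.h_mul_e w
    simpa [Module.End.mul_apply, Module.End.ofNat_apply, two_smul] using this
  have hF : ∀ w, H (F w) = F (H w) - (2 : ℂ) • F w := by
    intro w
    have := LinearMap.congr_fun t.h_mul_f w
    simpa [Module.End.mul_apply, Module.End.ofNat_apply, two_smul] using this
  have hev : E v = 0 := hinj _ (by rw [hE, hv, map_smul, add_smul])
  obtain ⟨k, rfl, hk, -⟩ := t.exists_weight hv hev hv0
  have hnr : v ∉ LinearMap.range (H - (k : ℂ) • (1 : Module.End ℂ W)) := by
    rintro ⟨w, hw⟩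
    have hw' : H w = (k : ℂ) • w + v := by
      rw [← hw]
      simp
    have hew : E w = 0 := hinj _ (by rw [hE, hw', map_add, map_smul, hev, add_zero, add_smul])
    exact hv0 (t.eq_zero_of_generalized hv hev hw' hew)
  obtain ⟨ξ, hξ, hξ'⟩ := Submodule.exists_le_ker_of_notMem hnr
  have hξH : ∀ w, ξ (H w) = k * ξ w := by
    intro w
    have := hξ' ⟨w, rfl⟩
    simpa [sub_eq_zero] using this
  -- Since `F ∘ (H - (k + 2)) = (H - k) ∘ F` and `ξ` vanishes on the range of `H - k`, surjectivity
  -- yields `ξ ∘ F = 0`; diagonalizability of `H` is not needed.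
  have hsurj : Function.Surjective (H - ((k : ℂ) + 2) • (1 : Module.End ℂ W)) := by
    rw [← LinearMap.injective_iff_surjective, injective_iff_map_eq_zero]
    intro w hw
    refine hinj w ?_
    simpa [sub_eq_zero] using hw
  refine ⟨k, v, (ξ v)⁻¹ • ξ, hv, hev, hk, fun w => ?_, fun w => ?_, ?_⟩
  · rw [LinearMap.smul_apply, LinearMap.smul_apply, hξH, smul_eq_mul, smul_eq_mul]
    ring
  · obtain ⟨w, rfl⟩ := hsurj w
    have h1 : F ((H - ((k : ℂ) + 2) • (1 : Module.End ℂ W)) w) = H (F w) - (k : ℂ) • F w := by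
      rw [hF]
      simp only [LinearMap.sub_apply, LinearMap.smul_apply, Module.End.one_apply, map_sub, map_smul]
      module
    rw [h1, map_sub, LinearMap.smul_apply, LinearMap.smul_apply, map_smul, hξH]
    simp
  · simp [hξ]

end Module

end SlTriple

/-! ### The Lie algebra `sl₂` and its representations from triples -/

namespace Sl

/-- The complex Lie algebra `sl₂`. -/
abbrev Alg : Type := LieAlgebra.SpecialLinear.sl (Fin 2) ℂ

/-- The upper triangular generator. -/
def E : Alg := ⟨!![0, 1; 0, 0], by
  change Matrix.trace (!![0, 1; 0, 0] : Matrix (Fin 2) (Fin 2) ℂ) = 0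
  simp [Matrix.trace_fin_two]⟩

/-- The lower triangular generator. -/
def F : Alg := ⟨!![0, 0; 1, 0], by
  change Matrix.trace (!![0, 0; 1, 0] : Matrix (Fin 2) (Fin 2) ℂ) = 0
  simp [Matrix.trace_fin_two]⟩

/-- The diagonal generator. -/
def H : Alg := ⟨!![1, 0; 0, -1], by
  change Matrix.trace (!![1, 0; 0, -1] : Matrix (Fin 2) (Fin 2) ℂ) = 0
  simp [Matrix.trace_fin_two]⟩

theorem apply_one_one (x : Alg) : x.1 1 1 = -x.1 0 0 := by
  have h : Matrix.trace x.1 = 0 := x.2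
  rw [Matrix.trace_fin_two] at h
  linear_combination h

theorem eq_combination (x : Alg) : x = x.1 0 1 • E + x.1 1 0 • F + x.1 0 0 • H := by
  apply Subtype.ext
  ext i j
  fin_cases i <;> fin_cases j <;> simp [E, F, H, apply_one_one]

theorem lie_H_E : ⁅H, E⁆ = (2 : ℂ) • E := by
  apply Subtype.ext
  rw [LieAlgebra.SpecialLinear.sl_bracket]
  ext i j
  fin_cases i <;> fin_cases j <;> simp [E, H]
  norm_num

theorem lie_H_F : ⁅H, F⁆ = (-2 : ℂ) • F := by
  apply Subtype.ext
  rw [LieAlgebra.SpecialLinear.sl_bracket]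
  ext i j
  fin_cases i <;> fin_cases j <;> simp [F, H]
  norm_num

theorem lie_E_F : ⁅E, F⁆ = H := by
  apply Subtype.ext
  rw [LieAlgebra.SpecialLinear.sl_bracket]
  ext i j
  fin_cases i <;> fin_cases j <;> simp [E, F, H]

section Hom

variable {M N : Type*} [AddCommGroup M] [Module ℂ M] [LieRingModule Alg M] [LieModule ℂ Alg M]
  [AddCommGroup N] [Module ℂ N] [LieRingModule Alg N] [LieModule ℂ Alg N]

theorem lie_eq (x : Alg) (m : M) :
    ⁅x, m⁆ = x.1 0 1 • ⁅E, m⁆ + x.1 1 0 • ⁅F, m⁆ + x.1 0 0 • ⁅H, m⁆ := by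
  conv_lhs => rw [eq_combination x]
  simp only [add_lie, smul_lie]

/-- A linear map commuting with the generators is a homomorphism of representations. -/
def mkHom (φ : M →ₗ[ℂ] N) (hE : ∀ m, φ ⁅E, m⁆ = ⁅E, φ m⁆) (hF : ∀ m, φ ⁅F, m⁆ = ⁅F, φ m⁆)
    (hH : ∀ m, φ ⁅H, m⁆ = ⁅H, φ m⁆) : M →ₗ⁅ℂ, Alg⁆ N :=
  { φ with
    map_lie' := by
      intro x m
      change φ ⁅x, m⁆ = ⁅x, φ m⁆
      rw [lie_eq, lie_eq x (φ m), map_add, map_add, map_smul, map_smul, map_smul, hE, hF, hH] }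

variable (M) in
theorem slTriple : SlTriple (LieModule.toEnd ℂ Alg M H) (LieModule.toEnd ℂ Alg M E)
    (LieModule.toEnd ℂ Alg M F) where
  h_mul_e := by
    ext m
    have h := leibniz_lie H E m
    rw [lie_H_E, smul_lie, two_smul] at h
    simpa [Module.End.mul_apply, two_mul, add_comm] using h
  h_mul_f := by
    ext m
    have h := leibniz_lie H F m
    rw [lie_H_F, smul_lie, neg_smul, two_smul] at h
    simpa [Module.End.mul_apply, two_mul, add_comm, sub_eq_add_neg] using h
  e_mul_f := by
    ext m
    have h := leibniz_lie E F m
    rw [lie_E_F] at h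
    simpa [Module.End.mul_apply, add_comm] using h

end Hom

end Sl

namespace SlTriple

variable {M : Type} [AddCommGroup M] [Module ℂ M] {h e f : Module.End ℂ M}

/-- The action of `sl₂` defined by a triple of operators. -/
def act (h e f : Module.End ℂ M) (x : Sl.Alg) : Module.End ℂ M :=
  x.1 0 1 • e + x.1 1 0 • f + x.1 0 0 • h

theorem act_mul (t : SlTriple h e f) (x y : Sl.Alg) :
    act h e f x * act h e f y = act h e f ⁅x, y⁆ + act h e f y * act h e f x := by
  have h2 : ∀ u v : Matrix (Fin 2) (Fin 2) ℂ, ∀ i j, (u * v - v * u) i j =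
      u i 0 * v 0 j + u i 1 * v 1 j - (v i 0 * u 0 j + v i 1 * u 1 j) := by
    intro u v i j
    simp [Matrix.mul_apply, Fin.sum_univ_two]
  simp only [act, LieAlgebra.SpecialLinear.sl_bracket, h2, Sl.apply_one_one, mul_add, add_mul,
    smul_mul_smul_comm, t.h_mul_e, t.h_mul_f, t.e_mul_f, two_mul]
  module

/-- The representation of `sl₂` defined by a triple of operators. -/
def toSlRep [Module.Finite ℂ M] (t : SlTriple h e f) : SlRep :=
  letI : LieRingModule Sl.Alg M :=
    { bracket := fun x m => act h e f x m
      add_lie := by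
        intro x y m
        change act h e f (x + y) m = act h e f x m + act h e f y m
        have hxy : ∀ i j, (x + y).1 i j = x.1 i j + y.1 i j := fun _ _ => rfl
        simp only [act, LinearMap.add_apply, LinearMap.smul_apply, hxy]
        module
      lie_add := fun x m m' => map_add _ _ _
      leibniz_lie := fun x y m => LinearMap.congr_fun (t.act_mul x y) m }
  letI : LieModule ℂ Sl.Alg M :=
    { smul_lie := by
        intro c x m
        change act h e f (c • x) m = c • act h e f x m
        have hcx : ∀ i j, (c • x).1 i j = c * x.1 i j := fun _ _ => rfl
        simp only [act, LinearMap.add_apply, LinearMap.smul_apply, hcx]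
        module
      lie_smul := fun c x m => map_smul _ _ _ }
  { carrier := M }

end SlTriple

/-! ### A model of the irreducible representations -/

/-- Sequences `x` with `x i = 0` for `i > k`. -/
def Truncated (k : ℕ) : Submodule ℂ (ℕ → ℂ) where
  carrier := {x | ∀ i, k < i → x i = 0}
  add_mem' := fun hx hy i hi => by simp [hx i hi, hy i hi]
  zero_mem' := fun i _ => rfl
  smul_mem' := fun c x hx i hi => by simp [hx i hi]

namespace Truncated

variable {k : ℕ}

theorem apply_eq_zero (x : Truncated k) {i : ℕ} (hi : k < i) : x.1 i = 0 := x.2 i hi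

@[ext]
theorem ext {x y : Truncated k} (h : ∀ i, x.1 i = y.1 i) : x = y := Subtype.ext (funext h)

variable (k)

/-- The raising operator. -/
def e : Module.End ℂ (Truncated k) where
  -- The coordinates imitate `x i = ξ (E ^ i w)` for a functional `ξ` of highest weight, see
  -- `toTruncated`; in them `E` is the shift.
  toFun x := ⟨fun i => x.1 (i + 1), fun i hi => x.2 _ (by omega)⟩
  map_add' x y := rfl
  map_smul' c x := rfl

/-- The lowering operator. -/
def f : Module.End ℂ (Truncated k) where
  -- At `i = 0` the factor `i` cancels the spurious value `x.1 (0 - 1) = x.1 0`; at `i = k + 1` the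
  -- factor `k + 1 - i` ensures truncation.
  toFun x := ⟨fun i => (i * (k + 1 - i) : ℂ) * x.1 (i - 1), fun i hi => by
    rcases (show i = k + 1 ∨ k < i - 1 by omega) with rfl | h
    · push_cast
      ring
    · exact mul_eq_zero_of_right _ (x.2 _ h)⟩
  map_add' x y := by
    ext i
    simp [mul_add]
  map_smul' c x := by
    ext i
    simp [mul_left_comm]

/-- The weight operator. -/
def h : Module.End ℂ (Truncated k) where
  toFun x := ⟨fun i => (k - 2 * i : ℂ) * x.1 i, fun i hi => mul_eq_zero_of_right _ (x.2 i hi)⟩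
  map_add' x y := by
    ext i
    simp [mul_add]
  map_smul' c x := by
    ext i
    simp [mul_left_comm]

variable {k}

@[simp] theorem e_apply (x : Truncated k) (i : ℕ) : (e k x).1 i = x.1 (i + 1) := rfl

@[simp] theorem f_apply (x : Truncated k) (i : ℕ) :
    (f k x).1 i = (i * (k + 1 - i) : ℂ) * x.1 (i - 1) := rfl

@[simp] theorem h_apply (x : Truncated k) (i : ℕ) : (h k x).1 i = (k - 2 * i : ℂ) * x.1 i := rfl

theorem e_pow_apply (x : Truncated k) (j i : ℕ) : ((e k ^ j) x).1 i = x.1 (i + j) := by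
  induction j generalizing i with
  | zero => simp
  | succ j ih =>
    rw [pow_succ', Module.End.mul_apply, e_apply, ih, add_assoc, add_comm 1]

variable (k) in
theorem slTriple : SlTriple (h k) (e k) (f k) where
  h_mul_e := by
    ext x i
    simp [two_mul, Module.End.mul_apply]
    ring
  h_mul_f := by
    ext x i
    rcases i with _ | i
    · simp [two_mul, Module.End.mul_apply]
    · simp [two_mul, Module.End.mul_apply]
      ring
  e_mul_f := by
    ext x i
    rcases i with _ | i
    · simp [Module.End.mul_apply]
    · simp [Module.End.mul_apply]
      ring

/-- Truncated sequences as vectors. -/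
def equivFun (k : ℕ) : Truncated k ≃ₗ[ℂ] (Fin (k + 1) → ℂ) where
  toFun x i := x.1 i
  map_add' x y := rfl
  map_smul' c x := rfl
  invFun y := ⟨fun i => if hi : i < k + 1 then y ⟨i, hi⟩ else 0, fun i hi => dif_neg (by omega)⟩
  left_inv x := by
    ext i
    by_cases hi : i < k + 1
    · exact dif_pos hi
    · exact (dif_neg hi).trans (x.2 i (by omega)).symm
  right_inv y := funext fun i => dif_pos i.2

instance : Module.Finite ℂ (Truncated k) := Module.Finite.equiv (equivFun k).symm

theorem finrank_eq (k : ℕ) : Module.finrank ℂ (Truncated k) = k + 1 := by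
  rw [(equivFun k).finrank_eq, Module.finrank_fin_fun]

theorem trace_h_pow (k m : ℕ) :
    LinearMap.trace ℂ (Truncated k) (h k ^ m) =
      ∑ i ∈ Finset.range (k + 1), (k - 2 * i : ℂ) ^ m := by
  have h1 : ∀ (x : Truncated k) (i : ℕ), ((h k ^ m) x).1 i = (k - 2 * i : ℂ) ^ m * x.1 i := by
    intro x i
    induction m with
    | zero => simp
    | succ m ih => rw [pow_succ', Module.End.mul_apply, h_apply, ih, pow_succ']; ring
  rw [LinearMap.trace_eq_matrix_trace ℂ (Module.Basis.ofEquivFun (equivFun k)), Matrix.trace,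
    ← Fin.sum_univ_eq_sum_range (fun i => (k - 2 * i : ℂ) ^ m)]
  refine Finset.sum_congr rfl fun i _ => ?_
  rw [Matrix.diag_apply, LinearMap.toMatrix_apply, Module.Basis.ofEquivFun_repr_apply]
  change ((h k ^ m) _).1 (i : ℕ) = _
  rw [h1]
  have h2 : ((equivFun k) ((equivFun k).symm (Pi.single i 1))) i = (1 : ℂ) := by
    rw [LinearEquiv.apply_symm_apply, Pi.single_eq_same]
  rw [Module.Basis.coe_ofEquivFun]
  exact (congrArg _ h2).trans (mul_one _)

end Truncated

namespace SlRep

/-- The irreducible representation of highest weight `k`. -/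
def irr (k : ℕ) : SlRep := (Truncated.slTriple k).toSlRep

theorem irr_lie_E {k : ℕ} (x : Truncated k) :
    (⁅Sl.E, (x : (irr k).carrier)⁆ : (irr k).carrier) = Truncated.e k x := by
  change SlTriple.act _ _ _ _ x = _
  simp [SlTriple.act, Sl.E]

theorem irr_lie_F {k : ℕ} (x : Truncated k) :
    (⁅Sl.F, (x : (irr k).carrier)⁆ : (irr k).carrier) = Truncated.f k x := by
  change SlTriple.act _ _ _ _ x = _
  simp [SlTriple.act, Sl.F]

theorem irr_lie_H {k : ℕ} (x : Truncated k) :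
    (⁅Sl.H, (x : (irr k).carrier)⁆ : (irr k).carrier) = Truncated.h k x := by
  change SlTriple.act _ _ _ _ x = _
  simp [SlTriple.act, Sl.H]

end SlRep

/-! ### Splitting off an irreducible representation of `sl₂` -/

namespace SlTriple

variable {W : Type*} [AddCommGroup W] [Module ℂ W] {H E F : Module.End ℂ W}

/-- Transposition reverses products, so `E` and `F` exchange their roles. A functional with `ξ ∘ F =
0` becomes a highest weight vector, and the properties of `toTruncated` involving `H` and `F` follow
from the formulas for such vectors. -/
theorem dual (t : SlTriple H E F) :
    SlTriple (Module.Dual.transpose (R := ℂ) H : Module.End ℂ (Module.Dual ℂ W))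
      (Module.Dual.transpose (R := ℂ) F) (Module.Dual.transpose (R := ℂ) E) where
  h_mul_e := by
    ext ξ w
    have h := congrArg ξ (LinearMap.congr_fun t.h_mul_f w)
    simp [Module.End.mul_apply, two_mul, Module.Dual.transpose_apply] at h ⊢
    rw [h]
    ring
  h_mul_f := by
    ext ξ w
    have h := congrArg ξ (LinearMap.congr_fun t.h_mul_e w)
    simp [Module.End.mul_apply, two_mul, Module.Dual.transpose_apply] at h ⊢
    rw [h]
    ring
  e_mul_f := by
    ext ξ w
    have h := congrArg ξ (LinearMap.congr_fun t.e_mul_f w)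
    simp [Module.End.mul_apply, Module.Dual.transpose_apply] at h ⊢
    rw [h]

theorem transpose_pow_apply (A : Module.End ℂ W) (ξ : Module.Dual ℂ W) (i : ℕ) (w : W) :
    (((Module.Dual.transpose (R := ℂ) A : Module.End ℂ (Module.Dual ℂ W)) ^ i) ξ) w =
      ξ ((A ^ i) w) := by
  induction i generalizing ξ with
  | zero => simp
  | succ i ih =>
    rw [pow_succ, Module.End.mul_apply, ih, pow_succ', Module.End.mul_apply]
    rfl

/-- The coefficients `i! k (k - 1) ⋯ (k - i + 1)`. -/
def weightCoeff (k i : ℕ) : ℂ := ∏ j ∈ Finset.range i, ((j : ℂ) + 1) * (k - j)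

theorem weightCoeff_succ (k i : ℕ) :
    weightCoeff k (i + 1) = weightCoeff k i * (((i : ℂ) + 1) * (k - i)) :=
  Finset.prod_range_succ _ _

theorem weightCoeff_ne_zero {k i : ℕ} (h : i ≤ k) : weightCoeff k i ≠ 0 := by
  refine Finset.prod_ne_zero_iff.mpr fun j hj => mul_ne_zero (Nat.cast_add_one_ne_zero j) ?_
  rw [Finset.mem_range] at hj
  rw [sub_ne_zero]
  exact_mod_cast (by omega : k ≠ j)

/-- The homomorphism from the irreducible representation determined by a primitive vector. -/
def fromTruncated (F : Module.End ℂ W) (v : W) (k : ℕ) : Truncated k →ₗ[ℂ] W where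
  -- For a highest weight vector `v` of weight `k`, `E ^ i (F ^ i v) = weightCoeff k i • v`; the
  -- division makes `E` correspond to the shift.
  toFun x := ∑ i ∈ Finset.range (k + 1), (x.1 i / weightCoeff k i) • (F ^ i) v
  map_add' x y := by
    rw [← Finset.sum_add_distrib]
    refine Finset.sum_congr rfl fun i _ => ?_
    rw [← add_smul, ← add_div]
    rfl
  map_smul' c x := by
    rw [Finset.smul_sum]
    refine Finset.sum_congr rfl fun i _ => ?_
    rw [smul_smul, RingHom.id_apply, ← mul_div_assoc]
    rfl

theorem fromTruncated_apply (F : Module.End ℂ W) (v : W) (k : ℕ) (x : Truncated k) :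
    fromTruncated F v k x =
      ∑ i ∈ Finset.range (k + 1), (x.1 i / weightCoeff k i) • (F ^ i) v := rfl

variable {v : W} {k : ℕ}

theorem fromTruncated_h (t : SlTriple H E F) (hv : H v = (k : ℂ) • v) (x : Truncated k) :
    fromTruncated F v k (Truncated.h k x) = H (fromTruncated F v k x) := by
  rw [fromTruncated_apply, fromTruncated_apply, map_sum]
  refine Finset.sum_congr rfl fun i _ => ?_
  rw [map_smul, t.h_apply_f_pow hv, smul_smul, Truncated.h_apply]
  congr 1
  ring

theorem fromTruncated_e (t : SlTriple H E F) (hv : H v = (k : ℂ) • v) (he : E v = 0)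
    (x : Truncated k) :
    fromTruncated F v k (Truncated.e k x) = E (fromTruncated F v k x) := by
  rw [fromTruncated_apply, fromTruncated_apply, map_sum, Finset.sum_range_succ,
    Finset.sum_range_succ' (fun i => E ((x.1 i / weightCoeff k i) • (F ^ i) v))]
  congr 1
  · refine Finset.sum_congr rfl fun i hi => ?_
    rw [Finset.mem_range] at hi
    have h1 := weightCoeff_ne_zero (show i + 1 ≤ k by omega)
    have h2 := weightCoeff_ne_zero (show i ≤ k by omega)
    rw [map_smul, t.e_apply_f_pow hv he, smul_smul, Truncated.e_apply]
    rw [weightCoeff_succ] at h1 ⊢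
    congr 1
    have h3 := right_ne_zero_of_mul (right_ne_zero_of_mul h1)
    field_simp
  · rw [Truncated.e_apply, Truncated.apply_eq_zero x (Nat.lt_succ_self k), zero_div, zero_smul,
      map_smul, pow_zero, Module.End.one_apply, he, smul_zero]

theorem fromTruncated_f (hk : (F ^ (k + 1)) v = 0) (x : Truncated k) :
    fromTruncated F v k (Truncated.f k x) = F (fromTruncated F v k x) := by
  rw [fromTruncated_apply, fromTruncated_apply, map_sum, Finset.sum_range_succ',
    Finset.sum_range_succ (fun i => F ((x.1 i / weightCoeff k i) • (F ^ i) v))]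
  congr 1
  · refine Finset.sum_congr rfl fun i hi => ?_
    rw [Finset.mem_range] at hi
    have h1 := weightCoeff_ne_zero (show i + 1 ≤ k by omega)
    have h2 := weightCoeff_ne_zero (show i ≤ k by omega)
    rw [map_smul, Truncated.f_apply, ← Module.End.mul_apply, ← pow_succ', Nat.add_sub_cancel]
    rw [weightCoeff_succ] at h1 ⊢
    have h3 := right_ne_zero_of_mul (right_ne_zero_of_mul h1)
    have h4 : (((i + 1 : ℕ) : ℂ) * (k + 1 - (i + 1 : ℕ)) * x.1 i) =
        (((i : ℂ) + 1) * (k - i)) * x.1 i := by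
      push_cast
      ring
    rw [h4]
    congr 1
    field_simp
  · rw [map_smul, ← Module.End.mul_apply, ← pow_succ', hk, Truncated.f_apply]
    simp

/-- The homomorphism to the irreducible representation determined by a functional of highest
weight. -/
def toTruncated (E : Module.End ℂ W) (ξ : Module.Dual ℂ W) (k : ℕ)
    (hk : ∀ w, ξ ((E ^ (k + 1)) w) = 0) : W →ₗ[ℂ] Truncated k where
  toFun w := ⟨fun i => ξ ((E ^ i) w), fun i hi => by
    obtain ⟨j, rfl⟩ := Nat.exists_eq_add_of_le hi
    change ξ ((E ^ (k + 1 + j)) w) = 0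
    rw [pow_add, Module.End.mul_apply, hk]⟩
  map_add' x y := by
    ext i
    simp
  map_smul' c x := by
    ext i
    simp

theorem toTruncated_apply (E : Module.End ℂ W) (ξ : Module.Dual ℂ W) (k : ℕ)
    (hk : ∀ w, ξ ((E ^ (k + 1)) w) = 0) (w : W) (i : ℕ) :
    (toTruncated E ξ k hk w).1 i = ξ ((E ^ i) w) := rfl

variable {ξ : Module.Dual ℂ W}

theorem apply_e_pow (t : SlTriple H E F) [Module.Finite ℂ W] (hH : ∀ w, ξ (H w) = k * ξ w)
    (hF : ∀ w, ξ (F w) = 0) (h0 : ξ ≠ 0) (w : W) : ξ ((E ^ (k + 1)) w) = 0 := by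
  obtain ⟨m, hm, h1, -⟩ := t.dual.exists_weight (v := ξ) (μ := k)
    (LinearMap.ext hH) (LinearMap.ext hF) h0
  obtain rfl : k = m := by exact_mod_cast hm
  rw [← transpose_pow_apply, h1, LinearMap.zero_apply]

theorem toTruncated_h (t : SlTriple H E F) (hH : ∀ w, ξ (H w) = k * ξ w)
    (hk : ∀ w, ξ ((E ^ (k + 1)) w) = 0) (w : W) :
    toTruncated E ξ k hk (H w) = Truncated.h k (toTruncated E ξ k hk w) := by
  ext i
  have h := LinearMap.congr_fun (t.dual.h_apply_f_pow (v := ξ) (μ := k) (LinearMap.ext hH) i) w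
  rw [toTruncated_apply, Truncated.h_apply, toTruncated_apply, ← transpose_pow_apply,
    ← transpose_pow_apply]
  exact h

theorem toTruncated_e (hk : ∀ w, ξ ((E ^ (k + 1)) w) = 0) (w : W) :
    toTruncated E ξ k hk (E w) = Truncated.e k (toTruncated E ξ k hk w) := by
  ext i
  rw [toTruncated_apply, Truncated.e_apply, toTruncated_apply, pow_succ, Module.End.mul_apply]

theorem toTruncated_f (t : SlTriple H E F) (hH : ∀ w, ξ (H w) = k * ξ w) (hF : ∀ w, ξ (F w) = 0)
    (hk : ∀ w, ξ ((E ^ (k + 1)) w) = 0) (w : W) :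
    toTruncated E ξ k hk (F w) = Truncated.f k (toTruncated E ξ k hk w) := by
  ext i
  rw [toTruncated_apply, Truncated.f_apply, toTruncated_apply]
  rcases i with _ | i
  · simp [hF]
  · have h := LinearMap.congr_fun (t.dual.e_apply_f_pow (v := ξ) (μ := k) (LinearMap.ext hH)
      (LinearMap.ext hF) i) w
    rw [← transpose_pow_apply, Nat.add_sub_cancel, ← transpose_pow_apply]
    refine h.trans ?_
    rw [LinearMap.smul_apply, smul_eq_mul]
    push_cast
    ring

/-- The coordinates of the left side are the values of `ξ` on `E ^ i`, and `E` passes through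
`fromTruncated`; so only the coordinate of index `0` has to be compared. There `ξ` kills every `F ^
(i + 1) v`. -/
theorem toTruncated_fromTruncated (t : SlTriple H E F) (hv : H v = (k : ℂ) • v) (he : E v = 0)
    (hF : ∀ w, ξ (F w) = 0) (h1 : ξ v = 1)
    (hk : ∀ w, ξ ((E ^ (k + 1)) w) = 0) (x : Truncated k) :
    toTruncated E ξ k hk (fromTruncated F v k x) = x := by
  have h0 : ∀ x : Truncated k, ξ (fromTruncated F v k x) = x.1 0 := by
    intro x
    rw [fromTruncated_apply, map_sum, Finset.sum_range_succ', Finset.sum_eq_zero, zero_add]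
    · simp [h1, weightCoeff]
    · intro i _
      rw [pow_succ', Module.End.mul_apply, map_smul, hF, smul_zero]
  have hE : ∀ i, (E ^ i) (fromTruncated F v k x) = fromTruncated F v k ((Truncated.e k ^ i) x) := by
    intro i
    induction i with
    | zero => rfl
    | succ i ih =>
      rw [pow_succ', Module.End.mul_apply, ih, ← t.fromTruncated_e hv he, pow_succ',
        Module.End.mul_apply]
  ext i
  rw [toTruncated_apply, hE, h0, Truncated.e_pow_apply, zero_add]

end SlTriple

namespace SlRep

/-- The action of the triple of generators. -/
theorem slTriple (V : SlRep) : SlTriple (LieModule.toEnd ℂ Sl.Alg V.carrier Sl.H)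
    (LieModule.toEnd ℂ Sl.Alg V.carrier Sl.E) (LieModule.toEnd ℂ Sl.Alg V.carrier Sl.F) :=
  Sl.slTriple V.carrier

/-- A subrepresentation. -/
def ofLieSubmodule (V : SlRep) (N : LieSubmodule ℂ Sl.Alg V.carrier) : SlRep where
  carrier := N

theorem equivalent_sum_of_retract (V S : SlRep) (i : S.carrier →ₗ⁅ℂ, Sl.Alg⁆ V.carrier)
    (p : V.carrier →ₗ⁅ℂ, Sl.Alg⁆ S.carrier) (h : ∀ x, p (i x) = x) :
    V.Equivalent (S.sum (V.ofLieSubmodule p.ker)) := by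
  let q : V.carrier →ₗ[ℂ] p.ker :=
    ((LinearMap.id : V.carrier →ₗ[ℂ] V.carrier) - (i : S.carrier →ₗ[ℂ] V.carrier) ∘ₗ
      (p : V.carrier →ₗ[ℂ] S.carrier)).codRestrict p.ker.toSubmodule fun v => by
        change p (v - i (p v)) = 0
        rw [map_sub, h, sub_self]
  have hq : ∀ v, (q v : V.carrier) = v - i (p v) := fun v => rfl
  refine ⟨LieModuleEquiv.mk
    { toFun := fun v => ((p v, q v) : S.carrier × p.ker)
      map_add' := fun x y => Prod.ext (map_add p x y) (map_add q x y)
      map_smul' := fun c x => Prod.ext (map_smul p c x) (map_smul q c x)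
      map_lie' := ?_ }
    (fun z : S.carrier × p.ker => i z.1 + (z.2 : V.carrier)) ?_ ?_⟩
  · intro x v
    refine Prod.ext (p.map_lie x v) (Subtype.ext ?_)
    change ⁅x, v⁆ - i (p ⁅x, v⁆) = ⁅x, v - i (p v)⁆
    rw [p.map_lie, i.map_lie, lie_sub]
  · intro v
    change i (p v) + (v - i (p v)) = v
    abel
  · rintro ⟨x, (y : p.ker)⟩
    have hy : p (y : V.carrier) = 0 := y.2
    have h1 : p (i x + (y : V.carrier)) = x := by rw [map_add, h, hy, add_zero]
    refine Prod.ext h1 (Subtype.ext ?_)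
    change i x + (y : V.carrier) - i (p (i x + y)) = y
    rw [h1]
    abel

theorem equivalent_sum_of_subsingleton (V : SlRep) [Subsingleton V.carrier] :
    V.Equivalent (V.sum V) :=
  ⟨LieModuleEquiv.mk
    { toFun := fun _ => (0 : V.carrier × V.carrier)
      map_add' := fun _ _ => (add_zero (0 : V.carrier × V.carrier)).symm
      map_smul' := fun _ _ => (smul_zero _ : _ • (0 : V.carrier × V.carrier) = 0).symm
      map_lie' := Prod.ext (Subsingleton.elim _ _) (Subsingleton.elim _ _) }
    (fun _ => 0) (fun _ => Subsingleton.elim _ _)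
    (fun _ => Prod.ext (Subsingleton.elim _ _) (Subsingleton.elim _ _))⟩

/-- The vector `v` gives a map from the model and the functional `ξ` a map to it; their composite on
the model is the identity, so the model is a direct summand. This replaces Weyl's theorem. -/
theorem exists_equivalent_irr_sum (V : SlRep) [Nontrivial V.carrier] :
    ∃ (k : ℕ) (T : SlRep), V.Equivalent ((irr k).sum T) ∧
      Module.finrank ℂ V.carrier = k + 1 + Module.finrank ℂ T.carrier := by
  have t := V.slTriple
  obtain ⟨k, v, ξ, hv, he, hk, hH, hF, h1⟩ := t.exists_highest_weight
  have hξ : ξ ≠ 0 := by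
    rintro rfl
    exact zero_ne_one h1
  have hk' := t.apply_e_pow hH hF hξ
  let i : (irr k).carrier →ₗ⁅ℂ, Sl.Alg⁆ V.carrier :=
    Sl.mkHom (M := (irr k).carrier) (SlTriple.fromTruncated _ v k)
      (fun x => (congrArg _ (irr_lie_E x)).trans (t.fromTruncated_e hv he x))
      (fun x => (congrArg _ (irr_lie_F x)).trans (SlTriple.fromTruncated_f hk x))
      (fun x => (congrArg _ (irr_lie_H x)).trans (t.fromTruncated_h hv x))
  let p : V.carrier →ₗ⁅ℂ, Sl.Alg⁆ (irr k).carrier :=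
    Sl.mkHom (N := (irr k).carrier) (SlTriple.toTruncated _ ξ k hk')
      (fun x => (SlTriple.toTruncated_e hk' x).trans (irr_lie_E _).symm)
      (fun x => (t.toTruncated_f hH hF hk' x).trans (irr_lie_F _).symm)
      (fun x => (t.toTruncated_h hH hk' x).trans (irr_lie_H _).symm)
  have hpi : ∀ x, p (i x) = x := t.toTruncated_fromTruncated hv he hF h1 hk'
  refine ⟨k, V.ofLieSubmodule p.ker, V.equivalent_sum_of_retract (irr k) i p hpi, ?_⟩
  have h2 := LinearMap.finrank_range_add_finrank_ker (p : V.carrier →ₗ[ℂ] (irr k).carrier)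
  have h3 : LinearMap.range (p : V.carrier →ₗ[ℂ] (irr k).carrier) = ⊤ :=
    LinearMap.range_eq_top.mpr fun x => ⟨i x, hpi x⟩
  rw [h3, finrank_top] at h2
  rw [← h2]
  congr 1
  exact Truncated.finrank_eq k

/-- Applied as often as possible without reaching zero, `E` leads from any nonzero vector of `N` to
one concentrated at index `0`, which has highest weight. The powers of `F` on it span the whole
space, since `toTruncated` with the coordinate of index `0` for `ξ` is the identity. -/
theorem isIrreducible_irr (k : ℕ) : (irr k).IsIrreducible := by
  have hnt : Nontrivial (irr k).carrier := by
    refine Module.nontrivial_of_finrank_pos (R := ℂ) ?_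
    rw [show Module.finrank ℂ (irr k).carrier = k + 1 from Truncated.finrank_eq k]
    exact k.succ_pos
  have key : ∀ N : LieSubmodule ℂ Sl.Alg (irr k).carrier, N = ⊥ ∨ N = ⊤ := by
    intro N
    refine or_iff_not_imp_left.mpr fun hN => ?_
    obtain ⟨x, hxN, hx⟩ : ∃ x : Truncated k, (x : (irr k).carrier) ∈ N ∧ x ≠ 0 := by
      by_contra! h
      exact hN ((LieSubmodule.eq_bot_iff N).mpr h)
    have hE : ∀ (i : ℕ) (y : Truncated k), (y : (irr k).carrier) ∈ N →
        ((Truncated.e k ^ i) y : (irr k).carrier) ∈ N := by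
      intro i y hy
      induction i with
      | zero => exact hy
      | succ i ih =>
        rw [pow_succ', Module.End.mul_apply, ← irr_lie_E]
        exact N.lie_mem ih
    have hF : ∀ (i : ℕ) (y : Truncated k), (y : (irr k).carrier) ∈ N →
        ((Truncated.f k ^ i) y : (irr k).carrier) ∈ N := by
      intro i y hy
      induction i with
      | zero => exact hy
      | succ i ih =>
        rw [pow_succ', Module.End.mul_apply, ← irr_lie_F]
        exact N.lie_mem ih
    obtain ⟨m, hm1, hm2⟩ := Nat.exists_not_and_succ_of_not_zero_of_exists
      (p := fun i => (Truncated.e k ^ i) x = 0) (fun h => hx h)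
      ⟨k + 1, by
        ext i
        rw [Truncated.e_pow_apply]
        exact Truncated.apply_eq_zero _ (by omega)⟩
    set u : Truncated k := (Truncated.e k ^ m) x with hu
    have he : Truncated.e k u = 0 := by
      rw [hu, ← Module.End.mul_apply, ← pow_succ']
      exact hm2
    have hui : ∀ i, u.1 (i + 1) = 0 := fun i => congrArg (fun z : Truncated k => z.1 i) he
    have hu0 : u.1 0 ≠ 0 := by
      intro h
      refine hm1 ?_
      ext i
      rcases i with _ | i
      · exact h
      · exact hui i
    have t := Truncated.slTriple k
    let ξ : Module.Dual ℂ (Truncated k) :=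
      { toFun := fun w => w.1 0
        map_add' := fun _ _ => rfl
        map_smul' := fun _ _ => rfl }
    have hξ : ∀ (i : ℕ) (w : Truncated k), ξ ((Truncated.e k ^ i) w) = w.1 i := by
      intro i w
      exact (Truncated.e_pow_apply w i 0).trans (by rw [zero_add])
    set v : Truncated k := (u.1 0)⁻¹ • u with hv
    have hkv : Truncated.h k v = (k : ℂ) • v := by
      ext i
      rcases i with _ | i
      · simp
      · simp [hv, hui]
    have hev : Truncated.e k v = 0 := by rw [hv, map_smul, he, smul_zero]
    have h1 : ξ v = 1 := inv_mul_cancel₀ hu0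
    refine eq_top_iff.mpr fun (y : Truncated k) _ => ?_
    have hy := t.toTruncated_fromTruncated hkv hev (ξ := ξ) (fun w => by simp [ξ]) h1
      (fun w => (hξ _ w).trans (Truncated.apply_eq_zero w (Nat.lt_succ_self k))) y
    have hy' : SlTriple.fromTruncated (Truncated.f k) v k y = y := by
      refine Eq.trans ?_ hy
      ext i
      rw [SlTriple.toTruncated_apply, hξ]
    rw [← hy']
    have hvN : (v : (irr k).carrier) ∈ N := N.smul_mem _ (hE m x hxN)
    let N' : Submodule ℂ (Truncated k) := N.toSubmodule
    have : ∑ i ∈ Finset.range (k + 1), (y.1 i / SlTriple.weightCoeff k i) •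
        (Truncated.f k ^ i) v ∈ N' := N'.sum_mem fun i _ => N'.smul_mem _ (hF i v hvN)
    exact this
  exact { exists_pair_ne := (LieSubmodule.nontrivial_iff ℂ Sl.Alg (irr k).carrier).mpr hnt |>.1
          eq_bot_or_eq_top := key }

theorem cls_mem_closure (V : SlRep) :
    V.cls ∈ AddSubgroup.closure (Set.range fun k => (irr k).cls) := by
  refine RepRing.of_mem_closure irr (fun W => Module.finrank ℂ W.carrier) (fun W => ?_) V
  rcases subsingleton_or_nontrivial W.carrier with h | h
  · exact Or.inl W.equivalent_sum_of_subsingleton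
  · obtain ⟨k, T, hT, hd⟩ := W.exists_equivalent_irr_sum
    exact Or.inr ⟨k, T, hT, by omega⟩

/-- The dimension count `1 = k + 1 + dim T` forces `k = 0` and `T = 0`, so no isomorphism has to be
written down. -/
theorem cls_irr_zero : (irr 0).cls = 1 := by
  have : Nontrivial trivial.carrier := inferInstanceAs (Nontrivial ℂ)
  obtain ⟨k, T, hT, hd⟩ := trivial.exists_equivalent_irr_sum
  rw [show Module.finrank ℂ trivial.carrier = 1 from Module.finrank_self ℂ] at hd
  obtain rfl : k = 0 := by omega
  have : Subsingleton T.carrier := Module.finrank_zero_iff (R := ℂ) |>.mp (by omega)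
  have h1 : trivial.cls = (irr 0).cls + T.cls := (RepRing.of_eq hT).trans (RepRing.of_sum _ _)
  have h2 : T.cls = T.cls + T.cls :=
    (RepRing.of_eq T.equivalent_sum_of_subsingleton).trans (RepRing.of_sum _ _)
  rw [left_eq_add] at h2
  rw [h2, add_zero] at h1
  exact h1.symm.trans RepRing.of_one

end SlRep

/-! ### Formal characters and the representation ring of `sl₂` -/

theorem sum_weights_mul {R : Type*} [CommRing R] (r : ℂ → R) (hr : ∀ a b, r a * r b = r (a + b))
    (k : ℕ) :
    (∑ i ∈ Finset.range (1 + 1), r (((1 : ℕ) : ℂ) - 2 * (i : ℕ))) *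
        ∑ i ∈ Finset.range (k + 1 + 1), r (((k + 1 : ℕ) : ℂ) - 2 * (i : ℕ)) =
      ∑ i ∈ Finset.range (k + 2 + 1), r (((k + 2 : ℕ) : ℂ) - 2 * (i : ℕ)) +
        ∑ i ∈ Finset.range (k + 1), r ((k : ℂ) - 2 * (i : ℕ)) := by
  have h0 : ∀ i : ℕ, r (((1 : ℕ) : ℂ) - 2 * (0 : ℕ)) * r (((k + 1 : ℕ) : ℂ) - 2 * (i : ℕ)) =
      r (((k + 2 : ℕ) : ℂ) - 2 * (i : ℕ)) := by
    intro i
    rw [hr]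
    congr 1
    push_cast
    ring
  have h1 : ∀ i : ℕ, r (((1 : ℕ) : ℂ) - 2 * (1 : ℕ)) * r (((k + 1 : ℕ) : ℂ) - 2 * (i : ℕ)) =
      r ((k : ℂ) - 2 * (i : ℕ)) := by
    intro i
    rw [hr]
    congr 1
    push_cast
    ring
  -- Shifted up by one, the weights of index `k + 1` are those of index `k + 2` without the lowest;
  -- shifted down, they are those of index `k` and one more, which is exactly the missing weight
  -- `-(k + 2)`.
  have h2 : r ((k : ℂ) - 2 * (k + 1 : ℕ)) = r (((k + 2 : ℕ) : ℂ) - 2 * (k + 2 : ℕ)) := by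
    congr 1
    push_cast
    ring
  rw [Finset.sum_range_succ (fun i : ℕ => r (((1 : ℕ) : ℂ) - 2 * (i : ℕ))), Finset.sum_range_one,
    add_mul, Finset.mul_sum, Finset.mul_sum, Finset.sum_congr rfl fun i _ => h0 i,
    Finset.sum_congr rfl fun i _ => h1 i,
    Finset.sum_range_succ (fun i : ℕ => r (((k + 2 : ℕ) : ℂ) - 2 * (i : ℕ))) (k + 2),
    Finset.sum_range_succ (fun i : ℕ => r ((k : ℂ) - 2 * (i : ℕ))) (k + 1), h2]
  abel

namespace SlRep

/-- The formal character `∑ m, tr (h ^ m) t ^ m / m!`. -/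
def character (V : SlRep) : PowerSeries ℂ :=
  PowerSeries.mk fun m => ((m.factorial : ℕ) : ℂ)⁻¹ *
    LinearMap.trace ℂ V.carrier (LieModule.toEnd ℂ Sl.Alg V.carrier Sl.H ^ m)

theorem character_eq_of_equivalent {V W : SlRep} (e : V.Equivalent W) :
    V.character = W.character := by
  obtain ⟨e⟩ := e
  ext m
  rw [character, character, PowerSeries.coeff_mk, PowerSeries.coeff_mk,
    ← LinearMap.trace_conj' _ e.toLinearEquiv]
  congr 2
  refine (map_pow e.toLinearEquiv.conjRingEquiv (LieModule.toEnd ℂ Sl.Alg V.carrier Sl.H)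
    m).trans ?_
  congr 1
  ext w
  change e (⁅Sl.H, e.symm w⁆) = ⁅Sl.H, w⁆
  exact (e.toLieModuleHom.map_lie Sl.H (e.symm w)).trans
    (congrArg (fun z => ⁅Sl.H, z⁆) (e.apply_symm_apply w))

theorem character_sum (V W : SlRep) : (V.sum W).character = V.character + W.character := by
  ext m
  rw [map_add, character, character, character, PowerSeries.coeff_mk, PowerSeries.coeff_mk,
    PowerSeries.coeff_mk, ← mul_add, ← LinearMap.trace_prodMap']
  congr 1
  refine congrArg (LinearMap.trace ℂ (V.carrier × W.carrier)) ?_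
  induction m with
  | zero => rfl
  | succ m ih =>
    rw [pow_succ, pow_succ, pow_succ, ← LinearMap.prodMap_mul, ← ih]
    rfl

/-- On a tensor product `h` acts by the sum of the commuting operators `h ⊗ 1` and `1 ⊗ h`. The
binomial theorem for its powers becomes the product of power series thanks to the factorials in the
denominators. -/
theorem character_tensor (V W : SlRep) :
    (V.tensor W).character = V.character * W.character := by
  have h1 : LieModule.toEnd ℂ Sl.Alg (V.carrier ⊗[ℂ] W.carrier) Sl.H =
      TensorProduct.map (LieModule.toEnd ℂ Sl.Alg V.carrier Sl.H) 1 +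
        TensorProduct.map 1 (LieModule.toEnd ℂ Sl.Alg W.carrier Sl.H) :=
    TensorProduct.ext' fun x y => TensorProduct.LieModule.lie_tmul_right Sl.H x y
  have h2 : Commute (TensorProduct.map (LieModule.toEnd ℂ Sl.Alg V.carrier Sl.H)
      (1 : Module.End ℂ W.carrier)) (TensorProduct.map (1 : Module.End ℂ V.carrier)
        (LieModule.toEnd ℂ Sl.Alg W.carrier Sl.H)) := by
    rw [Commute, SemiconjBy, ← TensorProduct.map_mul, ← TensorProduct.map_mul, one_mul, mul_one,
      one_mul, mul_one]
  have h3 : ∀ m : ℕ, LinearMap.trace ℂ (V.carrier ⊗[ℂ] W.carrier)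
      (LieModule.toEnd ℂ Sl.Alg (V.carrier ⊗[ℂ] W.carrier) Sl.H ^ m) =
      ∑ p ∈ Finset.HasAntidiagonal.antidiagonal m, (m.choose p.1 : ℂ) *
        (LinearMap.trace ℂ V.carrier (LieModule.toEnd ℂ Sl.Alg V.carrier Sl.H ^ p.1) *
          LinearMap.trace ℂ W.carrier (LieModule.toEnd ℂ Sl.Alg W.carrier Sl.H ^ p.2)) := by
    intro m
    rw [h1, h2.add_pow', map_sum]
    refine Finset.sum_congr rfl fun p _ => ?_
    rw [map_nsmul, TensorProduct.map_pow, TensorProduct.map_pow, ← TensorProduct.map_mul, one_pow,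
      one_pow, one_mul, mul_one, LinearMap.trace_tensorProduct', nsmul_eq_mul]
  ext m
  rw [PowerSeries.coeff_mul, character, PowerSeries.coeff_mk]
  refine (congrArg (((m.factorial : ℕ) : ℂ)⁻¹ * ·) (h3 m)).trans ?_
  rw [Finset.mul_sum]
  refine Finset.sum_congr rfl fun p hp => ?_
  rw [Finset.HasAntidiagonal.mem_antidiagonal] at hp
  rw [character, character, PowerSeries.coeff_mk, PowerSeries.coeff_mk, ← hp]
  have h4 : (((p.1 + p.2).choose p.1 : ℕ) : ℂ) * (p.1.factorial : ℕ) * (p.2.factorial : ℕ) =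
      ((p.1 + p.2).factorial : ℕ) := by
    rw [Nat.choose_symm_add]
    exact_mod_cast Nat.add_choose_mul_factorial_mul_factorial p.1 p.2
  have h5 : ((p.1.factorial : ℕ) : ℂ) ≠ 0 := Nat.cast_ne_zero.mpr (Nat.factorial_ne_zero _)
  have h6 : ((p.2.factorial : ℕ) : ℂ) ≠ 0 := Nat.cast_ne_zero.mpr (Nat.factorial_ne_zero _)
  have h7 : (((p.1 + p.2).factorial : ℕ) : ℂ) ≠ 0 :=
    Nat.cast_ne_zero.mpr (Nat.factorial_ne_zero _)
  rw [← h4] at h7 ⊢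
  have h8 := left_ne_zero_of_mul (left_ne_zero_of_mul h7)
  field_simp

theorem character_trivial : trivial.character = 1 := by
  ext m
  rw [character, PowerSeries.coeff_mk, PowerSeries.coeff_one]
  have h0 : LieModule.toEnd ℂ Sl.Alg trivial.carrier Sl.H = 0 := LinearMap.ext fun _ => rfl
  rw [h0]
  split_ifs with hm
  · subst hm
    rw [pow_zero, LinearMap.trace_one, show Module.finrank ℂ trivial.carrier = 1 from
      Module.finrank_self ℂ]
    simp
  · rw [zero_pow hm, map_zero, mul_zero]

/-- The formal character as a homomorphism on the representation ring. -/
def characterHom : SlRepRing →+* PowerSeries ℂ :=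
  RepRing.lift character (fun _ _ => character_eq_of_equivalent) character_sum character_tensor
    character_trivial

theorem characterHom_cls (V : SlRep) : characterHom V.cls = V.character :=
  RepRing.lift_of _ _ _ _ _ V

theorem coeff_character_irr (k m : ℕ) : PowerSeries.coeff m (irr k).character =
    ((m.factorial : ℕ) : ℂ)⁻¹ * ∑ i ∈ Finset.range (k + 1), (k - 2 * i : ℂ) ^ m := by
  have h : LieModule.toEnd ℂ Sl.Alg (irr k).carrier Sl.H = Truncated.h k :=
    LinearMap.ext irr_lie_H
  rw [character, PowerSeries.coeff_mk, h]
  congr 1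
  exact Truncated.trace_h_pow k m

theorem character_irr (k : ℕ) : (irr k).character =
    ∑ i ∈ Finset.range (k + 1), PowerSeries.rescale ((k : ℂ) - 2 * i) (PowerSeries.exp ℂ) := by
  ext m
  rw [coeff_character_irr, map_sum, Finset.mul_sum]
  refine Finset.sum_congr rfl fun i _ => ?_
  rw [PowerSeries.coeff_rescale, PowerSeries.coeff_exp, mul_comm]
  simp

/-- A relation between characters is one between power sums of weights, hence one between sums of
values of any polynomial at the weights. Let `K` be the largest index with nonzero coefficient. A
polynomial that vanishes at `-K, ..., K - 1` but not at `K` sees only the weight `K`, which occurs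
once in `irr K` and in no smaller one. -/
theorem linearIndependent_characterHom_cls :
    LinearIndependent ℤ fun k => characterHom (irr k).cls := by
  rw [linearIndependent_iff']
  intro s g hg
  by_contra! hne
  obtain ⟨k₀, hk₀, hgk₀⟩ := hne
  obtain ⟨K, hK, hmax⟩ := Finset.exists_max_image (s.filter fun j => g j ≠ 0) id
    ⟨k₀, Finset.mem_filter.mpr ⟨hk₀, hgk₀⟩⟩
  rw [Finset.mem_filter] at hK
  have h1 : ∀ m : ℕ, ∑ j ∈ s, (g j : ℂ) * ∑ i ∈ Finset.range (j + 1), (j - 2 * i : ℂ) ^ m = 0 := by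
    intro m
    have h := congrArg (fun z => ((m.factorial : ℕ) : ℂ) * PowerSeries.coeff m z) hg
    simp only [map_sum, characterHom_cls, map_zero, mul_zero, Finset.mul_sum (s := s)] at h
    rw [← h]
    refine Finset.sum_congr rfl fun j _ => ?_
    rw [map_zsmul, coeff_character_irr, zsmul_eq_mul, mul_left_comm,
      mul_inv_cancel_left₀ (Nat.cast_ne_zero.mpr (Nat.factorial_ne_zero _))]
  have h2 : ∀ p : Polynomial ℂ,
      ∑ j ∈ s, (g j : ℂ) * ∑ i ∈ Finset.range (j + 1), p.eval (j - 2 * i : ℂ) = 0 := by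
    intro p
    induction p using Polynomial.induction_on' with
    | add p q hp hq =>
      simp only [Polynomial.eval_add, Finset.sum_add_distrib, mul_add, hp, hq, add_zero]
    | monomial m c =>
      simp only [Polynomial.eval_monomial, ← Finset.mul_sum, mul_left_comm _ c, h1, mul_zero]
  let p : Polynomial ℂ := ∏ i ∈ Finset.range (2 * K), (Polynomial.X - Polynomial.C ((i : ℂ) - K))
  have hp : ∀ z, p.eval z = ∏ i ∈ Finset.range (2 * K), (z - ((i : ℂ) - K)) := by
    intro z
    simp [p, Polynomial.eval_prod]
  have hp0 : ∀ z : ℤ, -(K : ℤ) ≤ z → z < K → p.eval (z : ℂ) = 0 := by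
    intro z hz1 hz2
    rw [hp]
    refine Finset.prod_eq_zero (i := (z + K).toNat) (Finset.mem_range.mpr (by omega)) ?_
    have h : (((z + K).toNat : ℕ) : ℂ) = z + K := by
      have h' : (((z + K).toNat : ℕ) : ℤ) = z + K := Int.toNat_of_nonneg (by omega)
      exact_mod_cast congrArg (Int.cast : ℤ → ℂ) h'
    rw [h]
    ring
  have hpK : p.eval (K : ℂ) ≠ 0 := by
    rw [hp, Finset.prod_ne_zero_iff]
    intro i hi h
    rw [Finset.mem_range] at hi
    have h' : (i : ℂ) = ((2 * K : ℕ) : ℂ) := by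
      push_cast
      linear_combination -h
    have := Nat.cast_injective h'
    omega
  have h3 := h2 p
  rw [Finset.sum_eq_single_of_mem K hK.1, Finset.sum_range_succ', Finset.sum_eq_zero] at h3
  · simp only [Nat.cast_zero, mul_zero, sub_zero, zero_add, mul_eq_zero, Int.cast_eq_zero] at h3
    exact h3.elim hK.2 hpK
  · intro i hi
    rw [Finset.mem_range] at hi
    have := hp0 ((K : ℤ) - 2 * ((i : ℤ) + 1)) (by omega) (by omega)
    push_cast at this ⊢
    exact this
  · intro j hj hjK
    by_cases hgj : g j = 0
    · rw [hgj, Int.cast_zero, zero_mul]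
    · have hlt : j < K := lt_of_le_of_ne (hmax j (Finset.mem_filter.mpr ⟨hj, hgj⟩)) hjK
      rw [Finset.sum_eq_zero, mul_zero]
      intro i hi
      rw [Finset.mem_range] at hi
      have := hp0 ((j : ℤ) - 2 * i) (by omega) (by omega)
      push_cast at this
      exact this

/-- Injectivity of the character on the span of the irreducible classes; it turns the identity of
characters into the Clebsch–Gordan rule `cls_irr_mul` without decomposing a tensor product. -/
theorem eq_zero_of_characterHom {x : SlRepRing}
    (h : x ∈ AddSubgroup.closure (Set.range fun k => (irr k).cls)) (hx : characterHom x = 0) :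
    x = 0 := by
  have hspan : x ∈ Submodule.span ℤ (Set.range fun k => (irr k).cls) := by
    rw [← Submodule.mem_toAddSubgroup, Submodule.span_int_eq_addSubgroupClosure]
    exact h
  obtain ⟨c, rfl⟩ := Finsupp.mem_span_range_iff_exists_finsupp.mp hspan
  have hc : c = 0 := by
    refine linearIndependent_iff.mp linearIndependent_characterHom_cls c ?_
    rw [Finsupp.linearCombination_apply, ← hx, Finsupp.sum, Finsupp.sum, map_sum]
    exact Finset.sum_congr rfl fun k _ => (map_zsmul _ _ _).symm
  rw [hc, Finsupp.sum_zero_index]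

theorem cls_irr_mul (k : ℕ) :
    (irr 1).cls * (irr (k + 1)).cls = (irr (k + 2)).cls + (irr k).cls := by
  rw [← sub_eq_zero]
  refine eq_zero_of_characterHom (sub_mem ?_ (add_mem (cls_mem_closure _) (cls_mem_closure _))) ?_
  · have h : ((irr 1).tensor (irr (k + 1))).cls = (irr 1).cls * (irr (k + 1)).cls :=
      RepRing.of_tensor _ _
    rw [← h]
    exact cls_mem_closure _
  · rw [map_sub, map_mul, map_add, characterHom_cls, characterHom_cls, characterHom_cls,
      characterHom_cls, character_irr, character_irr, character_irr, character_irr,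
      sum_weights_mul (fun c => PowerSeries.rescale c (PowerSeries.exp ℂ))
        PowerSeries.exp_mul_exp_eq_exp_add, sub_self]

open Polynomial in
/-- The representation ring of `sl₂` is a polynomial ring, in which the classes of the irreducible
representations are Chebyshev polynomials. -/
theorem exists_ringEquiv :
    ∃ e : ℤ[X] ≃+* SlRepRing, ∀ k : ℕ, e (Chebyshev.S ℤ k) = (irr k).cls := by
  refine exists_chebyshev_ringEquiv (fun k => (irr k).cls) cls_irr_zero cls_irr_mul
    (fun S hS => RepRing.subring_eq_top S fun W => ?_)
    (LinearIndependent.of_comp characterHom.toAddMonoidHom.toIntLinearMap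
      linearIndependent_characterHom_cls)
  refine (AddSubgroup.closure_le S.toAddSubgroup).mpr ?_ (cls_mem_closure W)
  rintro _ ⟨k, rfl⟩
  exact hS k

end SlRep

end

/-! ### Quantum integers and the existence of a ladder -/

section quantumNumbers

variable {q : ℂ}

theorem pow_sub_inv_pow_ne_zero (hq0 : q ≠ 0) (hq : ∀ m : ℕ, 0 < m → q ^ m ≠ 1) (m : ℕ) :
    q ^ (m + 1) - q⁻¹ ^ (m + 1) ≠ 0 := by
  intro h
  refine hq (2 * (m + 1)) (by omega) ?_
  rw [sub_eq_zero] at h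
  rw [two_mul, pow_add]
  nth_rewrite 2 [h]
  rw [← mul_pow, mul_inv_cancel₀ hq0, one_pow]

theorem pow_sub_inv_pow_add (hq0 : q ≠ 0) (m : ℕ) :
    (q ^ (m + 2) - q⁻¹ ^ (m + 2)) + (q ^ m - q⁻¹ ^ m) =
      (q + q⁻¹) * (q ^ (m + 1) - q⁻¹ ^ (m + 1)) := by
  have h : q * q⁻¹ = 1 := mul_inv_cancel₀ hq0
  linear_combination (q⁻¹ ^ m - q ^ m) * h

/-- A ladder exists if the loop parameter is generic. -/
theorem nonempty_ladder {n : ℕ} (b : GL (Fin n) ℂ) (hq0 : q ≠ 0)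
    (hq : ∀ m : ℕ, 0 < m → q ^ m ≠ 1)
    (hb : Matrix.trace ((b : Matrix (Fin n) (Fin n) ℂ).transpose *
      ((b⁻¹ : GL (Fin n) ℂ) : Matrix (Fin n) (Fin n) ℂ)) = -(q + q⁻¹)) :
    Nonempty (Ladder b) := by
  have hs := pow_sub_inv_pow_ne_zero hq0 hq
  -- The solution `-[m + 1] / [m]` of the recursion; all the quantum integers involved are nonzero
  -- because `q` is not a root of unity. The value at `m = 0` is irrelevant, as `X 0 = 0`, but must
  -- be nonzero.
  refine ⟨Ladder.mk' b (fun m => if m = 0 then 1 else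
    -((q ^ (m + 1) - q⁻¹ ^ (m + 1)) / (q ^ m - q⁻¹ ^ m))) (δ := -(q + q⁻¹)) ?_ ?_ ?_ ?_⟩
  · rw [← hb, Matrix.trace, Finset.sum_comm]
    refine Finset.sum_congr rfl fun j _ => ?_
    rw [Matrix.diag_apply, Matrix.mul_apply]
    exact Finset.sum_congr rfl fun k _ => mul_comm _ _
  · intro m
    rcases m with _ | m
    · exact one_ne_zero
    · exact neg_ne_zero.mpr (div_ne_zero (hs _) (hs _))
  · have h1 := hs 0
    have h2 := pow_sub_inv_pow_add hq0 0
    simp only [zero_add, pow_zero, sub_self, add_zero] at h1 h2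
    rw [if_neg one_ne_zero, h2, mul_div_cancel_right₀ _ h1]
  · intro m
    have h1 := hs m
    have h2 := hs (m + 1)
    have h3 := pow_sub_inv_pow_add hq0 (m + 1)
    rw [if_neg (by omega), if_neg (by omega), inv_neg, inv_div, eq_sub_of_add_eq h3, sub_div,
      mul_div_cancel_right₀ _ h2]
    ring

end quantumNumbers

/-! ### Dimensions as Chebyshev values and the main theorem -/

theorem Polynomial.Chebyshev.eval_U_eq_of_recurrence {n : ℂ} {p : ℕ → ℂ} (h0 : p 0 = 1)
    (h1 : p 1 = n) (h : ∀ k, n * p (k + 1) = p (k + 2) + p k) (k : ℕ) :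
    p k = (U ℂ k).eval (n / 2) := by
  induction k using Nat.twoStepInduction with
  | zero => simpa using h0
  | one => simp [h1, mul_div_cancel₀]
  | more k ih0 ih1 =>
    have h2 := U_add_two ℂ (k : ℤ)
    push_cast at ih1 ⊢
    rw [h2, Polynomial.eval_sub, Polynomial.eval_mul, ← ih0, ← ih1]
    simp only [Polynomial.eval_mul, Polynomial.eval_ofNat, Polynomial.eval_X]
    linear_combination -h k

theorem mainTheorem2 (n : ℕ) (hn : 2 ≤ n) (b : GL (Fin n) ℂ) (q : ℂ) (hq0 : q ≠ 0)
    (hq : ∀ m : ℕ, 0 < m → q ^ m ≠ 1)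
    (hb : Matrix.trace ((b : Matrix (Fin n) (Fin n) ℂ).transpose *
      ((b⁻¹ : GL (Fin n) ℂ) : Matrix (Fin n) (Fin n) ℂ)) = -(q + q⁻¹)) :
    ∃ V : ℕ → URep b,
      -- the scalar and the fundamental representation
      (V 0).Equivalent (URep.trivial b) ∧
      (V 1).Equivalent (URep.fundamental b) ∧
      -- the `V k` are the irreducible representations, each up to equivalence exactly once
      (∀ k, (V k).IsIrreducible) ∧
      (∀ j k, (V j).Equivalent (V k) → j = k) ∧
      (∀ W : URep b, W.IsIrreducible → ∃ k, W.Equivalent (V k)) ∧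
      -- complete reducibility
      (∀ (W : URep b) (S : Submodule ℂ W.carrier), W.IsInvariant S →
        ∃ T : Submodule ℂ W.carrier, W.IsInvariant T ∧ IsCompl S T) ∧
      -- the Clebsch–Gordan rule (with `V (-1) = 0`)
      ((V 1).tensor (V 0)).Equivalent (V 1) ∧
      (∀ k, ((V 1).tensor (V (k + 1))).Equivalent ((V (k + 2)).sum (V k))) ∧
      -- the representation ring is that of `sl₂`
      (∃ φ : URepRing b ≃+* SlRepRing, ∀ k, ∃ S : SlRep,
        S.IsIrreducible ∧ Module.finrank ℂ S.carrier = k + 1 ∧ φ (V k).cls = S.cls) ∧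
      -- the recurrence for the dimensions (with `p (-1) = 0`)
      Module.finrank ℂ (V 0).carrier = 1 ∧
      Module.finrank ℂ (V 1).carrier = n ∧
      (∀ k, n * Module.finrank ℂ (V (k + 1)).carrier =
        Module.finrank ℂ (V (k + 2)).carrier + Module.finrank ℂ (V k).carrier) ∧
      -- the dimensions are values of Chebyshev polynomials of the second kind
      (∀ k : ℕ, (Module.finrank ℂ (V k).carrier : ℂ) =
        (Polynomial.Chebyshev.U ℂ k).eval ((n : ℂ) / 2)) ∧
      (∃ θ : ℂ, (n : ℂ) = 2 * Complex.cos θ) ∧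
      (∀ θ : ℂ, (n : ℂ) = 2 * Complex.cos θ → Complex.sin θ ≠ 0 → ∀ k : ℕ,
        (Module.finrank ℂ (V k).carrier : ℂ) =
          Complex.sin ((k + 1) * θ) / Complex.sin θ) := by
  obtain ⟨Λ⟩ := nonempty_ladder b hq0 hq hb
  have hnt := Λ.nontrivial hn
  have hdim : ∀ k, (Module.finrank ℂ (Λ.rep (k + 1)).carrier : ℂ) =
      (Polynomial.Chebyshev.U ℂ k).eval ((n : ℂ) / 2) := by
    refine Polynomial.Chebyshev.eval_U_eq_of_recurrence
      (p := fun k => (Module.finrank ℂ (Λ.X (k + 1)) : ℂ)) ?_ ?_ fun k => ?_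
    · simp only [Λ.finrank_one, Nat.cast_one]
    · simp only [Nat.reduceAdd, Λ.finrank_two]
    · exact_mod_cast Λ.finrank_add_two (k + 1)
  have := Λ.subsingleton
  -- The shift by one skips `X 0 = 0`, which serves as `V (-1)`: the rule for `V 1 ⊗ V 0` is the
  -- general one with a zero summand.
  refine ⟨fun k => Λ.rep (k + 1), Λ.equivalent_trivial, Λ.equivalent_fundamental,
    fun k => Λ.isIrreducible_rep _, fun j k h => Nat.succ_injective (Λ.eq_of_equivalent h),
    fun W hW => ?_, Λ.exists_isCompl,
    (Λ.equivalent_tensor 0).trans (URep.equivalent_sum_of_subsingleton (Λ.rep 2) (Λ.rep 0)),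
    fun k => Λ.equivalent_tensor (k + 1), ?_, Λ.finrank_one, Λ.finrank_two,
    fun k => Λ.finrank_add_two (k + 1), hdim, ?_, fun θ hθ hsin k => ?_⟩
  · obtain ⟨m, hm⟩ := Λ.exists_equivalent_rep W hW
    rcases m with _ | m
    · obtain ⟨e, -⟩ := hm
      have := hW.1
      exact absurd (e.symm.toEquiv.subsingleton_congr.mp Λ.subsingleton)
        (not_subsingleton W.carrier)
    · exact ⟨m, hm⟩
  · obtain ⟨e, he⟩ := Λ.exists_ringEquiv hn
    obtain ⟨e', he'⟩ := SlRep.exists_ringEquiv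
    -- Both rings are `ℤ[X]`, and both classes of index `k` correspond to `S k`.
    refine ⟨e.symm.trans e', fun k => ⟨SlRep.irr k, SlRep.isIrreducible_irr k,
      Truncated.finrank_eq k, ?_⟩⟩
    rw [RingEquiv.trans_apply, ← he, RingEquiv.symm_apply_apply, he']
  · obtain ⟨θ, hθ⟩ := Complex.cos_surjective ((n : ℂ) / 2)
    exact ⟨θ, by rw [hθ]; ring⟩
  · have h := Polynomial.Chebyshev.U_complex_cos θ (k : ℤ)
    rw [hdim, hθ, mul_div_cancel_left₀ _ two_ne_zero, eq_div_iff hsin, h]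
    push_cast
    rfl
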